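/- Let $p$ be a prime. A $\delta$-structure on a commutative ring $B$ is a map $\delta:B\to B$ with $\delta(0)=\delta(1)=0$, $\delta(a+b)=\delta(a)+\delta(b)-\sum_{0<i<p}\frac1p\binom pi a^ib^{p-i}$ and $\delta(ab)=a^p\delta(b)+b^p\delta(a)+p\,\delta(a)\delta(b)$; put $\phi(b)=b^p+p\,\delta(b)$. Let $R$ be a commutative $\mathbb Z_p[[q-1]]$-algebra with a $\delta$-structure such that $\delta(q)=0$ (where $q$ also denotes its image in $R$), and call $\delta$-$R$-algebra a commutative $R$-algebra with a $\delta$-structure such that the structure map commutes with $\delta$; morphisms of such are the $R$-algebra morphisms commuting with $\delta$. Write $(n)_q=1+q+\dots+q^{n-1}$ and let $\binom nk_q$ be the $q$-binomial coefficients. A $q$-PD-pair is a $\delta$-$R$-algebra $B$ without $(p)_q$-torsion together with an ideal $J$ such that $\phi(J)\subseteq (p)_qB$. We call $J$ $\gamma$-stable if $\phi(f)-(p)_q\delta(f)\in (p)_qJ$ for all $f\in J$. Let $A$ be a $\delta$-$R$-algebra without $(p)_q$-torsion, let $x\in A$ satisfy $\delta(x)=0$, and put $y=(1-q)x$. Let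 $A\langle\xi\rangle_{q,y}$ be the free $A$-module on symbols $\xi^{[n]}$, $n\ge 0$, with the commutative $A$-algebra structure with unit $\xi^{[0]}$ given by $$\xi^{[n]}\xi^{[m]}=\sum_{i=0}^{\min(m,n)}(-1)^iq^{\frac{i(i-1)}2}\binom{m+n-i}{m}_q\binom mi_q\,y^i\,\xi^{[m+n-i]},$$ and let $I^{[1]}$ be its ideal which is the $A$-span of the $\xi^{[k]}$, $k\ge 1$. Then: 1. There is a unique $\delta$-structure on $A[\xi]$ that extends that of $A$ and satisfies $\delta(\xi)=\sum_{1\le i\le p-1}\frac1p\binom pi x^{p-i}\xi^i$. 2. With this $\delta$-structure on $A[\xi]$, the pair $(A\langle\xi\rangle_{q,y},I^{[1]})$ is the $q$-PD-envelope of $(A[\xi],(\xi))$. That is, there is a $\delta$-structure on $A\langle\xi\rangle_{q,y}$ for which $(A\langle\xi\rangle_{q,y},I^{[1]})$ is a $q$-PD-pair with $I^{[1]}$ $\gamma$-stable, the $A$-algebra morphism $A[\xi]\to A\langle\xi\rangle_{q,y}$, $\xi\mapsto\xi^{[1]}$, commutes with $\delta$ (and sends $(\xi)$ into $I^{[1]}$),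 and every morphism of $\delta$-$R$-algebras $u:A[\xi]\to B$ with $u(\xi)\in J$, where $(B,J)$ is a $q$-PD-pair, extends uniquely to a morphism of $\delta$-$R$-algebras $v:A\langle\xi\rangle_{q,y}\to B$. If moreover $J$ is $\gamma$-stable, then $v(I^{[1]})\subseteq J$. -/

import Mathlib

universe uR uA uC uD w

namespace QDiv

/-! ### `q`-integers, `q`-factorials, `q`-binomial coefficients -/

section QNumbers

variable {A : Type*} [CommRing A]

/-- The `q`-integer `(n)_q = 1 + q + ⋯ + q^(n-1)`, i.e. `(u^n - 1)/(u - 1) ∈ ℤ[u]` at `u = q`. -/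
def qInt (q : A) (n : ℕ) : A := ∑ i ∈ Finset.range n, q ^ i

/-- The `q`-factorial `(n)_q! = (1)_q (2)_q ⋯ (n)_q`. -/
def qFact (q : A) (n : ℕ) : A := ∏ i ∈ Finset.range n, qInt q (i + 1)

/-- The `q`-binomial coefficient: the polynomial `(n)_u! / ((k)_u! (n-k)_u!) ∈ ℤ[u]` at `u = q`
(and `0` if `k > n`), computed by the `q`-Pascal rule; see `qBinom_mul_qFact`. -/
def qBinom (q : A) : ℕ → ℕ → A
  | _, 0 => 1
  | 0, _ + 1 => 0
  | n + 1, k + 1 => qBinom q n k + q ^ (k + 1) * qBinom q n (k + 1)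

theorem qInt_succ (q : A) (n : ℕ) : qInt q (n + 1) = qInt q n + q ^ n := by
  simp [qInt, Finset.sum_range_succ]

theorem qInt_add (q : A) (m n : ℕ) : qInt q (m + n) = qInt q m + q ^ m * qInt q n := by
  simp [qInt, Finset.sum_range_add, pow_add, Finset.mul_sum]

theorem qFact_succ (q : A) (n : ℕ) : qFact q (n + 1) = qFact q n * qInt q (n + 1) := by
  simp [qFact, Finset.prod_range_succ]

@[simp] theorem qBinom_zero_right (q : A) (n : ℕ) : qBinom q n 0 = 1 := by
  cases n <;> simp [qBinom]

theorem qBinom_eq_zero (q : A) : ∀ {n k : ℕ}, n < k → qBinom q n k = 0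
  | 0, k + 1, _ => by simp [qBinom]
  | n + 1, k + 1, h => by
      simp [qBinom, qBinom_eq_zero q (show n < k by omega),
        qBinom_eq_zero q (show n < k + 1 by omega)]

/-- `(k)_q! (j)_q!` times the `q`-binomial coefficient of `k + j` over `k` is `(k + j)_q!`. -/
theorem qBinom_mul_qFact (q : A) (k j : ℕ) :
    qBinom q (k + j) k * (qFact q k * qFact q j) = qFact q (k + j) := by
  induction k generalizing j with
  | zero => simp [qFact]
  | succ k ihk =>
    induction j with
    | zero =>
      have h := ihk 0
      simp only [Nat.add_zero] at h ⊢
      rw [qBinom, qBinom_eq_zero q (Nat.lt_succ_self k), qFact_succ]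
      linear_combination qInt q (k + 1) * h
    | succ j ihj =>
      have h1 := ihk (j + 1)
      have e1 : k + 1 + (j + 1) = (k + (j + 1)) + 1 := by omega
      have e2 : k + 1 + j = k + (j + 1) := by omega
      rw [e2] at ihj
      rw [e1, qBinom, qFact_succ q (k + (j + 1))]
      have e3 : qInt q (k + (j + 1) + 1) = qInt q (k + 1) + q ^ (k + 1) * qInt q (j + 1) := by
        rw [← qInt_add]; congr 1; omega
      rw [e3, mul_add, ← mul_assoc]
      conv_rhs => rw [← h1]
      have : qBinom q (k + (j + 1)) (k + 1) * (qFact q (k + 1) * qFact q (j + 1))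
          = qFact q (k + (j + 1)) * qInt q (j + 1) := by
        rw [← ihj, qFact_succ q j]; ring
      have h2 : qFact q (k + (j+1)) * (q ^ (k + 1) * qInt q (j + 1)) =
          q ^ (k + 1) * (qBinom q (k + (j + 1)) (k + 1) * (qFact q (k + 1) * qFact q (j + 1))) := by
        rw [this]; ring
      rw [h1, h2, ← h1, qFact_succ q k]; ring

theorem map_qInt {B : Type*} [CommRing B] (f : A →+* B) (q : A) (n : ℕ) :
    f (qInt q n) = qInt (f q) n := by
  simp [qInt]

theorem map_qBinom {B : Type*} [CommRing B] (f : A →+* B) (q : A) :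
    ∀ n k : ℕ, f (qBinom q n k) = qBinom (f q) n k
  | n, 0 => by simp
  | 0, k + 1 => by simp [qBinom]
  | n + 1, k + 1 => by simp [qBinom, map_qBinom f q n k, map_qBinom f q n (k + 1)]

end QNumbers

/-! ### The ring of `q`-divided power polynomials -/

/-- `A⟨ξ⟩_{q,y}`: the free `A`-module on generators `ξ^[n]`, `n ∈ ℕ`. -/
def QDPoly (A : Type*) [CommRing A] (_q _y : A) : Type _ := ℕ →₀ A

namespace QDPoly

variable {A : Type*} [CommRing A] {q y : A}

noncomputable instance : AddCommGroup (QDPoly A q y) := inferInstanceAs (AddCommGroup (ℕ →₀ A))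

noncomputable instance {S : Type*} [CommSemiring S] [Algebra S A] : Module S (QDPoly A q y) :=
  inferInstanceAs (Module S (ℕ →₀ A))

/-- The generators `ξ^[n]` as an `A`-basis of `A⟨ξ⟩_{q,y}`. -/
noncomputable def basis (A : Type*) [CommRing A] (q y : A) : Module.Basis ℕ A (QDPoly A q y) :=
  Module.Basis.ofRepr (LinearEquiv.refl A (ℕ →₀ A))

/-- The generator `ξ^[n]`. -/
noncomputable def dp (q y : A) (n : ℕ) : QDPoly A q y := basis A q y n

/-- The coefficient of `ξ^[m+n-i]` in `ξ^[n] ξ^[m]`. -/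
def coef (q y : A) (m n i : ℕ) : A :=
  (-1) ^ i * q ^ (i * (i - 1) / 2) * qBinom q (m + n - i) m * qBinom q m i * y ^ i

/-- Multiplication by `ξ^[m]`. -/
noncomputable def mulDp (q y : A) (m : ℕ) : QDPoly A q y →ₗ[A] QDPoly A q y :=
  (basis A q y).constr A fun n =>
    ∑ i ∈ Finset.range (min m n + 1), coef q y m n i • dp q y (m + n - i)

/-- The `A`-bilinear multiplication with
`ξ^[n] ξ^[m] = ∑ i ≤ min m n, (-1)^i q^(i(i-1)/2) [m+n-i, m]_q [m, i]_q y^i ξ^[m+n-i]`. -/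
noncomputable def mulLin (q y : A) : QDPoly A q y →ₗ[A] QDPoly A q y →ₗ[A] QDPoly A q y :=
  (basis A q y).constr A fun m => mulDp q y m

theorem mulLin_dp (m : ℕ) : mulLin q y (dp q y m) = mulDp q y m := by
  simp [mulLin, dp]

theorem mulDp_dp (m n : ℕ) : mulDp q y m (dp q y n) =
    ∑ i ∈ Finset.range (min m n + 1), coef q y m n i • dp q y (m + n - i) := by
  simp [mulDp, dp]

theorem coef_eq_zero_of_left {m n i : ℕ} (h : m < i) : coef q y m n i = 0 := by
  simp [coef, qBinom_eq_zero q h]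

theorem coef_eq_zero_of_right {m n i : ℕ} (h : n < i) : coef q y m n i = 0 := by
  by_cases hm : m < i
  · exact coef_eq_zero_of_left hm
  · simp [coef, qBinom_eq_zero q (show m + n - i < m by omega)]

theorem mulDp_dp' (m n : ℕ) {N : ℕ} (hN : min m n < N) : mulDp q y m (dp q y n) =
    ∑ i ∈ Finset.range N, coef q y m n i • dp q y (m + n - i) := by
  rw [mulDp_dp]
  apply Finset.sum_subset
  · intro i hi
    simp only [Finset.mem_range] at hi ⊢
    omega
  · intro i _ hi
    simp only [Finset.mem_range, not_lt] at hi
    rcases lt_or_ge m i with h | h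
    · rw [coef_eq_zero_of_left h, zero_smul]
    · rw [coef_eq_zero_of_right (by omega), zero_smul]

theorem mulDp_zero : mulDp q y 0 = LinearMap.id := by
  apply (basis A q y).ext
  intro n
  have := mulDp_dp (q := q) (y := y) 0 n
  simpa [coef, dp] using this

theorem mulDp_dp_zero (m : ℕ) : mulDp q y m (dp q y 0) = dp q y m := by
  have h : qBinom q m m = 1 := by
    induction m with
    | zero => simp
    | succ m ih => simp [qBinom, ih, qBinom_eq_zero q (Nat.lt_succ_self m)]
  rw [mulDp_dp]
  simp [coef, h]

theorem mulDp_one_dp (n : ℕ) : mulDp q y 1 (dp q y n) =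
    qInt q (n + 1) • dp q y (n + 1) - (qInt q n * y) • dp q y n := by
  have h : ∀ n, qBinom q n 1 = qInt q n := by
    intro n
    induction n with
    | zero => simp [qBinom, qInt]
    | succ n ih =>
      rw [qBinom, ih, add_comm n 1, qInt_add]
      simp [qInt]
  rw [mulDp_dp' 1 n (N := 2) (by omega)]
  simp [Finset.sum_range_succ, coef, h, add_comm 1 n, qBinom, qInt_succ, sub_eq_add_neg]

section Generic

variable [IsDomain A]

theorem qFact_ne_zero (hq : ∀ n, qInt q (n + 1) ≠ 0) (n : ℕ) : qFact q n ≠ 0 :=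
  Finset.prod_ne_zero_iff.mpr fun i _ => hq i

theorem absorb₁ (hq : ∀ n, qInt q (n + 1) ≠ 0) (m s : ℕ) :
    qInt q (m + 1) * qBinom q (m + s + 1) (m + 1) = qInt q (m + s + 1) * qBinom q (m + s) m := by
  have h1 := qBinom_mul_qFact q (m + 1) s
  have h2 := qBinom_mul_qFact q m s
  rw [show m + 1 + s = m + s + 1 by omega, qFact_succ, qFact_succ, ← h2] at h1
  apply mul_right_cancel₀ (mul_ne_zero (qFact_ne_zero hq m) (qFact_ne_zero hq s))
  linear_combination h1

theorem absorb₂ (hq : ∀ n, qInt q (n + 1) ≠ 0) (m s : ℕ) :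
    qInt q (s + 1) * qBinom q (m + s + 1) m = qInt q (m + s + 1) * qBinom q (m + s) m := by
  have h1 := qBinom_mul_qFact q m (s + 1)
  have h2 := qBinom_mul_qFact q m s
  rw [show m + (s + 1) = m + s + 1 by omega, qFact_succ, qFact_succ, ← h2] at h1
  apply mul_right_cancel₀ (mul_ne_zero (qFact_ne_zero hq m) (qFact_ne_zero hq s))
  linear_combination h1

theorem pascal' (hq : ∀ n, qInt q (n + 1) ≠ 0) (i j : ℕ) :
    qBinom q (i + j + 1) (i + 1) = qBinom q (i + j) (i + 1) + q ^ j * qBinom q (i + j) i := by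
  apply mul_left_cancel₀ (hq i)
  rw [mul_add, absorb₁ hq]
  have h : qInt q (i + 1) * qBinom q (i + j) (i + 1) = qInt q j * qBinom q (i + j) i := by
    cases j with
    | zero => simp [qBinom_eq_zero q (Nat.lt_succ_self i), qInt]
    | succ j =>
      have h1 := absorb₁ hq i j
      have h2 := absorb₂ hq i j
      rw [← add_assoc, h1, h2]
  rw [h, show i + j + 1 = j + (i + 1) by omega, qInt_add]
  ring

theorem coef_rec_zero (hq : ∀ n, qInt q (n + 1) ≠ 0) (m n : ℕ) :
    qInt q (m + 1) * coef q y (m + 1) n 0 = coef q y m n 0 * qInt q (m + n + 1) := by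
  have := absorb₁ hq m n
  simp only [coef, Nat.sub_zero, qBinom_zero_right]
  rw [show m + 1 + n = m + n + 1 by omega]
  linear_combination this

theorem coef_rec_succ (hq : ∀ n, qInt q (n + 1) ≠ 0) (m n i : ℕ) (him : i ≤ m) :
    qInt q (m + 1) * coef q y (m + 1) n (i + 1) =
      coef q y m n (i + 1) * qInt q (m + n - (i + 1) + 1) +
        coef q y m n i * ((qInt q m - qInt q (m + n - i)) * y) := by
  rcases lt_trichotomy n i with h | h | h
  · simp [coef_eq_zero_of_right h, coef_eq_zero_of_right (show n < i + 1 by omega)]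
  · subst h
    simp [coef_eq_zero_of_right (Nat.lt_succ_self n)]
  · obtain ⟨s, rfl⟩ : ∃ s, n = i + 1 + s := ⟨n - (i + 1), by omega⟩
    obtain ⟨j, rfl⟩ : ∃ j, m = i + j := ⟨m - i, by omega⟩
    have a1 := absorb₁ hq (i + j) s
    have a2 := absorb₂ hq (i + j) s
    have a3 := pascal' hq i j
    have e1 : i + j + 1 + (i + 1 + s) - (i + 1) = i + j + s + 1 := by omega
    have e2 : i + j + (i + 1 + s) - (i + 1) = i + j + s := by omega
    have e3 : i + j + (i + 1 + s) - i = i + j + s + 1 := by omega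
    have e4 : (i + 1) * (i + 1 - 1) / 2 = i * (i - 1) / 2 + i := by
      have := Nat.triangle_succ i
      simpa using this
    have e5 : qInt q (i + j + s + 1) = qInt q (i + j) + q ^ (i + j) * qInt q (s + 1) := by
      rw [← qInt_add]; rfl
    have e6 : qInt q (i + j) - qInt q (i + j + s + 1) = - (q ^ (i + j) * qInt q (s + 1)) := by
      rw [e5]; ring
    simp only [coef, e1, e2, e3, e4, e6]
    generalize hE : i * (i - 1) / 2 = E
    rw [a3]
    simp only [pow_succ, pow_add]
    linear_combination
      (-1) ^ i * (-1) * (q ^ E * q ^ i) * (y ^ i * y) *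
        (qBinom q (i + j) (i + 1) + q ^ j * qBinom q (i + j) i) * a1
      + (-1) ^ i * (q ^ E * q ^ i) * q ^ j * (y ^ i * y) * qBinom q (i + j) i * a2

theorem mulDp_succ (hq : ∀ n, qInt q (n + 1) ≠ 0) (m : ℕ) :
    qInt q (m + 1) • mulDp q y (m + 1) =
      mulDp q y 1 ∘ₗ mulDp q y m + (qInt q m * y) • mulDp q y m := by
  apply (basis A q y).ext
  intro n
  change qInt q (m + 1) • mulDp q y (m + 1) (dp q y n) =
    mulDp q y 1 (mulDp q y m (dp q y n)) + (qInt q m * y) • mulDp q y m (dp q y n)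
  have hR : mulDp q y 1 (mulDp q y m (dp q y n)) + (qInt q m * y) • mulDp q y m (dp q y n) =
      ∑ i ∈ Finset.range (m + 2), (coef q y m n i * qInt q (m + n - i + 1)) • dp q y (m + n - i + 1)
      + ∑ i ∈ Finset.range (m + 1), (coef q y m n i * ((qInt q m - qInt q (m + n - i)) * y)) •
          dp q y (m + n - i) := by
    rw [Finset.sum_range_succ _ (m + 1), coef_eq_zero_of_left (Nat.lt_succ_self m),
      mulDp_dp' m n (N := m + 1) (by omega), map_sum, Finset.smul_sum, ← Finset.sum_add_distrib,
      zero_mul, zero_smul, add_zero, ← Finset.sum_add_distrib]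
    refine Finset.sum_congr rfl fun i _ => ?_
    rw [map_smul, mulDp_one_dp]
    module
  rw [hR, mulDp_dp' (m + 1) n (N := m + 2) (by omega), Finset.sum_range_succ' _ (m + 1),
    Finset.sum_range_succ' _ (m + 1), smul_add, Finset.smul_sum]
  have h0 : qInt q (m + 1) • coef q y (m + 1) n 0 • dp q y (m + 1 + n - 0) =
      (coef q y m n 0 * qInt q (m + n - 0 + 1)) • dp q y (m + n - 0 + 1) := by
    rw [smul_smul, coef_rec_zero hq]
    congr 2; omega
  rw [h0]
  conv_rhs => rw [add_right_comm, ← Finset.sum_add_distrib]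
  congr 1
  refine Finset.sum_congr rfl fun i hi => ?_
  have hi' : i ≤ m := by simpa [Nat.lt_succ_iff] using hi
  rw [smul_smul, coef_rec_succ hq m n i hi', add_smul,
    show m + 1 + n - (i + 1) = m + n - i by omega]
  congr 1
  by_cases h : i + 1 ≤ m + n
  · congr 2; omega
  · rw [coef_eq_zero_of_right (show n < i + 1 by omega)]; simp

theorem smul_injective {a : A} (ha : a ≠ 0) {f g : Module.End A (QDPoly A q y)}
    (h : a • f = a • g) : f = g := by
  ext z
  have h1 : a • f z = a • g z := by
    simpa using congrArg (fun F : Module.End A (QDPoly A q y) => F z) h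
  apply (basis A q y).repr.injective
  ext n
  have h2 := congrArg (fun w => (basis A q y).repr w n) h1
  simpa [ha] using h2

theorem commute_mulDp (hq : ∀ n, qInt q (n + 1) ≠ 0) {S : Module.End A (QDPoly A q y)}
    (hS : Commute S (mulDp q y 1 : Module.End A (QDPoly A q y))) (m : ℕ) :
    Commute S (mulDp q y m : Module.End A (QDPoly A q y)) := by
  induction m with
  | zero =>
    rw [mulDp_zero]
    exact Commute.one_right S
  | succ m ih =>
    have key : Commute S (qInt q (m + 1) • (mulDp q y (m + 1) : Module.End A (QDPoly A q y))) := by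
      rw [mulDp_succ hq]
      exact (hS.mul_right ih).add_right (ih.smul_right _)
    apply smul_injective (hq m)
    simpa [Commute, SemiconjBy] using key

theorem mulDp_comm_generic (hq : ∀ n, qInt q (n + 1) ≠ 0) (m n : ℕ) (z : QDPoly A q y) :
    mulDp q y m (mulDp q y n z) = mulDp q y n (mulDp q y m z) := by
  have h1 : Commute (mulDp q y m : Module.End A (QDPoly A q y)) (mulDp q y 1) :=
    (commute_mulDp hq (Commute.refl _) m).symm
  exact congrArg (fun F : Module.End A (QDPoly A q y) => F z) (commute_mulDp hq h1 n).eq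

end Generic

@[elab_as_elim]
theorem dp_induction {P : QDPoly A q y → Prop} (z : QDPoly A q y) (h0 : P 0)
    (hadd : ∀ a b, P a → P b → P (a + b)) (hsmul : ∀ (r : A) (n : ℕ), P (r • dp q y n)) : P z := by
  refine Finsupp.induction_linear (motive := P) z h0 (fun a b => hadd a b) fun n r => ?_
  have h := hsmul r n
  have e : r • dp q y n = (Finsupp.single n r : ℕ →₀ A) := by
    change r • (Finsupp.single n (1 : A)) = Finsupp.single n r
    simp
  rwa [e] at h

/-- Change of coefficients along a ring homomorphism. -/
noncomputable def mapCoeff {K : Type*} [CommRing K] (f : K →+* A) (Q Y : K) (q y : A) :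
    QDPoly K Q Y →+ QDPoly A q y :=
  (Finsupp.mapRange.addMonoidHom f.toAddMonoidHom : (ℕ →₀ K) →+ (ℕ →₀ A))

theorem mapCoeff_smul_dp {K : Type*} [CommRing K] (f : K →+* A) (Q Y : K) (c : K) (n : ℕ) :
    mapCoeff f Q Y q y (c • dp Q Y n) = f c • dp q y n := by
  change Finsupp.mapRange f (map_zero f) (c • Finsupp.single n (1 : K)) =
    f c • Finsupp.single n (1 : A)
  simp

theorem mapCoeff_mulDp {K : Type*} [CommRing K] (f : K →+* A) {Q Y : K} (hQ : f Q = q)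
    (hY : f Y = y) (m : ℕ) (z : QDPoly K Q Y) :
    mapCoeff f Q Y q y (mulDp Q Y m z) = mulDp q y m (mapCoeff f Q Y q y z) := by
  refine dp_induction z ?_ (fun a b ha hb => ?_) fun c n => ?_
  · simp
  · simp only [map_add, ha, hb]
  rw [mapCoeff_smul_dp, map_smul (mulDp q y m), map_smul (mulDp Q Y m), mulDp_dp, mulDp_dp, Finset.smul_sum, Finset.smul_sum,
    map_sum]
  refine Finset.sum_congr rfl fun i _ => ?_
  rw [smul_smul, smul_smul, mapCoeff_smul_dp, map_mul]
  congr 2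
  simp [coef, map_qBinom, hQ, hY]

theorem mulDp_comm_dp (m n l : ℕ) :
    mulDp q y m (mulDp q y n (dp q y l)) = mulDp q y n (mulDp q y m (dp q y l)) := by
  let K := MvPolynomial (Fin 2) ℤ
  let Q : K := MvPolynomial.X 0
  let Y : K := MvPolynomial.X 1
  let f : K →+* A := MvPolynomial.eval₂Hom (Int.castRingHom A) ![q, y]
  have hQ : f Q = q := by
    change (MvPolynomial.eval₂Hom (Int.castRingHom A) ![q, y]) (MvPolynomial.X 0) = q
    rw [MvPolynomial.eval₂Hom_X']
    rfl
  have hY : f Y = y := by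
    change (MvPolynomial.eval₂Hom (Int.castRingHom A) ![q, y]) (MvPolynomial.X 1) = y
    rw [MvPolynomial.eval₂Hom_X']
    rfl
  have hq : ∀ n, qInt Q (n + 1) ≠ 0 := by
    intro n h
    have h1 := congrArg (MvPolynomial.eval₂Hom (Int.castRingHom ℤ) ![1, 0]) h
    rw [map_qInt] at h1
    simp [Q, qInt] at h1
    omega
  have h := congrArg (mapCoeff f Q Y q y) (mulDp_comm_generic (y := Y) hq m n (dp Q Y l))
  have hl : mapCoeff f Q Y q y (dp Q Y l) = dp q y l := by
    have := mapCoeff_smul_dp (q := q) (y := y) f Q Y 1 l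
    simpa using this
  simpa only [mapCoeff_mulDp f hQ hY, hl] using h

theorem mulDp_comm (m n : ℕ) (z : QDPoly A q y) :
    mulDp q y m (mulDp q y n z) = mulDp q y n (mulDp q y m z) := by
  have : mulDp q y m ∘ₗ mulDp q y n = mulDp q y n ∘ₗ mulDp q y m :=
    (basis A q y).ext fun l => mulDp_comm_dp m n l
  exact congrArg (fun F : QDPoly A q y →ₗ[A] QDPoly A q y => F z) this

theorem mulLin_comm (a b : QDPoly A q y) : mulLin q y a b = mulLin q y b a := by
  have h : mulLin q y = (mulLin q y).flip := by
    refine (basis A q y).ext fun m => (basis A q y).ext fun n => ?_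
    change mulLin q y (dp q y m) (dp q y n) = mulLin q y (dp q y n) (dp q y m)
    rw [mulLin_dp, mulLin_dp, ← mulDp_dp_zero n, mulDp_comm, mulDp_dp_zero]
  exact congrArg (fun F : QDPoly A q y →ₗ[A] QDPoly A q y →ₗ[A] QDPoly A q y => F a b) h

theorem mulLin_left_comm (a b c : QDPoly A q y) :
    mulLin q y a (mulLin q y b c) = mulLin q y b (mulLin q y a c) := by
  refine dp_induction a ?_ (fun _ _ ha hb => ?_) fun r m => ?_
  · simp
  · simp only [map_add, LinearMap.add_apply, ha, hb]
  simp only [map_smul, LinearMap.smul_apply]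
  congr 1
  refine dp_induction b ?_ (fun _ _ ha hb => ?_) fun r n => ?_
  · simp
  · simp only [map_add, LinearMap.add_apply, ha, hb]
  simp only [map_smul, LinearMap.smul_apply, mulLin_dp, mulDp_comm m n c]

noncomputable instance : CommRing (QDPoly A q y) :=
  { (inferInstance : AddCommGroup (QDPoly A q y)) with
    mul := fun a b => mulLin q y a b
    one := dp q y 0
    left_distrib := fun a b c => map_add (mulLin q y a) b c
    right_distrib := fun a b c => LinearMap.map_add₂ (mulLin q y) a b c
    zero_mul := fun a => LinearMap.map_zero₂ (mulLin q y) a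
    mul_zero := fun a => map_zero (mulLin q y a)
    mul_assoc := fun a b c => by
      change mulLin q y (mulLin q y a b) c = mulLin q y a (mulLin q y b c)
      rw [mulLin_comm _ c, mulLin_left_comm, mulLin_comm c b]
    one_mul := fun a => by
      change mulLin q y (dp q y 0) a = a
      rw [mulLin_dp, mulDp_zero]; rfl
    mul_one := fun a => by
      change mulLin q y a (dp q y 0) = a
      rw [mulLin_comm, mulLin_dp, mulDp_zero]; rfl
    mul_comm := mulLin_comm }

theorem mul_def (a b : QDPoly A q y) : a * b = mulLin q y a b := rfl

theorem one_def : (1 : QDPoly A q y) = dp q y 0 := rfl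

theorem dp_mul_dp (n m : ℕ) : dp q y n * dp q y m = ∑ i ∈ Finset.range (min m n + 1),
    ((-1) ^ i * q ^ (i * (i - 1) / 2) * qBinom q (m + n - i) m * qBinom q m i * y ^ i) •
      dp q y (m + n - i) := by
  rw [mul_comm, mul_def, mulLin_dp, mulDp_dp]
  rfl

section Scalars

variable {S : Type*} [CommSemiring S] [Algebra S A]

noncomputable instance : IsScalarTower S A (QDPoly A q y) :=
  inferInstanceAs (IsScalarTower S A (ℕ →₀ A))

noncomputable instance : Algebra S (QDPoly A q y) :=
  Algebra.ofModule
    (fun r a b => by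
      rw [← algebraMap_smul A r a, ← algebraMap_smul A r (a * b)]
      exact LinearMap.map_smul₂ (mulLin q y) _ a b)
    (fun r a b => by
      rw [← algebraMap_smul A r b, ← algebraMap_smul A r (a * b)]
      exact map_smul (mulLin q y a) _ b)

end Scalars

/-- The ideal `I^[n]` of `A⟨ξ⟩_{q,y}`: the free `A`-submodule generated by the `ξ^[k]`, `k ≥ n`. -/
noncomputable def filt (q y : A) (n : ℕ) : Ideal (QDPoly A q y) where
  carrier := Submodule.span A {z | ∃ k, n ≤ k ∧ dp q y k = z}
  add_mem' := fun ha hb => add_mem ha hb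
  zero_mem' := zero_mem _
  smul_mem' := by
    intro c z hz
    change mulLin q y c z ∈ Submodule.span A {z | ∃ k, n ≤ k ∧ dp q y k = z}
    refine dp_induction c ?_ (fun a b ha hb => ?_) fun r m => ?_
    · simp
    · rw [map_add, LinearMap.add_apply]
      exact add_mem ha hb
    · rw [map_smul, LinearMap.smul_apply, mulLin_dp]
      refine Submodule.smul_mem _ _ ?_
      refine Submodule.span_induction (fun w hw => ?_) ?_ (fun a b _ _ ha hb => ?_)
        (fun s a _ ha => ?_) hz
      · obtain ⟨k, hk, rfl⟩ := hw
        rw [mulDp_dp]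
        refine Submodule.sum_mem _ fun i hi => Submodule.smul_mem _ _ (Submodule.subset_span ?_)
        rw [Finset.mem_range] at hi
        exact ⟨m + k - i, by omega, rfl⟩
      · simp
      · rw [map_add]; exact add_mem ha hb
      · rw [map_smul]; exact Submodule.smul_mem _ _ ha

end QDPoly

/-! ### `δ`-structures -/

/-- A `δ`-structure (with respect to `p`) on a commutative ring. For `0 < i < p` with `p` prime,
`p.choose i / p` is an exact division. -/
@[ext]
structure DeltaStructure (p : ℕ) (A : Type*) [CommRing A] where
  toFun : A → A
  map_zero' : toFun 0 = 0
  map_one' : toFun 1 = 0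
  map_add' : ∀ a b, toFun (a + b) = toFun a + toFun b -
    ∑ i ∈ Finset.Ico 1 p, ((p.choose i / p : ℕ) : A) * a ^ i * b ^ (p - i)
  map_mul' : ∀ a b, toFun (a * b) = a ^ p * toFun b + b ^ p * toFun a + p * toFun a * toFun b

instance (p : ℕ) (A : Type*) [CommRing A] : CoeFun (DeltaStructure p A) fun _ => A → A :=
  ⟨DeltaStructure.toFun⟩

/-- The lift of Frobenius `φ(a) = a^p + p δ(a)` of a `δ`-structure. -/
def DeltaStructure.frob {p : ℕ} {A : Type*} [CommRing A] (δ : DeltaStructure p A) (a : A) : A :=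
  a ^ p + p * δ a

/-- The map `f` is compatible with the `δ`-structures. -/
def IsDeltaHom {p : ℕ} {A B : Type*} [CommRing A] [CommRing B] (δA : DeltaStructure p A)
    (δB : DeltaStructure p B) (f : A →+* B) : Prop :=
  ∀ a, f (δA a) = δB (f a)

/-- `δP` is a `δ`-structure on `A[ξ]` that extends the one of `A` and satisfies
`δ(ξ) = ∑ 1 ≤ i ≤ p - 1, (1/p) (p choose i) x^(p-i) ξ^i`. -/
def IsPolyDelta {p : ℕ} {A : Type*} [CommRing A] (δA : DeltaStructure p A) (x : A)
    (δP : DeltaStructure p (Polynomial A)) : Prop :=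
  IsDeltaHom δA δP Polynomial.C ∧
    δP Polynomial.X = ∑ i ∈ Finset.Ico 1 p,
      Polynomial.C (((p.choose i / p : ℕ) : A) * x ^ (p - i)) * Polynomial.X ^ i

/-! ### `q`-PD-pairs and `q`-PD-envelopes -/

section Envelope

variable {p : ℕ} {R : Type*} [CommRing R]

/-- `B` has no `(p)_q`-torsion. -/
def IsTorsionFree (p : ℕ) (q : R) (B : Type*) [CommRing B] [Algebra R B] : Prop :=
  ∀ b : B, algebraMap R B (qInt q p) * b = 0 → b = 0

/-- `(B, J)` is a `q`-PD-pair over `(R, δR)`: `B` is a `δ`-`R`-algebra without `(p)_q`-torsion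
and `φ(J) ⊆ (p)_q B`. -/
structure IsQPDPair (δR : DeltaStructure p R) (q : R) {B : Type*} [CommRing B] [Algebra R B]
    (δB : DeltaStructure p B) (J : Ideal B) : Prop where
  algebraMap_delta : IsDeltaHom δR δB (algebraMap R B)
  torsionFree : IsTorsionFree p q B
  frob_mem : ∀ f ∈ J, algebraMap R B (qInt q p) ∣ δB.frob f

/-- The ideal `J` is stable under the operation `γ(f) = φ(f)/(p)_q - δ(f)`, that is,
`φ(f) - (p)_q δ(f) ∈ (p)_q J` for all `f ∈ J`. -/
def IsGammaStable (q : R) {B : Type*} [CommRing B] [Algebra R B]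
    (δB : DeltaStructure p B) (J : Ideal B) : Prop :=
  ∀ f ∈ J, ∃ g ∈ J,
    δB.frob f - algebraMap R B (qInt q p) * δB f = algebraMap R B (qInt q p) * g

/-- `ι : (C, I) → (D, K)` is the `q`-PD-envelope of the `δ`-pair `(C, I)` over `(R, δR)`.
Every morphism from `(C, I)` to a `q`-PD-pair `(B, J)` extends uniquely to the `δ`-ring `D`;
the extension sends `K` into `J` whenever `J` is `γ`-stable, as `K` itself is. -/
structure IsQPDEnvelope {R : Type uR} [CommRing R] (δR : DeltaStructure p R) (q : R)
    {C : Type uC} [CommRing C] [Algebra R C] (δC : DeltaStructure p C) (I : Ideal C)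
    {D : Type uD} [CommRing D] [Algebra R D] (δD : DeltaStructure p D) (K : Ideal D)
    (ι : C →ₐ[R] D) : Prop where
  isQPDPair : IsQPDPair δR q δD K
  isGammaStable : IsGammaStable q δD K
  isDeltaHom : IsDeltaHom δC δD (ι : C →+* D)
  map_le : I.map ι ≤ K
  existsUnique_lift : ∀ (B : Type w) [CommRing B] [Algebra R B] (δB : DeltaStructure p B)
    (J : Ideal B), IsQPDPair δR q δB J →
    ∀ u : C →ₐ[R] B, IsDeltaHom δC δB (u : C →+* B) → I.map u ≤ J →
      ∃! v : D →ₐ[R] B, IsDeltaHom δD δB (v : D →+* B) ∧ v.comp ι = u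
  lift_map_le : ∀ (B : Type w) [CommRing B] [Algebra R B] (δB : DeltaStructure p B)
    (J : Ideal B), IsQPDPair δR q δB J → IsGammaStable q δB J →
    ∀ v : D →ₐ[R] B, IsDeltaHom δD δB (v : D →+* B) → I.map (v.comp ι) ≤ J → K.map v ≤ J

end Envelope

/-- The canonical morphism `A[ξ] → A⟨ξ⟩_{q,y}` of `A`-algebras, `ξ ↦ ξ^[1]`. -/
noncomputable def QDPoly.ofPoly {A : Type*} [CommRing A] (q y : A) :
    Polynomial A →ₐ[A] QDPoly A q y :=
  Polynomial.aeval (QDPoly.dp q y 1)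

end QDiv

/-! A `δ`-structure on `B` is a ring section of the projection `W2 p B → B` from Witt vectors of
length two. Hence `δ`-structures, and compatibility with them, can be handled on ring generators;
this settles `A[ξ]` at once.

Existence of `δ` on `A⟨ξ⟩`. Put `X = ξ + x`; the prescribed values of `δ` on `ξ` and `x` give `δ(X)
= 0`, so `φ(X) = X^p`. The substitution `X ↦ qX` has a twisted derivation `∂` with `∂ ξ^[n+1] =
ξ^[n]`, and the chain rule `∂φ = (p)_q X^(p-1) φ∂` dictates `φ(ξ^[n+1]) = (p)_q ∫ X^(p-1) φ(ξ^[n])`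
(`frobDp`). Over the domain `ℤ[q][x]`, differentiating shows that `φ` is multiplicative
(`frobDp_rec`) and reduces to the `p`-th power modulo `p` (`natCast_dvd_frobDp_sub_pow`), so it
comes from a `δ`, which is then transported to `A` (`IsStandardDelta.baseChange`). The formula gives
`φ(I) ⊆ (p)_q I` for `I = I^[1]`; together with `δ(I) ⊆ I` this is `γ`-stability.

Uniqueness. Since `ℤ_p[[q-1]]` is local, an integral polynomial in `q` whose value at `q = 1` is
prime to `p` becomes a unit (`HasQUnits`). Let `P` be the largest power of `p` with `P ≤ n`. If `P <
n`, Lucas's theorem makes the leading coefficient of `ξ^[P] ξ^[n-P]` a unit. If `n = p^(k+1)`, that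
of `γ(ξ^[p^k])` is a unit, because `(p^(k+1))!/(p^k)!^p` is divisible by `p` exactly once. So `ξ`
generates `I` under `A`-combinations, products and `γ` (`dp_mem_of_gamma`), which gives uniqueness
and `v(I) ⊆ J`.

Existence of the extension. Neither `p` nor the `q`-factorials can be divided out in `B`. The images
`e_n` of `ξ^[n]` are solved for recursively: from `e_P e_(n-P)`, from `φ(u ξ)/(p)_q` when `n = p`,
and from `δ(e_(p^k))` when `n = p^(k+1)` with `k ≥ 1`. Multiplicativity is proved by induction on
the total degree `N`. The failures in degree `N` satisfy a cocycle identity, which reduces them to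
one relation. If `N` is not a power of `p`, it holds by construction; if `N = p^(k+1)`, it says that
`ξ^[p^k]^p` is sent to `e_(p^k)^p`. For `k = 0` this follows from `φ(ξ) = ξ^p + p δ(ξ)`. For `k ≥
1`, apply `δ` to `c ξ^[n] = t^p + L`, where `n = p^k`, `t = ξ^[p^(k-1)]` and `L` has degree `< n`:
the failure gets multiplied by a unit and must vanish (`map_dp_pow_pow`). -/

namespace QDiv

/-! ### Witt vectors of length two -/

section Carry

variable {p : ℕ} {A : Type*} [CommRing A]

/-- The polynomial `((a + b)^p - a^p - b^p) / p`. -/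
def carry (p : ℕ) {A : Type*} [CommRing A] (a b : A) : A :=
  ∑ i ∈ Finset.Ico 1 p, ((p.choose i / p : ℕ) : A) * a ^ i * b ^ (p - i)

theorem map_carry {B : Type*} [CommRing B] (f : A →+* B) (a b : A) :
    f (carry p a b) = carry p (f a) (f b) := by
  simp [carry]

theorem mul_choose_div_self [hp : Fact p.Prime] {i : ℕ} (hi : i ∈ Finset.Ico 1 p) :
    p * (p.choose i / p) = p.choose i := by
  rw [Finset.mem_Ico] at hi
  exact Nat.mul_div_cancel' (hp.out.dvd_choose_self (by omega) hi.2)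

theorem natCast_mul_carry [hp : Fact p.Prime] (a b : A) :
    (p : A) * carry p a b = (a + b) ^ p - a ^ p - b ^ p := by
  rw [add_pow, Finset.sum_range_succ, Finset.range_eq_Ico,
    Finset.sum_eq_sum_Ico_succ_bot hp.out.pos, carry, Finset.mul_sum]
  have : ∑ i ∈ Finset.Ico 1 p, (p : A) * (((p.choose i / p : ℕ) : A) * a ^ i * b ^ (p - i)) =
      ∑ i ∈ Finset.Ico 1 p, a ^ i * b ^ (p - i) * (p.choose i : A) := by
    refine Finset.sum_congr rfl fun i hi => ?_
    have h := congrArg (Nat.cast (R := A)) (mul_choose_div_self hi)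
    push_cast at h
    rw [← h]
    ring
  rw [this]
  simp

theorem carry_comm (a b : A) : carry p a b = carry p b a := by
  unfold carry
  refine Finset.sum_nbij' (fun i => p - i) (fun i => p - i) ?_ ?_ ?_ ?_ ?_ <;>
    intro i hi <;> rw [Finset.mem_Ico] at hi
  · rw [Finset.mem_Ico]; omega
  · rw [Finset.mem_Ico]; omega
  · omega
  · omega
  · rw [Nat.choose_symm hi.2.le, show p - (p - i) = i by omega]
    ring

@[simp] theorem carry_zero_left (b : A) : carry p 0 b = 0 := by
  refine Finset.sum_eq_zero fun i hi => ?_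
  rw [Finset.mem_Ico] at hi
  rw [zero_pow (by omega)]
  ring

@[simp] theorem carry_zero_right (a : A) : carry p a 0 = 0 := by
  rw [carry_comm, carry_zero_left]

theorem carry_mul_left (c a b : A) : carry p (c * a) (c * b) = c ^ p * carry p a b := by
  unfold carry
  rw [Finset.mul_sum]
  refine Finset.sum_congr rfl fun i hi => ?_
  rw [Finset.mem_Ico] at hi
  have : c ^ p = c ^ i * c ^ (p - i) := by rw [← pow_add]; congr 1; omega
  rw [this, mul_pow, mul_pow]
  ring

/-- After multiplication by `p` both sides telescope to `(a+b+c)^p - a^p - b^p - c^p`. The factor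
`p` may be cancelled over `ℤ[a,b,c]`, and the identity then specializes to any ring. -/
theorem carry_assoc [hp : Fact p.Prime] (a b c : A) :
    carry p a b + carry p (a + b) c = carry p b c + carry p a (b + c) := by
  have key : ∀ a b c : MvPolynomial (Fin 3) ℤ,
      carry p a b + carry p (a + b) c = carry p b c + carry p a (b + c) := by
    intro a b c
    have hp0 : (p : MvPolynomial (Fin 3) ℤ) ≠ 0 := Nat.cast_ne_zero.mpr hp.out.ne_zero
    apply mul_left_cancel₀ hp0
    simp only [mul_add, natCast_mul_carry]
    ring
  have h := congrArg (MvPolynomial.eval₂Hom (Int.castRingHom A) ![a, b, c])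
    (key (MvPolynomial.X 0) (MvPolynomial.X 1) (MvPolynomial.X 2))
  simpa only [map_add, map_carry, MvPolynomial.eval₂Hom_X', Matrix.cons_val] using h

end Carry

/-- The ring of `p`-typical Witt vectors of length two, in the coordinates in which the sections of
the projection to the first component are the maps `a ↦ (a, δ a)` for `δ`-structures `δ`. -/
@[ext]
structure W2 (p : ℕ) (A : Type*) where
  /-- the first component -/
  fst : A
  /-- the second component -/
  snd : A

namespace W2

variable {p : ℕ} {A : Type*} [CommRing A]

instance : Zero (W2 p A) := ⟨⟨0, 0⟩⟩
instance : One (W2 p A) := ⟨⟨1, 0⟩⟩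
instance : Add (W2 p A) := ⟨fun a b => ⟨a.fst + b.fst, a.snd + b.snd - carry p a.fst b.fst⟩⟩
instance : Neg (W2 p A) := ⟨fun a => ⟨-a.fst, carry p a.fst (-a.fst) - a.snd⟩⟩
instance : Mul (W2 p A) :=
  ⟨fun a b => ⟨a.fst * b.fst, a.fst ^ p * b.snd + b.fst ^ p * a.snd + p * a.snd * b.snd⟩⟩

@[simp] theorem zero_fst : (0 : W2 p A).fst = 0 := rfl
@[simp] theorem zero_snd : (0 : W2 p A).snd = 0 := rfl
@[simp] theorem one_fst : (1 : W2 p A).fst = 1 := rfl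
@[simp] theorem one_snd : (1 : W2 p A).snd = 0 := rfl
@[simp] theorem add_fst (a b : W2 p A) : (a + b).fst = a.fst + b.fst := rfl
@[simp] theorem add_snd (a b : W2 p A) :
    (a + b).snd = a.snd + b.snd - carry p a.fst b.fst := rfl
@[simp] theorem neg_fst (a : W2 p A) : (-a).fst = -a.fst := rfl
@[simp] theorem neg_snd (a : W2 p A) : (-a).snd = carry p a.fst (-a.fst) - a.snd := rfl
@[simp] theorem mul_fst (a b : W2 p A) : (a * b).fst = a.fst * b.fst := rfl
@[simp] theorem mul_snd (a b : W2 p A) :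
    (a * b).snd = a.fst ^ p * b.snd + b.fst ^ p * a.snd + p * a.snd * b.snd := rfl

variable [hp : Fact p.Prime]

instance : CommRing (W2 p A) where
  zero_add a := by ext <;> simp
  add_zero a := by ext <;> simp
  add_comm a b := by
    ext
    · simp [add_comm]
    · simp [add_comm a.snd, carry_comm a.fst]
  add_assoc a b c := by
    ext
    · simp [add_assoc]
    · have := carry_assoc (p := p) a.fst b.fst c.fst
      simp only [add_snd, add_fst]
      linear_combination -this
  neg_add_cancel a := by
    ext
    · simp
    · simp [carry_comm (-a.fst)]
  one_mul a := by ext <;> simp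
  mul_one a := by ext <;> simp
  zero_mul a := by ext <;> simp [hp.out.ne_zero]
  mul_zero a := by ext <;> simp [hp.out.ne_zero]
  mul_comm a b := by
    ext
    · simp [mul_comm]
    · simp only [mul_snd]; ring
  mul_assoc a b c := by
    ext
    · simp [mul_assoc]
    · simp only [mul_snd, mul_fst]; ring
  left_distrib a b c := by
    ext
    · simp [mul_add]
    -- The product creates a term `p · a.snd · carry`, which has to be traded for `p`-th powers.
    · have h := natCast_mul_carry (p := p) b.fst c.fst
      simp only [mul_snd, add_snd, add_fst, mul_fst, carry_mul_left]
      linear_combination (-a.snd) * h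
  right_distrib a b c := by
    ext
    · simp [add_mul]
    · have h := natCast_mul_carry (p := p) a.fst b.fst
      simp only [mul_snd, add_snd, add_fst, mul_fst, mul_comm _ c.fst, carry_mul_left]
      linear_combination (-c.snd) * h
  nsmul := nsmulRec
  zsmul := zsmulRec

/-- The projection to the first component. -/
@[simps]
def fstHom (p : ℕ) [Fact p.Prime] (A : Type*) [CommRing A] : W2 p A →+* A where
  toFun := fst
  map_zero' := rfl
  map_one' := rfl
  map_add' _ _ := rfl
  map_mul' _ _ := rfl

/-- Functoriality of Witt vectors of length two. -/
@[simps]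
def map (p : ℕ) [Fact p.Prime] {A B : Type*} [CommRing A] [CommRing B] (f : A →+* B) :
    W2 p A →+* W2 p B where
  toFun a := ⟨f a.fst, f a.snd⟩
  map_zero' := by ext <;> simp
  map_one' := by ext <;> simp
  map_add' _ _ := by ext <;> simp [map_carry]
  map_mul' _ _ := by ext <;> simp

end W2

/-! ### `δ`-structures as sections of `W2`, and from lifts of Frobenius -/

namespace DeltaStructure

variable {p : ℕ} {A : Type*} [CommRing A]

@[simp] theorem map_zero (δ : DeltaStructure p A) : δ 0 = 0 := δ.map_zero'
@[simp] theorem map_one (δ : DeltaStructure p A) : δ 1 = 0 := δ.map_one'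

theorem map_add (δ : DeltaStructure p A) (a b : A) : δ (a + b) = δ a + δ b - carry p a b :=
  δ.map_add' a b

theorem map_mul (δ : DeltaStructure p A) (a b : A) :
    δ (a * b) = a ^ p * δ b + b ^ p * δ a + p * δ a * δ b := δ.map_mul' a b

theorem frob_apply (δ : DeltaStructure p A) (a : A) : δ.frob a = a ^ p + p * δ a := rfl

variable [hp : Fact p.Prime]

/-- The section of the projection `W2 p A → A` attached to a `δ`-structure. -/
@[simps]
def toW2 (δ : DeltaStructure p A) : A →+* W2 p A where
  toFun a := ⟨a, δ a⟩
  map_zero' := by ext <;> simp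
  map_one' := by ext <;> simp
  map_add' a b := by ext <;> simp [map_add]
  map_mul' a b := by ext <;> simp [map_mul]

/-- The `δ`-structure attached to a section of the projection `W2 p A → A`. -/
@[simps]
def ofW2 (s : A →+* W2 p A) (hs : ∀ a, (s a).fst = a) : DeltaStructure p A where
  toFun a := (s a).snd
  map_zero' := by simp
  map_one' := by simp
  map_add' a b := by simp [hs, carry]
  map_mul' a b := by simp [hs]

/-- Compatibility with `δ` becomes an equality of two ring homomorphisms, so it can be checked on
ring generators. -/
theorem isDeltaHom_iff {B : Type*} [CommRing B] {δA : DeltaStructure p A} {δB : DeltaStructure p B}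
    {f : A →+* B} :
    IsDeltaHom δA δB f ↔ (W2.map p f).comp δA.toW2 = δB.toW2.comp f := by
  refine ⟨fun h => RingHom.ext fun a => ?_, fun h a => ?_⟩
  · ext
    · rfl
    · exact h a
  · exact congrArg W2.snd (RingHom.congr_fun h a)

/-- The lift of Frobenius as a ring homomorphism. -/
@[simps]
def frobHom (δ : DeltaStructure p A) : A →+* A where
  toFun := δ.frob
  map_zero' := by simp [frob, hp.out.ne_zero]
  map_one' := by simp [frob]
  map_add' a b := by
    have h := natCast_mul_carry (p := p) a b
    simp only [frob, map_add]
    linear_combination -h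
  map_mul' a b := by
    simp only [frob, map_mul]
    ring

/-- On a `p`-torsion-free ring, a lift of Frobenius comes from a `δ`-structure. -/
theorem exists_frob_eq (hp0 : ∀ a : A, (p : A) * a = 0 → a = 0) (φ : A →+* A)
    (hφ : ∀ a, (p : A) ∣ φ a - a ^ p) : ∃ δ : DeltaStructure p A, ∀ a, δ.frob a = φ a := by
  have hinj : ∀ a b : A, (p : A) * a = p * b → a = b := fun a b h =>
    sub_eq_zero.mp (hp0 _ (by rw [mul_sub, h, sub_self]))
  choose d hd using hφ
  refine ⟨⟨d, ?_, ?_, ?_, ?_⟩, fun a => ?_⟩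
  · apply hp0
    rw [← hd]
    simp [hp.out.ne_zero]
  · apply hp0
    rw [← hd]
    simp
  · intro a b
    have h := natCast_mul_carry (p := p) a b
    apply hinj
    change _ = (p : A) * (d a + d b - carry p a b)
    rw [mul_sub, mul_add, ← hd, ← hd, ← hd, h, _root_.map_add]
    ring
  · intro a b
    apply hinj
    have ha := hd a
    have hb := hd b
    rw [sub_eq_iff_eq_add] at ha hb
    rw [← hd, _root_.map_mul, ha, hb]
    ring
  · change a ^ p + p * d a = φ a
    rw [← hd]
    ring

end DeltaStructure
namespace QDPoly

variable {A : Type*} [CommRing A] {q y : A}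

/-! ### Coefficients -/

/-- The coefficient of `ξ^[n]`. -/
noncomputable def coeff (n : ℕ) : QDPoly A q y →ₗ[A] A := (basis A q y).coord n

theorem coeff_dp (m n : ℕ) : coeff n (dp q y m) = if m = n then 1 else 0 := by
  simp [coeff, dp, Finsupp.single_apply]

@[simp] theorem coeff_dp_self (n : ℕ) : coeff n (dp q y n) = 1 := by simp [coeff_dp]

theorem coeff_dp_of_ne {m n : ℕ} (h : m ≠ n) : coeff n (dp q y m) = 0 := by simp [coeff_dp, h]

theorem ext_coeff {z w : QDPoly A q y} (h : ∀ n, coeff n z = coeff n w) : z = w :=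
  (basis A q y).ext_elem h

/-- The element of the ring `QDPoly A q y` attached to a constant. -/
theorem algebraMap_apply {S : Type*} [CommSemiring S] [Algebra S A] (s : S) :
    algebraMap S (QDPoly A q y) s = s • (1 : QDPoly A q y) := Algebra.algebraMap_eq_smul_one s

theorem dp_zero : dp q y 0 = 1 := rfl

theorem dp_one_mul_dp (n : ℕ) : dp q y 1 * dp q y n =
    qInt q (n + 1) • dp q y (n + 1) - (qInt q n * y) • dp q y n := by
  rw [mul_def, mulLin_dp, mulDp_one_dp]

theorem dp_mul_dp_coef (n m : ℕ) : dp q y n * dp q y m =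
    ∑ i ∈ Finset.range (min m n + 1), coef q y m n i • dp q y (m + n - i) := by
  rw [mul_comm, mul_def, mulLin_dp, mulDp_dp]

/-! ### Filtration by the degree -/

/-- The submodule of elements of degree `< N`. -/
noncomputable def degLT (A : Type*) [CommRing A] (q y : A) (N : ℕ) :
    Submodule A (QDPoly A q y) where
  carrier := {z | ∀ k, N ≤ k → coeff k z = 0}
  add_mem' ha hb k hk := by rw [map_add, ha k hk, hb k hk, add_zero]
  zero_mem' k _ := map_zero _
  smul_mem' c z hz k hk := by rw [map_smul, hz k hk, smul_zero]

theorem degLT_mono {M N : ℕ} (h : M ≤ N) : degLT A q y M ≤ degLT A q y N :=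
  fun _ hz k hk => hz k (h.trans hk)

theorem dp_mem_degLT {n N : ℕ} (h : n < N) : dp q y n ∈ degLT A q y N :=
  fun k hk => coeff_dp_of_ne (by omega)

theorem one_mem_degLT {N : ℕ} (h : 0 < N) : (1 : QDPoly A q y) ∈ degLT A q y N := dp_mem_degLT h

theorem exists_mem_degLT (z : QDPoly A q y) : ∃ N, z ∈ degLT A q y N := by
  refine dp_induction z ⟨0, zero_mem _⟩ ?_ ?_
  · rintro a b ⟨M, hM⟩ ⟨N, hN⟩
    exact ⟨max M N, add_mem (degLT_mono (le_max_left _ _) hM) (degLT_mono (le_max_right _ _) hN)⟩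
  · exact fun r n => ⟨n + 1, Submodule.smul_mem _ _ (dp_mem_degLT n.lt_succ_self)⟩

theorem sub_lead_mem {n : ℕ} {z : QDPoly A q y} (hz : z ∈ degLT A q y (n + 1)) :
    z - coeff n z • dp q y n ∈ degLT A q y n := by
  intro k hk
  rcases hk.eq_or_lt with rfl | hk
  · simp
  · rw [map_sub, map_smul, hz k hk, coeff_dp_of_ne hk.ne]
    simp

theorem mem_degLT_zero {z : QDPoly A q y} : z ∈ degLT A q y 0 ↔ z = 0 := by
  refine ⟨fun h => ext_coeff fun n => ?_, fun h => h ▸ zero_mem _⟩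
  rw [h n n.zero_le, map_zero]

theorem degLT_induction {N : ℕ} {P : QDPoly A q y → Prop} (h0 : P 0)
    (hadd : ∀ a b, a ∈ degLT A q y N → b ∈ degLT A q y N → P a → P b → P (a + b))
    (hdp : ∀ (r : A) (n : ℕ), n < N → P (r • dp q y n)) {z : QDPoly A q y}
    (hz : z ∈ degLT A q y N) : P z := by
  have : ∀ M ≤ N, ∀ w ∈ degLT A q y M, P w := by
    intro M
    induction M with
    | zero =>
      intro _ w hw
      rwa [mem_degLT_zero.mp hw]
    | succ M ih =>
      intro hM w hw
      have := hadd _ _ (degLT_mono (by omega) (sub_lead_mem hw))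
        (Submodule.smul_mem _ (coeff M w) (dp_mem_degLT (show M < N by omega)))
        (ih (by omega) _ (sub_lead_mem hw)) (hdp _ M (by omega))
      rwa [sub_add_cancel] at this
  exact this N le_rfl z hz

theorem dp_mul_dp_mem_degLT (m n : ℕ) : dp q y n * dp q y m ∈ degLT A q y (n + m + 1) := by
  rw [dp_mul_dp_coef]
  exact sum_mem fun i _ => Submodule.smul_mem _ _ (dp_mem_degLT (by omega))

theorem coeff_dp_mul_dp (m n : ℕ) : coeff (n + m) (dp q y n * dp q y m) = qBinom q (n + m) m := by
  rw [dp_mul_dp_coef, Finset.sum_range_succ', map_add, map_sum, Finset.sum_eq_zero]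
  · simp [coef, add_comm m n]
  · intro i hi
    rw [Finset.mem_range] at hi
    rw [map_smul, coeff_dp_of_ne (by omega), smul_zero]

theorem mul_mem_degLT {a b : ℕ} {z w : QDPoly A q y} (hz : z ∈ degLT A q y (a + 1))
    (hw : w ∈ degLT A q y (b + 1)) : z * w ∈ degLT A q y (a + b + 1) := by
  refine degLT_induction (P := fun z => z * w ∈ degLT A q y (a + b + 1)) ?_ ?_ ?_ hz
  · simp
  · intro u v _ _ hu hv
    rw [add_mul]; exact add_mem hu hv
  · intro r n hn
    rw [smul_mul_assoc]
    refine Submodule.smul_mem _ _ ?_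
    refine degLT_induction (P := fun w => dp q y n * w ∈ degLT A q y (a + b + 1)) ?_ ?_ ?_ hw
    · simp
    · intro u v _ _ hu hv
      rw [mul_add]; exact add_mem hu hv
    · intro r m hm
      rw [mul_smul_comm]
      exact Submodule.smul_mem _ _ (degLT_mono (by omega) (dp_mul_dp_mem_degLT m n))

theorem mul_mem_degLT_of_lt {a b N : ℕ} {z w : QDPoly A q y} (hz : z ∈ degLT A q y a)
    (hw : w ∈ degLT A q y (b + 1)) (h : a + b ≤ N) : z * w ∈ degLT A q y N := by
  rcases a with _ | a
  · rw [mem_degLT_zero.mp hz, zero_mul]; exact zero_mem _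
  · exact degLT_mono (by omega) (mul_mem_degLT hz hw)

/-- Products involving a remainder after the leading term have degree below `a + b`, so only `ξ^[a]
ξ^[b]` contributes. -/
theorem coeff_mul_of_mem {a b : ℕ} {z w : QDPoly A q y} (hz : z ∈ degLT A q y (a + 1))
    (hw : w ∈ degLT A q y (b + 1)) :
    coeff (a + b) (z * w) = qBinom q (a + b) b * coeff a z * coeff b w := by
  have hz' := sub_lead_mem hz
  have hw' := sub_lead_mem hw
  have e : z * w = (coeff a z * coeff b w) • (dp q y a * dp q y b) +
      ((z - coeff a z • dp q y a) * w + (w - coeff b w • dp q y b) * (coeff a z • dp q y a)) := by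
    simp only [sub_mul, smul_mul_assoc, mul_smul_comm, smul_smul, mul_comm (dp q y b),
      mul_comm w (dp q y a), smul_sub]
    module
  have h1 := mul_mem_degLT_of_lt (N := a + b) hz' hw (by omega)
  have h2 := mul_mem_degLT_of_lt (N := a + b) hw'
    (Submodule.smul_mem _ (coeff a z) (dp_mem_degLT a.lt_succ_self)) (by omega)
  rw [e, map_add, map_smul, coeff_dp_mul_dp, add_mem h1 h2 _ le_rfl, smul_eq_mul]
  ring

/-- The `q`-multinomial coefficient `(j n)_q! / (n)_q!^j`. -/
def qMultinom (q : A) (n j : ℕ) : A := ∏ i ∈ Finset.range j, qBinom q (n * i + n) n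

theorem pow_mem_degLT {n : ℕ} {z : QDPoly A q y} (hz : z ∈ degLT A q y (n + 1)) (j : ℕ) :
    z ^ j ∈ degLT A q y (n * j + 1) := by
  induction j with
  | zero => simpa using one_mem_degLT one_pos
  | succ j ih => rw [pow_succ]; exact mul_mem_degLT ih hz

theorem coeff_pow_of_mem {n : ℕ} {z : QDPoly A q y} (hz : z ∈ degLT A q y (n + 1)) (j : ℕ) :
    coeff (n * j) (z ^ j) = qMultinom q n j * coeff n z ^ j := by
  induction j with
  | zero => simp [qMultinom, ← dp_zero]
  | succ j ih =>
    rw [pow_succ, mul_add, mul_one, coeff_mul_of_mem (pow_mem_degLT hz j) hz, ih, qMultinom,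
      qMultinom, Finset.prod_range_succ]
    ring

/-! ### The augmentation ideal -/

theorem mem_filt {n : ℕ} {z : QDPoly A q y} : z ∈ filt q y n ↔ ∀ k < n, coeff k z = 0 := by
  constructor
  · intro hz
    change z ∈ Submodule.span A {z | ∃ k, n ≤ k ∧ dp q y k = z} at hz
    intro k hk
    refine Submodule.span_induction ?_ (map_zero _) ?_ ?_ hz
    · rintro _ ⟨m, hm, rfl⟩
      exact coeff_dp_of_ne (by omega)
    · intro a b _ _ ha hb
      rw [map_add, ha, hb, add_zero]
    · intro r a _ ha
      rw [map_smul, ha, smul_zero]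
  · intro hz
    have key : ∀ w : QDPoly A q y, w - ∑ k ∈ Finset.range n, coeff k w • dp q y k ∈
        Submodule.span A {z | ∃ k, n ≤ k ∧ dp q y k = z} := by
      intro w
      refine dp_induction w (by simp) ?_ ?_
      · intro a b ha hb
        have := add_mem ha hb
        convert this using 1
        simp only [map_add, add_smul, Finset.sum_add_distrib]
        abel
      · intro r m
        by_cases hm : m < n
        · rw [Finset.sum_eq_single m]
          · simp
          · intro k _ hk
            simp [coeff_dp_of_ne hk.symm]
          · simp [hm]
        · rw [Finset.sum_eq_zero, sub_zero]
          · exact Submodule.smul_mem _ _ (Submodule.subset_span ⟨m, by omega, rfl⟩)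
          · intro k hk
            rw [Finset.mem_range] at hk
            simp [coeff_dp_of_ne (show m ≠ k by omega)]
    have h := key z
    rwa [Finset.sum_eq_zero, sub_zero] at h
    intro k hk
    rw [hz k (Finset.mem_range.mp hk), zero_smul]

theorem mem_filt_one {z : QDPoly A q y} : z ∈ filt q y 1 ↔ coeff 0 z = 0 := by
  simp [mem_filt]

theorem dp_mem_filt_one {n : ℕ} (hn : n ≠ 0) : dp q y n ∈ filt q y 1 :=
  mem_filt_one.mpr (coeff_dp_of_ne hn)

theorem smul_mem_filt (r : A) {n : ℕ} {z : QDPoly A q y} (hz : z ∈ filt q y n) :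
    r • z ∈ filt q y n :=
  mem_filt.mpr fun k hk => by rw [map_smul, mem_filt.mp hz k hk, smul_zero]

theorem filt_one_induction {P : QDPoly A q y → Prop} (h0 : P 0)
    (hadd : ∀ a b, a ∈ filt q y 1 → b ∈ filt q y 1 → P a → P b → P (a + b))
    (hdp : ∀ (r : A) (n : ℕ), n ≠ 0 → P (r • dp q y n)) {z : QDPoly A q y}
    (hz : z ∈ filt q y 1) : P z := by
  have h : z ∈ Submodule.span A {z | ∃ k, 1 ≤ k ∧ dp q y k = z} := hz
  have : ∀ r : A, P (r • z) := by
    refine Submodule.span_induction (p := fun z _ => ∀ r : A, P (r • z)) ?_ ?_ ?_ ?_ h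
    · rintro _ ⟨k, hk, rfl⟩ r
      exact hdp r k (by omega)
    · simpa using h0
    · intro a b ha hb h1 h2 r
      rw [smul_add]
      exact hadd _ _ (smul_mem_filt r ha) (smul_mem_filt r hb) (h1 r) (h2 r)
    · intro s a _ ha r
      rw [smul_smul]
      exact ha _
  simpa using this 1

/-! ### Ring homomorphisms out of the ring of `q`-divided power polynomials -/

section Lift

variable {T : Type*} [CommRing T]

/-- The additive map `∑ a_n ξ^[n] ↦ ∑ s(a_n) e_n`. -/
noncomputable def liftAdd (q y : A) (s : A →+* T) (e : ℕ → T) : QDPoly A q y →+ T :=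
  (Finsupp.liftAddHom fun n => (AddMonoidHom.mulRight (e n)).comp s.toAddMonoidHom :
    (ℕ →₀ A) →+ T)

variable (s : A →+* T) (e : ℕ → T)

theorem liftAdd_smul_dp (r : A) (n : ℕ) : liftAdd q y s e (r • dp q y n) = s r * e n := by
  have h : r • dp q y n = (Finsupp.single n r : ℕ →₀ A) := by
    change r • (Finsupp.single n (1 : A)) = Finsupp.single n r
    simp
  rw [h]
  exact Finsupp.liftAddHom_apply_single _ _ _ |>.trans rfl

@[simp] theorem liftAdd_dp (n : ℕ) : liftAdd q y s e (dp q y n) = e n := by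
  simpa using liftAdd_smul_dp (q := q) (y := y) s e 1 n

theorem liftAdd_smul (r : A) (z : QDPoly A q y) :
    liftAdd q y s e (r • z) = s r * liftAdd q y s e z := by
  refine dp_induction z (by simp) (fun a b ha hb => ?_) fun c n => ?_
  · rw [smul_add, map_add, ha, hb, map_add, mul_add]
  · rw [smul_smul, liftAdd_smul_dp, liftAdd_smul_dp, map_mul, mul_assoc]

theorem liftAdd_congr {N : ℕ} {e e' : ℕ → T} (h : ∀ n < N, e n = e' n) {z : QDPoly A q y}
    (hz : z ∈ degLT A q y N) : liftAdd q y s e z = liftAdd q y s e' z := by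
  refine degLT_induction (P := fun z => liftAdd q y s e z = liftAdd q y s e' z) (by simp) ?_ ?_ hz
  · intro a b _ _ ha hb
    rw [map_add, map_add, ha, hb]
  · intro r n hn
    rw [liftAdd_smul_dp, liftAdd_smul_dp, h n hn]

/-- The ring homomorphism `∑ a_n ξ^[n] ↦ ∑ s(a_n) e_n`. -/
noncomputable def liftHom (h0 : e 0 = 1)
    (hmul : ∀ m n, liftAdd q y s e (dp q y m * dp q y n) = e m * e n) : QDPoly A q y →+* T :=
  { liftAdd q y s e with
    map_one' := by
      change liftAdd q y s e (dp q y 0) = 1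
      rw [liftAdd_dp, h0]
    map_zero' := (liftAdd q y s e).map_zero
    map_mul' := fun z w => by
      change liftAdd q y s e (z * w) = liftAdd q y s e z * liftAdd q y s e w
      refine dp_induction z (by simp) (fun a b ha hb => ?_) fun c m => ?_
      · rw [add_mul, map_add, ha, hb, map_add, add_mul]
      refine dp_induction w (by simp) (fun a b ha hb => ?_) fun d n => ?_
      · rw [mul_add, map_add, ha, hb, map_add, mul_add]
      rw [smul_mul_smul_comm, liftAdd_smul, hmul, liftAdd_smul_dp, liftAdd_smul_dp, map_mul]
      ring }

variable {s e}

theorem ringHom_ext {f g : QDPoly A q y →+* T}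
    (hA : ∀ a : A, f (algebraMap A _ a) = g (algebraMap A _ a))
    (hdp : ∀ n, f (dp q y n) = g (dp q y n)) : f = g := by
  refine RingHom.ext fun z => dp_induction z (by simp) (fun a b ha hb => ?_) fun r n => ?_
  · rw [map_add, map_add, ha, hb]
  · rw [Algebra.smul_def, map_mul, map_mul, hA, hdp]

/-- If the `q`-integers are regular in `T`, only the products with `ξ` have to be checked. -/
theorem liftAdd_dp_mul_dp_of_regular (hs : ∀ n (t t' : T), s (qInt q (n + 1)) * t =
      s (qInt q (n + 1)) * t' → t = t') (h0 : e 0 = 1)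
    (h1 : ∀ n, e 1 * e n = s (qInt q (n + 1)) * e (n + 1) - s (qInt q n * y) * e n) (m n : ℕ) :
    liftAdd q y s e (dp q y m * dp q y n) = e m * e n := by
  have hmul1 : ∀ z, liftAdd q y s e (dp q y 1 * z) = e 1 * liftAdd q y s e z := by
    intro z
    refine dp_induction z (by simp) (fun a b ha hb => ?_) fun r n => ?_
    · rw [mul_add, map_add, ha, hb, map_add, mul_add]
    · rw [mul_smul_comm, liftAdd_smul, dp_one_mul_dp, map_sub, liftAdd_smul_dp, liftAdd_smul_dp,
        liftAdd_smul_dp, ← h1]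
      ring
  induction m with
  | zero => rw [dp_zero, one_mul, liftAdd_dp, h0, one_mul]
  | succ m ih =>
    -- Up to the regular factor `(m+1)_q`, the generator `ξ^[m+1]` comes from `ξ · ξ^[m]`;
    -- associativity then replaces the full product formula.
    have e1 : qInt q (m + 1) • dp q y (m + 1) = dp q y 1 * dp q y m + (qInt q m * y) • dp q y m := by
      rw [dp_one_mul_dp]; abel
    apply hs m
    rw [← liftAdd_smul, ← smul_mul_assoc, e1, add_mul, map_add, mul_assoc, hmul1, smul_mul_assoc,
      liftAdd_smul, ih]
    linear_combination e n * h1 m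

end Lift

/-- Change of coefficients, as a ring homomorphism. -/
noncomputable def mapHom {K : Type*} [CommRing K] (f : K →+* A) {Q Y : K} (hQ : f Q = q)
    (hY : f Y = y) : QDPoly K Q Y →+* QDPoly A q y :=
  liftHom ((algebraMap A (QDPoly A q y)).comp f) (dp q y) rfl fun m n => by
    rw [dp_mul_dp_coef, dp_mul_dp_coef, map_sum]
    refine Finset.sum_congr rfl fun i _ => ?_
    rw [liftAdd_smul_dp, RingHom.comp_apply, ← Algebra.smul_def]
    congr 1
    simp [coef, map_qBinom, hQ, hY]

section Map

variable {K : Type*} [CommRing K] (f : K →+* A) {Q Y : K} (hQ : f Q = q) (hY : f Y = y)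

theorem mapHom_smul (r : K) (z : QDPoly K Q Y) :
    mapHom f hQ hY (r • z) = f r • mapHom f hQ hY z := by
  rw [Algebra.smul_def (f r)]
  exact liftAdd_smul ((algebraMap A (QDPoly A q y)).comp f) (dp q y) r z

@[simp] theorem mapHom_dp (n : ℕ) : mapHom f hQ hY (dp Q Y n) = dp q y n :=
  liftAdd_dp ((algebraMap A (QDPoly A q y)).comp f) (dp q y) n

theorem mapHom_algebraMap (r : K) :
    mapHom f hQ hY (algebraMap K _ r) = algebraMap A _ (f r) := by
  rw [Algebra.algebraMap_eq_smul_one, mapHom_smul, map_one, ← Algebra.algebraMap_eq_smul_one]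

theorem coeff_mapHom (n : ℕ) (z : QDPoly K Q Y) :
    coeff n (mapHom f hQ hY z) = f (coeff n z) := by
  refine dp_induction z (by simp) (fun a b ha hb => ?_) fun r m => ?_
  · simp only [map_add, ha, hb]
  · rw [mapHom_smul, mapHom_dp, map_smul, map_smul, coeff_dp, coeff_dp]
    split_ifs <;> simp

theorem mapHom_mem_degLT {N : ℕ} {z : QDPoly K Q Y} (hz : z ∈ degLT K Q Y N) :
    mapHom f hQ hY z ∈ degLT A q y N := fun k hk => by rw [coeff_mapHom, hz k hk, map_zero]

end Map

end QDPoly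

theorem qInt_mul_one_sub {A : Type*} [CommRing A] (q : A) (n : ℕ) :
    qInt q n * (1 - q) = 1 - q ^ n := geom_sum_mul_neg q n

@[simp] theorem qInt_zero {A : Type*} [CommRing A] (q : A) : qInt q 0 = 0 := by simp [qInt]

@[simp] theorem qInt_one {A : Type*} [CommRing A] (q : A) : qInt q 1 = 1 := by simp [qInt]

/-- Modulo `p`, the `q`-integer `(p)_q` is `(q - 1)^(p - 1)`. -/
theorem exists_qInt_prime_eq {p : ℕ} [hp : Fact p.Prime] {K : Type*} [CommRing K] [IsDomain K]
    {q : K} (hq1 : q ≠ 1) : ∃ r, qInt q p = (q - 1) ^ (p - 1) + p * r := by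
  obtain ⟨r, hr⟩ := exists_add_pow_prime_eq hp.out (q - 1) 1
  -- The witness `r` comes from the mixed terms of `q^p = ((q - 1) + 1)^p`; the factor `q - 1` is
  -- then cancelled from `q^p - 1`.
  refine ⟨r, mul_left_cancel₀ (sub_ne_zero.mpr hq1) ?_⟩
  have h1 := qInt_mul_one_sub q p
  have h2 : (q - 1) ^ p = (q - 1) * (q - 1) ^ (p - 1) := by
    rw [← pow_succ', Nat.sub_add_cancel hp.out.one_le]
  rw [sub_add_cancel, h2] at hr
  linear_combination -h1 + hr

namespace QDPoly

/-! ### The twisted derivation and its primitive -/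

section Derivative

variable {K : Type*} [CommRing K] {q y : K}

/-- The twisted derivation `ξ^[n] ↦ ξ^[n-1]`. -/
noncomputable def der (q y : K) : QDPoly K q y →ₗ[K] QDPoly K q y :=
  (basis K q y).constr K fun n => if n = 0 then 0 else dp q y (n - 1)

/-- The linear map `ξ^[n] ↦ ξ^[n+1]`. -/
noncomputable def integ (q y : K) : QDPoly K q y →ₗ[K] QDPoly K q y :=
  (basis K q y).constr K fun n => dp q y (n + 1)

@[simp] theorem der_dp_zero : der q y (dp q y 0) = 0 := by simp [der, dp]

@[simp] theorem der_one : der q y 1 = 0 := der_dp_zero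

@[simp] theorem der_dp_succ (n : ℕ) : der q y (dp q y (n + 1)) = dp q y n := by simp [der, dp]

@[simp] theorem der_algebraMap (a : K) : der q y (algebraMap K _ a) = 0 := by
  rw [algebraMap_apply, map_smul, der_one, smul_zero]

@[simp] theorem integ_dp (n : ℕ) : integ q y (dp q y n) = dp q y (n + 1) := by simp [integ, dp]

theorem coeff_der (n : ℕ) (z : QDPoly K q y) : coeff n (der q y z) = coeff (n + 1) z := by
  refine dp_induction z (by simp) (fun a b ha hb => ?_) fun r m => ?_
  · simp only [map_add, ha, hb]
  · rcases m with _ | m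
    · simp [coeff_dp]
    · simp [coeff_dp]

@[simp] theorem der_integ (z : QDPoly K q y) : der q y (integ q y z) = z := by
  refine dp_induction z (by simp) (fun a b ha hb => ?_) fun r m => ?_
  · simp only [map_add, ha, hb]
  · simp

@[simp] theorem coeff_zero_integ (z : QDPoly K q y) : coeff 0 (integ q y z) = 0 := by
  refine dp_induction z (by simp) (fun a b ha hb => ?_) fun r m => ?_
  · simp only [map_add, ha, hb, add_zero]
  · simp [coeff_dp]

theorem coeff_succ_integ (n : ℕ) (z : QDPoly K q y) :
    coeff (n + 1) (integ q y z) = coeff n z := by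
  rw [← coeff_der, der_integ]

theorem integ_mem_degLT {N : ℕ} {z : QDPoly K q y} (hz : z ∈ degLT K q y N) :
    integ q y z ∈ degLT K q y (N + 1) := by
  rintro (_ | k) hk
  · simp
  · rw [coeff_succ_integ, hz k (by omega)]

theorem integ_mem_filt_one (z : QDPoly K q y) : integ q y z ∈ filt q y 1 :=
  mem_filt_one.mpr (coeff_zero_integ z)

/-- The substitute for integration: identities are proved below by comparing constant coefficients
and derivatives, with no division. -/
theorem eq_of_der_eq {z w : QDPoly K q y} (h0 : coeff 0 z = coeff 0 w)
    (h : der q y z = der q y w) : z = w := by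
  refine ext_coeff fun n => ?_
  rcases n with _ | n
  · exact h0
  · rw [← coeff_der, ← coeff_der, h]

theorem integ_der {z : QDPoly K q y} (hz : z ∈ filt q y 1) : integ q y (der q y z) = z :=
  eq_of_der_eq (by rw [coeff_zero_integ, mem_filt_one.mp hz]) (der_integ _)

end Derivative

/-! ### The `q`-difference calculus in `X = ξ + x` and the Frobenius -/

section Frobenius

variable {K : Type*} [CommRing K] {q x y : K}

/-- The coordinate `X = ξ + x`. -/
noncomputable def coordX (q x y : K) : QDPoly K q y := dp q y 1 + algebraMap K _ x

theorem der_coordX : der q y (coordX q x y) = 1 := by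
  rw [coordX, map_add, der_dp_succ, der_algebraMap, add_zero, dp_zero]

theorem coordX_mem_degLT : coordX q x y ∈ degLT K q y 2 := by
  rw [coordX, algebraMap_apply]
  exact add_mem (dp_mem_degLT one_lt_two) (Submodule.smul_mem _ _ (dp_mem_degLT zero_lt_two))

theorem coeff_one_coordX : coeff 1 (coordX q x y) = 1 := by
  rw [coordX, map_add, coeff_dp_self, algebraMap_apply, map_smul, ← dp_zero,
    coeff_dp_of_ne zero_ne_one, smul_zero, add_zero]

/-- Here `y = (1 - q) x` enters: it turns `x - (n)_q y` into `q^n x`, so that `(X - q^n x) ξ^[n] =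
(n+1)_q ξ^[n+1]`. -/
theorem coordX_mul_dp (hy : y = (1 - q) * x) (n : ℕ) : coordX q x y * dp q y n =
    qInt q (n + 1) • dp q y (n + 1) + (q ^ n * x) • dp q y n := by
  have h := qInt_mul_one_sub q n
  have e : q ^ n * x = x - qInt q n * y := by rw [hy]; linear_combination x * h
  rw [coordX, add_mul, dp_one_mul_dp, ← Algebra.smul_def, e]
  module

theorem smul_regular [IsDomain K] {a : K} (ha : a ≠ 0) {z w : QDPoly K q y} (h : a • z = a • w) :
    z = w :=
  ext_coeff fun n => mul_left_cancel₀ ha (by simpa using congrArg (coeff n) h)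

/-- Since `X` has leading coefficient `1`, multiplying by it multiplies a leading coefficient in
degree `N` by the nonzero factor `(N+1)_q`. -/
theorem coordX_regular [IsDomain K] (hq : ∀ n, qInt q (n + 1) ≠ 0) {z w : QDPoly K q y}
    (h : coordX q x y * z = coordX q x y * w) : z = w := by
  have key : ∀ N, ∀ z ∈ degLT K q y N, coordX q x y * z = 0 → z = 0 := by
    intro N
    induction N with
    | zero => exact fun z hz _ => mem_degLT_zero.mp hz
    | succ N ih =>
      intro z hz h
      have h1 := coeff_mul_of_mem hz (b := 1) (coordX_mem_degLT (x := x))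
      rw [mul_comm, h, map_zero, coeff_one_coordX, mul_one] at h1
      have h2 : qBinom q (N + 1) 1 = qInt q (N + 1) := by
        have a1 := qBinom_mul_qFact q 1 N
        have : qFact q 1 = 1 := by simp [qFact]
        rw [this, add_comm 1 N, one_mul, qFact_succ, mul_comm] at a1
        exact mul_left_cancel₀ (qFact_ne_zero hq N) a1
      have h3 : coeff N z = 0 := by
        rcases mul_eq_zero.mp h1.symm with h | h
        · exact absurd (h2 ▸ h) (hq N)
        · exact h
      refine ih z (fun k hk => ?_) h
      rcases hk.eq_or_lt with rfl | hk
      · exact h3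
      · exact hz k hk
  obtain ⟨N, hN⟩ := exists_mem_degLT (z - w)
  exact sub_eq_zero.mp (key N _ hN (by rw [mul_sub, h, sub_self]))

/-- The values of the automorphism `X ↦ q X` on the generators. -/
noncomputable def sigmaDp (q y : K) : ℕ → QDPoly K q y
  | 0 => 1
  | n + 1 => q ^ (n + 1) • dp q y (n + 1) - (q ^ n * y) • dp q y n

/-- On generators this is `σ = 1 + (q - 1) X ∂`: thus `∂` is the `q`-difference quotient attached to
`X ↦ qX`. -/
theorem sigmaDp_eq (hy : y = (1 - q) * x) (n : ℕ) : sigmaDp q y n =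
    dp q y n + (q - 1) • (coordX q x y * der q y (dp q y n)) := by
  rcases n with _ | n
  · simp [sigmaDp, dp_zero]
  · have h := qInt_mul_one_sub q (n + 1)
    have e : q ^ (n + 1) = 1 + (q - 1) * qInt q (n + 1) := by linear_combination h
    have e' : q ^ n * y = - ((q - 1) * (q ^ n * x)) := by rw [hy]; ring
    rw [der_dp_succ, coordX_mul_dp hy, sigmaDp, e, e']
    module

theorem sigmaDp_mul [IsDomain K] (hq : ∀ n, qInt q (n + 1) ≠ 0) (m n : ℕ) :
    liftAdd q y (algebraMap K (QDPoly K q y)) (sigmaDp q y) (dp q y m * dp q y n) =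
      sigmaDp q y m * sigmaDp q y n := by
  refine liftAdd_dp_mul_dp_of_regular (fun n t t' h => ?_) rfl (fun n => ?_) m n
  · rw [← Algebra.smul_def, ← Algebra.smul_def] at h
    exact smul_regular (hq n) h
  · have h1 : sigmaDp q y 1 = q • dp q y 1 - y • 1 := by simp [sigmaDp, dp_zero]
    rw [← Algebra.smul_def, ← Algebra.smul_def, h1, sub_mul, smul_mul_assoc, smul_mul_assoc, one_mul]
    rcases n with _ | n
    · simp [sigmaDp, dp_zero]
    · simp only [sigmaDp, mul_sub, mul_smul_comm, dp_one_mul_dp]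
      have e1 : qInt q (n + 1 + 1) = 1 + q * qInt q (n + 1) := by
        rw [add_comm (n + 1) 1, qInt_add]; simp
      have e2 : qInt q (n + 1) = 1 + q * qInt q n := by rw [add_comm n 1, qInt_add]; simp
      simp only [smul_sub, smul_smul]
      match_scalars
      · ring
      · rw [e1]; ring
      · linear_combination (- q ^ n * y ^ 2) * e2

/-- The automorphism `X ↦ q X`. -/
noncomputable def sigma [IsDomain K] (hq : ∀ n, qInt q (n + 1) ≠ 0) :
    QDPoly K q y →+* QDPoly K q y :=
  liftHom (algebraMap K (QDPoly K q y)) (sigmaDp q y) (by rw [sigmaDp]) (sigmaDp_mul hq)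

theorem sigma_apply [IsDomain K] (hy : y = (1 - q) * x) (hq : ∀ n, qInt q (n + 1) ≠ 0)
    (z : QDPoly K q y) :
    sigma hq z = z + (q - 1) • (coordX q x y * der q y z) := by
  change liftAdd q y (algebraMap K (QDPoly K q y)) (sigmaDp q y) z = _
  refine dp_induction z (by simp) (fun a b ha hb => ?_) fun r n => ?_
  · rw [map_add, ha, hb, map_add, mul_add, smul_add]; abel
  · rw [liftAdd_smul_dp, sigmaDp_eq hy, ← Algebra.smul_def, map_smul, mul_smul_comm, smul_add,
      smul_comm r (q - 1)]

/-- The twisted Leibniz rule is the multiplicativity of `σ = 1 + (q - 1) X ∂` after cancelling the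
regular element `(q - 1) X`. -/
theorem der_mul [IsDomain K] (hy : y = (1 - q) * x) (hq : ∀ n, qInt q (n + 1) ≠ 0) (hq1 : q ≠ 1)
    (z w : QDPoly K q y) :
    der q y (z * w) = der q y z * w + sigma hq z * der q y w := by
  have h := map_mul (sigma hq) z w
  rw [sigma_apply hy hq w, sigma_apply hy hq (z * w)] at h
  apply coordX_regular (x := x) hq
  apply smul_regular (sub_ne_zero.mpr hq1)
  have hz := sigma_apply hy hq z
  simp only [Algebra.smul_def] at h hz ⊢
  linear_combination h + w * hz

theorem sigma_coordX [IsDomain K] (hy : y = (1 - q) * x) (hq : ∀ n, qInt q (n + 1) ≠ 0) :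
    sigma hq (coordX q x y) = q • coordX q x y := by
  rw [sigma_apply hy, der_coordX, mul_one]
  module

theorem der_coordX_pow [IsDomain K] (hy : y = (1 - q) * x) (hq : ∀ n, qInt q (n + 1) ≠ 0)
    (hq1 : q ≠ 1) (n : ℕ) :
    der q y (coordX q x y ^ n) = qInt q n • coordX q x y ^ (n - 1) := by
  induction n with
  | zero => simp
  | succ n ih =>
    rw [pow_succ', der_mul hy hq hq1, der_coordX, ih, sigma_coordX hy, add_comm n 1, qInt_add, add_smul,
      qInt_one, pow_one, one_mul, one_smul, Nat.add_sub_cancel_left, smul_mul_smul_comm]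
    rcases n with _ | n
    · simp
    · rw [Nat.add_sub_cancel, ← pow_succ']

/-- The values of the Frobenius on the generators. -/
noncomputable def frobDp (p : ℕ) (q x y : K) : ℕ → QDPoly K q y
  | 0 => 1
  -- This choice encodes the chain rule `∂φ = (p)_q X^(p-1) φ∂` for `φ(X) = X^p`, with zero constant
  -- coefficient; the factor `(p)_q` is visible.
  | n + 1 => qInt q p • integ q y (coordX q x y ^ (p - 1) * frobDp p q x y n)

theorem der_frobDp_succ (p : ℕ) (n : ℕ) : der q y (frobDp p q x y (n + 1)) =
    qInt q p • (coordX q x y ^ (p - 1) * frobDp p q x y n) := by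
  rw [frobDp, map_smul, der_integ]

theorem frobDp_succ_mem (p : ℕ) (n : ℕ) : frobDp p q x y (n + 1) ∈ filt q y 1 :=
  smul_mem_filt _ (integ_mem_filt_one _)

/-- This is what `φ` must make of `(X - q^n x) ξ^[n] = (n+1)_q ξ^[n+1]`. By induction on `n`, both
sides have the same derivative and no constant term. -/
theorem frobDp_rec [IsDomain K] (hy : y = (1 - q) * x) (hq : ∀ n, qInt q (n + 1) ≠ 0)
    (hq1 : q ≠ 1) (p n : ℕ) :
    (coordX q x y ^ p - algebraMap K _ (q ^ (p * n) * x ^ p)) * frobDp p q x y n =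
      qInt (q ^ p) (n + 1) • frobDp p q x y (n + 1) := by
  have hder : ∀ c : K, der q y (coordX q x y ^ p - algebraMap K _ c) =
      qInt q p • coordX q x y ^ (p - 1) := fun c => by
    rw [map_sub, der_coordX_pow hy hq hq1, der_algebraMap, sub_zero]
  have hsig : ∀ c : K, sigma hq (coordX q x y ^ p - algebraMap K _ c) =
      q ^ p • coordX q x y ^ p - algebraMap K _ c := fun c => by
    rw [map_sub, map_pow, sigma_coordX hy, smul_pow]
    congr 1
    rw [sigma_apply hy, der_algebraMap, mul_zero, smul_zero, add_zero]
  induction n with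
  | zero =>
    refine eq_of_der_eq ?_ ?_
    · rw [map_smul, mem_filt_one.mp (frobDp_succ_mem p 0), smul_zero, ← mem_filt_one, mul_zero,
        pow_zero, one_mul, map_pow]
      -- `X^p - x^p` is divisible by `X - x = ξ`, so its constant coefficient vanishes.
      refine Ideal.mul_mem_right _ _ (Ideal.mem_of_dvd _ (sub_dvd_pow_sub_pow _ _ p) ?_)
      rw [coordX, add_sub_cancel_right]
      exact dp_mem_filt_one one_ne_zero
    · rw [der_mul hy hq hq1, hder, map_smul, der_frobDp_succ, frobDp, der_one]
      simp
  | succ n ih =>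
    refine eq_of_der_eq ?_ ?_
    · rw [map_smul, mem_filt_one.mp (frobDp_succ_mem p _), smul_zero]
      exact mem_filt_one.mp (Ideal.mul_mem_left _ _ (frobDp_succ_mem p _))
    · have e1 : qInt (q ^ p) (n + 1 + 1) = 1 + q ^ p * qInt (q ^ p) (n + 1) := by
        rw [add_comm (n + 1) 1, qInt_add]; simp
      rw [der_mul hy hq hq1, hder, hsig, map_smul, der_frobDp_succ, der_frobDp_succ, e1]
      have e2 : algebraMap K (QDPoly K q y) (q ^ (p * (n + 1)) * x ^ p) =
          algebraMap K _ (q ^ p) * algebraMap K _ (q ^ (p * n) * x ^ p) := by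
        rw [← map_mul]; congr 1; ring
      rw [e2]
      simp only [Algebra.smul_def, map_add, map_mul, map_one] at ih ⊢
      linear_combination algebraMap K _ (q ^ p) * algebraMap K _ (qInt q p) *
        coordX q x y ^ (p - 1) * ih

theorem liftAdd_frobDp_mul [IsDomain K] (hy : y = (1 - q) * x) (hq : ∀ n, qInt q (n + 1) ≠ 0)
    (hq1 : q ≠ 1) {p : ℕ} (hq' : ∀ n, qInt (q ^ p) (n + 1) ≠ 0) {φ : K →+* K}
    (hφq : φ q = q ^ p) (hφx : φ x = x ^ p) (m n : ℕ) :
    liftAdd q y ((algebraMap K (QDPoly K q y)).comp φ) (frobDp p q x y) (dp q y m * dp q y n) =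
      frobDp p q x y m * frobDp p q x y n := by
  have h1 : frobDp p q x y 1 = coordX q x y ^ p - algebraMap K _ (x ^ p) := by
    have := frobDp_rec hy hq hq1 p 0
    rw [mul_zero, pow_zero, one_mul, zero_add, qInt_one, one_smul, frobDp, mul_one] at this
    exact this.symm
  refine liftAdd_dp_mul_dp_of_regular (fun n t t' h => ?_) rfl (fun n => ?_) m n
  · rw [RingHom.comp_apply, map_qInt, hφq, ← Algebra.smul_def, ← Algebra.smul_def] at h
    exact smul_regular (hq' n) h
  · have h2 := frobDp_rec hy hq hq1 p n
    have h3 : qInt (q ^ p) n * (1 - q ^ p) = 1 - q ^ (p * n) := by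
      rw [qInt_mul_one_sub, ← pow_mul]
    have h4 : algebraMap K (QDPoly K q y) (qInt (q ^ p) n * φ y) =
        algebraMap K _ (x ^ p) - algebraMap K _ (q ^ (p * n) * x ^ p) := by
      rw [← map_sub]
      congr 1
      rw [hy, map_mul, map_sub, map_one, hφq, hφx]
      linear_combination x ^ p * h3
    rw [RingHom.comp_apply, RingHom.comp_apply, map_mul φ, map_qInt φ, map_qInt φ, hφq, h4,
      ← Algebra.smul_def, ← h2, h1]
    ring

/-- The Frobenius of the ring of `q`-divided power polynomials. -/
noncomputable def frobHom [IsDomain K] (hy : y = (1 - q) * x) (hq : ∀ n, qInt q (n + 1) ≠ 0)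
    (hq1 : q ≠ 1) {p : ℕ} (hq' : ∀ n, qInt (q ^ p) (n + 1) ≠ 0) {φ : K →+* K}
    (hφq : φ q = q ^ p) (hφx : φ x = x ^ p) : QDPoly K q y →+* QDPoly K q y :=
  liftHom ((algebraMap K (QDPoly K q y)).comp φ) (frobDp p q x y) (by rw [frobDp])
    (liftAdd_frobDp_mul hy hq hq1 hq' hφq hφx)

/-- The primitive is linear over constants and recovers `z` from its derivative, so it carries the
quotient along. -/
theorem dvd_of_dvd_der {c : K} {z : QDPoly K q y} (hz : z ∈ filt q y 1)
    (h : algebraMap K _ c ∣ der q y z) : algebraMap K _ c ∣ z := by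
  obtain ⟨w, hw⟩ := h
  refine ⟨integ q y w, ?_⟩
  rw [← integ_der hz, hw, ← Algebra.smul_def, ← Algebra.smul_def, map_smul]

theorem frobDp_sub_pow_mem (p : ℕ) [hp : Fact p.Prime] {n : ℕ} (hn : n ≠ 0) :
    frobDp p q x y n - dp q y n ^ p ∈ filt q y 1 := by
  obtain ⟨n, rfl⟩ := Nat.exists_eq_succ_of_ne_zero hn
  exact sub_mem (frobDp_succ_mem p n)
    (Ideal.pow_mem_of_mem _ (dp_mem_filt_one hn) p hp.out.pos)

/-- Induction through `∂`. For `z = ξ^[n+1]`, the derivative of `z^p` is `((q - 1) X)^(p-1) (∂z)^p`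
modulo `p`, that of `φ(z)` is `(p)_q X^(p-1) φ(∂z)`, and `(p)_q ≡ (q - 1)^(p-1)`. -/
theorem natCast_dvd_frobDp_sub_pow [IsDomain K] (hy : y = (1 - q) * x)
    (hq : ∀ n, qInt q (n + 1) ≠ 0) (hq1 : q ≠ 1) (p : ℕ) [hp : Fact p.Prime] (n : ℕ) :
    (p : QDPoly K q y) ∣ frobDp p q x y n - dp q y n ^ p := by
  induction n with
  | zero => simp [frobDp, dp_zero]
  | succ n ih =>
    have hc : ((p : ℕ) : QDPoly K q y) = algebraMap K _ (p : K) := (map_natCast _ p).symm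
    rw [hc] at ih ⊢
    refine dvd_of_dvd_der (frobDp_sub_pow_mem p n.succ_ne_zero) ?_
    rw [map_sub, der_frobDp_succ]
    set z := dp q y (n + 1) with hz
    set X := coordX q x y with hX
    obtain ⟨r, hr⟩ := exists_qInt_prime_eq (p := p) hq1
    obtain ⟨t, ht⟩ := exists_add_pow_prime_eq hp.out z ((q - 1) • (X * dp q y n))
    -- Expand `σ(z)^p = (z + (q - 1) X ∂z)^p` and divide `σ(z^p) - z^p` by `(q - 1) X`.
    have h1 : der q y (z ^ p) = ((q - 1) • X) ^ (p - 1) * dp q y n ^ p +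
        algebraMap K _ (p : K) * (z * dp q y n * t) := by
      apply coordX_regular (x := x) hq
      apply smul_regular (sub_ne_zero.mpr hq1)
      have h2 := sigma_apply hy hq (z ^ p)
      rw [map_pow, sigma_apply hy hq z, hz, der_dp_succ, ← hz, ht, hc] at h2
      have h3 : ((q - 1) • (X * dp q y n)) ^ p =
          ((q - 1) • X) * (((q - 1) • X) ^ (p - 1) * dp q y n ^ p) := by
        rw [← smul_mul_assoc, mul_pow, ← mul_assoc, ← pow_succ', Nat.sub_add_cancel hp.out.one_le]
      rw [h3] at h2
      simp only [Algebra.smul_def] at h2 ⊢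
      linear_combination -h2
    obtain ⟨w, hw⟩ := ih
    rw [sub_eq_iff_eq_add] at hw
    refine ⟨r • (X ^ (p - 1) * frobDp p q x y n) + ((q - 1) • X) ^ (p - 1) * w
      - z * dp q y n * t, ?_⟩
    rw [h1, hr, smul_pow]
    simp only [Algebra.smul_def, map_add, map_mul, map_pow]
    linear_combination (algebraMap K (QDPoly K q y) (q - 1)) ^ (p - 1) * X ^ (p - 1) * hw

/-- The `δ`-structure on `K⟨ξ⟩_{q,y}` in the case of a domain of characteristic zero. -/
theorem exists_delta_of_isDomain [IsDomain K] [CharZero K] {p : ℕ} [hp : Fact p.Prime]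
    (hy : y = (1 - q) * x) (hq : ∀ n, qInt q (n + 1) ≠ 0) (hq1 : q ≠ 1)
    (hq' : ∀ n, qInt (q ^ p) (n + 1) ≠ 0) (δK : DeltaStructure p K) (hδq : δK q = 0)
    (hδx : δK x = 0) :
    ∃ δ : DeltaStructure p (QDPoly K q y),
      IsDeltaHom δK δ (algebraMap K _) ∧ ∀ n, δ.frob (dp q y n) = frobDp p q x y n := by
  have hφq : δK.frobHom q = q ^ p := by simp [DeltaStructure.frob_apply, hδq]
  have hφx : δK.frobHom x = x ^ p := by simp [DeltaStructure.frob_apply, hδx]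
  have hc : ((p : ℕ) : QDPoly K q y) = algebraMap K _ (p : K) := (map_natCast _ p).symm
  have hp0 : (p : K) ≠ 0 := Nat.cast_ne_zero.mpr hp.out.ne_zero
  have htf : ∀ z : QDPoly K q y, (p : QDPoly K q y) * z = 0 → z = 0 := by
    intro z hz
    rw [hc, ← Algebra.smul_def] at hz
    exact smul_regular hp0 (hz.trans (smul_zero _).symm)
  set Φ := frobHom hy hq hq1 hq' hφq hφx with hΦ
  have hΦdp : ∀ r n, Φ (r • dp q y n) =
      algebraMap K _ (δK.frob r) * frobDp p q x y n := fun r n => liftAdd_smul_dp _ _ r n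
  obtain ⟨δ, hδ⟩ := DeltaStructure.exists_frob_eq htf Φ fun z => by
    refine dp_induction z ?_ ?_ ?_
    · simp [hp.out.ne_zero]
    · rintro a b ⟨u, hu⟩ ⟨v, hv⟩
      refine ⟨u + v - carry p a b, ?_⟩
      have h := natCast_mul_carry (p := p) a b
      rw [map_add]
      linear_combination hu + hv + h
    · intro r n
      obtain ⟨u, hu⟩ := natCast_dvd_frobDp_sub_pow (x := x) hy hq hq1 p n
      refine ⟨algebraMap K _ (δK r) * frobDp p q x y n + (algebraMap K _ r) ^ p * u, ?_⟩
      rw [hΦdp, Algebra.smul_def, DeltaStructure.frob_apply, map_add, map_mul, map_pow, ← hc]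
      linear_combination (algebraMap K (QDPoly K q y) r) ^ p * hu
  have hdp : ∀ n, δ.frob (dp q y n) = frobDp p q x y n := fun n => by
    have := hΦdp 1 n
    rw [one_smul] at this
    rw [hδ, this]
    simp [DeltaStructure.frob_apply]
  refine ⟨δ, fun a => ?_, hdp⟩
  have h1 : δ.frob (algebraMap K _ a) = algebraMap K _ (δK.frob a) := by
    rw [hδ, algebraMap_apply, ← dp_zero, hΦdp, frobDp, mul_one]
  rw [DeltaStructure.frob_apply, DeltaStructure.frob_apply, map_add, map_mul, map_pow, ← hc,
    add_right_inj] at h1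
  exact (sub_eq_zero.mp (htf _ (by rw [mul_sub, h1, sub_self]))).symm

end Frobenius
end QDPoly

/-! ### Degrees and leading coefficients of the Frobenius -/

section Leading

variable {A : Type*} [CommRing A]

/-- The leading coefficient of `φ(ξ^[n])`. -/
def frobLead (p : ℕ) (q : A) : ℕ → A
  | 0 => 1
  | n + 1 => qInt q p *
      (qBinom q (p - 1 + p * n) (p * n) * QDPoly.qMultinom q 1 (p - 1) * frobLead p q n)

theorem QDPoly.map_qMultinom {B : Type*} [CommRing B] (f : A →+* B) (q : A) (n j : ℕ) :
    f (qMultinom q n j) = qMultinom (f q) n j := by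
  simp [qMultinom, map_qBinom]

theorem map_frobLead {B : Type*} [CommRing B] (f : A →+* B) (p : ℕ) (q : A) (n : ℕ) :
    f (frobLead p q n) = frobLead p (f q) n := by
  induction n with
  | zero => simp [frobLead]
  | succ n ih => simp [frobLead, map_qBinom, map_qInt, QDPoly.map_qMultinom, ih]

end Leading

namespace QDPoly

section FrobDegree

variable {A : Type*} [CommRing A] {q x y : A}

/-- The element `φ(ξ^[n+1]) / (p)_q`. -/
noncomputable def divFrobDp (p : ℕ) (q x y : A) (n : ℕ) : QDPoly A q y :=
  integ q y (coordX q x y ^ (p - 1) * frobDp p q x y n)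

theorem frobDp_succ (p n : ℕ) :
    frobDp p q x y (n + 1) = qInt q p • divFrobDp p q x y n := rfl

theorem divFrobDp_mem_filt_one (p n : ℕ) : divFrobDp p q x y n ∈ filt q y 1 :=
  integ_mem_filt_one _

theorem mapHom_integ {K : Type*} [CommRing K] (f : K →+* A) {Q Y : K} (hQ : f Q = q)
    (hY : f Y = y) (z : QDPoly K Q Y) :
    mapHom f hQ hY (integ Q Y z) = integ q y (mapHom f hQ hY z) := by
  refine dp_induction z (by simp) (fun a b ha hb => ?_) fun r n => ?_
  · simp only [map_add, ha, hb]
  · simp only [map_smul, integ_dp, mapHom_smul, mapHom_dp]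

theorem mapHom_frobDp (p : ℕ) {K : Type*} [CommRing K] (f : K →+* A) {Q X Y : K} (hQ : f Q = q)
    (hY : f Y = y) (hX : f X = x) (n : ℕ) :
    mapHom f hQ hY (frobDp p Q X Y n) = frobDp p q x y n := by
  induction n with
  | zero => simp [frobDp]
  | succ n ih =>
    rw [frobDp, frobDp, mapHom_smul, mapHom_integ, map_mul, map_pow, ih, map_qInt, hQ, coordX,
      coordX, map_add, mapHom_dp, mapHom_algebraMap, hX]

variable (p : ℕ) [hp : Fact p.Prime]

theorem frobDp_mem_degLT (n : ℕ) : frobDp p q x y n ∈ degLT A q y (p * n + 1) := by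
  induction n with
  | zero => exact one_mem_degLT (by omega)
  | succ n ih =>
    have h := integ_mem_degLT
      (mul_mem_degLT (pow_mem_degLT (n := 1) (coordX_mem_degLT (q := q) (x := x) (y := y)) (p - 1)) ih)
    have e : 1 * (p - 1) + p * n + 1 + 1 = p * (n + 1) + 1 := by
      have := hp.out.pos; rw [mul_add]; omega
    rw [e] at h
    exact Submodule.smul_mem _ _ h

theorem divFrobDp_mem_degLT (n : ℕ) : divFrobDp p q x y n ∈ degLT A q y (p * (n + 1) + 1) := by
  have h := integ_mem_degLT (mul_mem_degLT
    (pow_mem_degLT (n := 1) (coordX_mem_degLT (q := q) (x := x) (y := y)) (p - 1))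
    (frobDp_mem_degLT (x := x) p n))
  have e : 1 * (p - 1) + p * n + 1 + 1 = p * (n + 1) + 1 := by
    have := hp.out.pos; rw [mul_add]; omega
  rwa [e] at h

theorem coeff_divFrobDp_of_coeff (n : ℕ) : coeff (p * (n + 1)) (divFrobDp p q x y n) =
    qBinom q (p - 1 + p * n) (p * n) * qMultinom q 1 (p - 1) *
      coeff (p * n) (frobDp p q x y n) := by
  have h1 : (coordX q x y) ^ (p - 1) ∈ degLT A q y (p - 1 + 1) := by
    simpa using pow_mem_degLT (n := 1) (coordX_mem_degLT (q := q) (x := x) (y := y)) (p - 1)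
  have h2 : coeff (p - 1) ((coordX q x y) ^ (p - 1)) = qMultinom q 1 (p - 1) := by
    simpa [coeff_one_coordX] using
      coeff_pow_of_mem (n := 1) (coordX_mem_degLT (q := q) (x := x) (y := y)) (p - 1)
  have e : p * (n + 1) = p - 1 + p * n + 1 := by
    have := hp.out.pos; rw [mul_add]; omega
  rw [e, divFrobDp, coeff_succ_integ, coeff_mul_of_mem h1 (frobDp_mem_degLT p n), h2]

theorem coeff_frobDp (n : ℕ) : coeff (p * n) (frobDp p q x y n) = frobLead p q n := by
  induction n with
  | zero => simp [frobDp, frobLead, ← dp_zero]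
  | succ n ih => rw [frobDp_succ, map_smul, coeff_divFrobDp_of_coeff, ih, frobLead, smul_eq_mul]

theorem coeff_divFrobDp (n : ℕ) : coeff (p * (n + 1)) (divFrobDp p q x y n) =
    qBinom q (p - 1 + p * n) (p * n) * qMultinom q 1 (p - 1) * frobLead p q n := by
  rw [coeff_divFrobDp_of_coeff, coeff_frobDp]

end FrobDegree

/-- The properties of the `δ`-structure of `A⟨ξ⟩_{q,y}`. -/
structure IsStandardDelta {p : ℕ} {A : Type*} [CommRing A] {q : A} (x : A) {y : A}
    (δA : DeltaStructure p A) (δ : DeltaStructure p (QDPoly A q y)) : Prop where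
  algebraMap_delta : IsDeltaHom δA δ (algebraMap A _)
  frob_dp : ∀ n, δ.frob (dp q y n) = frobDp p q x y n
  delta_dp_one : δ (dp q y 1) = carry p (dp q y 1) (algebraMap A _ x)
  delta_dp_mem_filt : ∀ n, n ≠ 0 → δ (dp q y n) ∈ filt q y 1
  delta_dp_mem_degLT : ∀ n, δ (dp q y n) ∈ degLT A q y (p * n + 1)
  -- If `p` is a zero divisor in `A`, the coefficient is not determined by its product with `p`; an
  -- integral polynomial `w` keeps the quotient available after base change.
  coeff_delta_dp : ∀ n, ∃ w : Polynomial ℤ,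
    (p : Polynomial ℤ) * w = frobLead p Polynomial.X n - qMultinom Polynomial.X n p ∧
      coeff (p * n) (δ (dp q y n)) = Polynomial.eval₂ (Int.castRingHom A) q w

/-! ### The standard `δ` in characteristic zero, and its base change -/

section Domain

variable {p : ℕ} {K : Type*} [CommRing K] {q x y : K} {δK : DeltaStructure p K}
  {δ : DeltaStructure p (QDPoly K q y)}

theorem natCast_smul_delta_dp (h : ∀ n, δ.frob (dp q y n) = frobDp p q x y n) (n : ℕ) :
    (p : K) • δ (dp q y n) = frobDp p q x y n - dp q y n ^ p := by
  rw [← h, DeltaStructure.frob_apply, Algebra.smul_def, map_natCast, add_sub_cancel_left]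

variable [hp : Fact p.Prime]

theorem natCast_mul_coeff_delta_dp (h : ∀ n, δ.frob (dp q y n) = frobDp p q x y n) (n : ℕ) :
    (p : K) * coeff (p * n) (δ (dp q y n)) = frobLead p q n - qMultinom q n p := by
  have h6 := coeff_pow_of_mem (dp_mem_degLT (q := q) (y := y) n.lt_succ_self) p
  rw [coeff_dp_self, one_pow, mul_one, mul_comm n p] at h6
  rw [← coeff_frobDp (x := x) (y := y), ← h6, ← map_sub, ← natCast_smul_delta_dp h, map_smul,
    smul_eq_mul]

variable [IsDomain K] [CharZero K]

theorem coeff_delta_dp_eq_zero (h : ∀ n, δ.frob (dp q y n) = frobDp p q x y n) {k n : ℕ}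
    (hk : coeff k (frobDp p q x y n - dp q y n ^ p) = 0) : coeff k (δ (dp q y n)) = 0 := by
  rw [← natCast_smul_delta_dp h, map_smul] at hk
  exact (mul_eq_zero.mp hk).resolve_left (Nat.cast_ne_zero.mpr hp.out.ne_zero)

/-- Everything is read off from `p δ(ξ^[n]) = φ(ξ^[n]) - ξ^[n]^p` by cancelling `p`. The hypothesis
`hw` asks that the quotient of the leading coefficients come from `ℤ[q]`. -/
theorem isStandardDelta_of_isDomain (hy : y = (1 - q) * x) (hq : ∀ n, qInt q (n + 1) ≠ 0)
    (hq1 : q ≠ 1) (hδ : IsDeltaHom δK δ (algebraMap K _))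
    (h : ∀ n, δ.frob (dp q y n) = frobDp p q x y n)
    (hw : ∀ (c : K) (n : ℕ), (p : K) * c = frobLead p q n - qMultinom q n p →
      ∃ w : Polynomial ℤ,
        (p : Polynomial ℤ) * w = frobLead p Polynomial.X n - qMultinom Polynomial.X n p ∧
        c = Polynomial.eval₂ (Int.castRingHom K) q w) :
    IsStandardDelta x δK δ := by
  have hp0 : (p : K) ≠ 0 := Nat.cast_ne_zero.mpr hp.out.ne_zero
  refine ⟨hδ, h, ?_, fun n hn => ?_, fun n k hk => ?_, fun n => ?_⟩
  · apply smul_regular hp0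
    rw [natCast_smul_delta_dp h, Algebra.smul_def, map_natCast, natCast_mul_carry]
    have h5 := frobDp_rec hy hq hq1 p 0
    rw [mul_zero, pow_zero, one_mul, zero_add, qInt_one, one_smul, frobDp, mul_one, coordX,
      map_pow] at h5
    rw [← h5]
    ring
  · exact mem_filt_one.mpr (coeff_delta_dp_eq_zero h (mem_filt_one.mp (frobDp_sub_pow_mem p hn)))
  · refine coeff_delta_dp_eq_zero h (sub_mem (frobDp_mem_degLT p n) ?_ k hk)
    rw [mul_comm]
    exact pow_mem_degLT (dp_mem_degLT n.lt_succ_self) p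
  · exact hw _ n (natCast_mul_coeff_delta_dp h n)

end Domain

/-- Base change of the standard `δ`-structure. -/
theorem IsStandardDelta.baseChange {p : ℕ} [hp : Fact p.Prime] {K A : Type*} [CommRing K]
    [CommRing A] {Q X Y : K} {q x y : A} {δK : DeltaStructure p K} {δA : DeltaStructure p A}
    {δ0 : DeltaStructure p (QDPoly K Q Y)} (hst : IsStandardDelta X δK δ0) {f : K →+* A}
    (hfδ : IsDeltaHom δK δA f) (hQ : f Q = q) (hX : f X = x) (hY : f Y = y) :
    ∃ δ : DeltaStructure p (QDPoly A q y), IsStandardDelta x δA δ := by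
  set m := mapHom f hQ hY with hm
  let s : A →+* W2 p (QDPoly A q y) := (W2.map p (algebraMap A (QDPoly A q y))).comp δA.toW2
  let e : ℕ → W2 p (QDPoly A q y) := fun n => W2.map p m (δ0.toW2 (dp Q Y n))
  have h1 : ∀ z, W2.map p m (δ0.toW2 z) = liftAdd q y s e (m z) := by
    intro z
    refine dp_induction z (by simp only [map_zero]) (fun a b ha hb => ?_) fun r n => ?_
    · simp only [map_add, ha, hb]
    · rw [hm, mapHom_smul, mapHom_dp, liftAdd_smul_dp, Algebra.smul_def, map_mul, map_mul]
      congr 1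
      ext
      · change mapHom f hQ hY (algebraMap _ _ r) = _
        rw [mapHom_algebraMap]
        rfl
      · change mapHom f hQ hY (δ0 (algebraMap _ _ r)) = _
        rw [← hst.algebraMap_delta, mapHom_algebraMap, hfδ]
        rfl
  -- A product `ξ^[i] ξ^[j]` is the image of the same product over `K`, where the section of `δ0` is
  -- multiplicative; `h1` transports this.
  let S : QDPoly A q y →+* W2 p (QDPoly A q y) := liftHom s e (by simp [e, dp_zero])
    fun i j => by
      have h2 := h1 (dp Q Y i * dp Q Y j)
      rw [map_mul m, hm, mapHom_dp, mapHom_dp, map_mul, map_mul] at h2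
      exact h2.symm
  have hS : (W2.fstHom p _).comp S = RingHom.id _ := by
    refine ringHom_ext (fun a => ?_) fun n => ?_
    · change (liftAdd q y s e (algebraMap A _ a)).fst = _
      rw [algebraMap_apply, ← dp_zero, liftAdd_smul_dp]
      simp [s, e, dp_zero, algebraMap_apply]
    · change (liftAdd q y s e (dp q y n)).fst = _
      rw [liftAdd_dp]
      exact mapHom_dp f hQ hY n
  let δ := DeltaStructure.ofW2 S fun z => RingHom.congr_fun hS z
  have hδ : ∀ z, δ (m z) = m (δ0 z) := fun z => (congrArg W2.snd (h1 z)).symm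
  have hδdp : ∀ n, δ (dp q y n) = m (δ0 (dp Q Y n)) := fun n => by
    rw [← hδ, hm, mapHom_dp]
  refine ⟨δ, fun a => ?_, fun n => ?_, ?_, fun n hn => ?_, fun n => ?_, fun n => ?_⟩
  · change _ = (liftAdd q y s e (algebraMap A _ a)).snd
    rw [algebraMap_apply a, ← dp_zero, liftAdd_smul_dp]
    simp [s, e, dp_zero, algebraMap_apply]
  · have h2 := congrArg m (hst.frob_dp n)
    rw [hm, mapHom_frobDp p f hQ hY hX, DeltaStructure.frob_apply, map_add, map_pow, map_mul,
      mapHom_dp, map_natCast, ← hm, ← hδdp] at h2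
    exact h2
  · rw [hδdp, hst.delta_dp_one, map_carry, hm, mapHom_dp, mapHom_algebraMap, hX]
  · rw [hδdp, mem_filt_one, hm, coeff_mapHom, mem_filt_one.mp (hst.delta_dp_mem_filt n hn),
      map_zero]
  · rw [hδdp]
    exact mapHom_mem_degLT f hQ hY (hst.delta_dp_mem_degLT n)
  · obtain ⟨w, hw, hw'⟩ := hst.coeff_delta_dp n
    refine ⟨w, hw, ?_⟩
    rw [hδdp, hm, coeff_mapHom, hw', Polynomial.hom_eval₂, hQ]
    congr 1
    exact RingHom.ext_int _ _

/-! ### The universal case `ℤ[q][x]` -/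

section Universal

open Polynomial

/-- At `q = 1` the value is `n + 1`. The exponents needed are `k = 1` and `k = p`, for the bases `q`
and `q^p`. -/
theorem qInt_C_X_pow_ne_zero (n k : ℕ) :
    qInt ((C X : Polynomial (Polynomial ℤ)) ^ k) (n + 1) ≠ 0 := by
  intro h
  have h1 := congrArg (fun P : Polynomial (Polynomial ℤ) => (P.eval 0).eval 1) h
  simp [qInt, eval_finsetSum] at h1
  omega

/-- The `δ`-structure on `ℤ[q][x]` with `δ(q) = δ(x) = 0`. -/
theorem exists_delta_polynomial (p : ℕ) [hp : Fact p.Prime] :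
    ∃ δ : DeltaStructure p (Polynomial (Polynomial ℤ)), δ (C X) = 0 ∧ δ X = 0 := by
  let s : Polynomial (Polynomial ℤ) →+* W2 p (Polynomial (Polynomial ℤ)) :=
    eval₂RingHom (eval₂RingHom (Int.castRingHom _) ⟨C X, 0⟩) ⟨X, 0⟩
  have hs : (W2.fstHom p _).comp s = RingHom.id _ := by
    refine Polynomial.ringHom_ext' (Polynomial.ringHom_ext' (RingHom.ext_int _ _) ?_) ?_ <;>
      simp [s]
  refine ⟨DeltaStructure.ofW2 s fun a => RingHom.congr_fun hs a, ?_, ?_⟩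
  · change (s (C X)).snd = 0
    simp [s]
  · change (s X).snd = 0
    simp [s]

/-- If `p c` does not involve `x`, then neither does `c`, as `p` is regular; so the quotient by `p`
already lives in `ℤ[q]`. -/
theorem exists_eval₂_C_X_eq {p : ℕ} (hp : p ≠ 0) {c : Polynomial (Polynomial ℤ)}
    {v : Polynomial ℤ} (h : (p : Polynomial (Polynomial ℤ)) * c = C v) :
    ∃ w, (p : Polynomial ℤ) * w = v ∧ c = eval₂ (Int.castRingHom _) (C X) w := by
  have h7 : ∀ k, (p : Polynomial ℤ) * c.coeff k =
      (C v : Polynomial (Polynomial ℤ)).coeff k := fun k => by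
    rw [← h, coeff_natCast_mul]
  refine ⟨c.coeff 0, by simpa using h7 0, ?_⟩
  have h8 : c = C (c.coeff 0) := by
    ext1 k
    rcases k with _ | k
    · simp
    · have := h7 (k + 1)
      rw [coeff_C_succ] at this
      rw [coeff_C_succ]
      exact (mul_eq_zero.mp this).resolve_left (Nat.cast_ne_zero.mpr hp)
  have h9 : eval₂RingHom (Int.castRingHom (Polynomial (Polynomial ℤ))) (C X) =
      (C : Polynomial ℤ →+* Polynomial (Polynomial ℤ)) :=
    Polynomial.ringHom_ext' (RingHom.ext_int _ _) (by simp)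
  exact h8.trans (RingHom.congr_fun h9 _).symm

theorem exists_standardDelta_polynomial (p : ℕ) [hp : Fact p.Prime] :
    ∃ (δK : DeltaStructure p (Polynomial (Polynomial ℤ)))
      (δ : DeltaStructure p (QDPoly (Polynomial (Polynomial ℤ)) (C X) ((1 - C X) * X))),
      δK (C X) = 0 ∧ δK X = 0 ∧ IsStandardDelta X δK δ := by
  obtain ⟨δK, h1, h2⟩ := exists_delta_polynomial p
  have hq : ∀ n, qInt (C X : Polynomial (Polynomial ℤ)) (n + 1) ≠ 0 := fun n => by
    simpa using qInt_C_X_pow_ne_zero n 1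
  have hq1 : (C X : Polynomial (Polynomial ℤ)) ≠ 1 := fun h =>
    X_ne_C (1 : ℤ) (C_injective (h.trans (by simp)))
  obtain ⟨δ, h3, h4⟩ := exists_delta_of_isDomain (q := (C X : Polynomial (Polynomial ℤ))) (x := X)
    rfl hq hq1 (fun n => qInt_C_X_pow_ne_zero n p) δK h1 h2
  refine ⟨δK, δ, h1, h2, isStandardDelta_of_isDomain rfl hq hq1 h3 h4 fun c n hc => ?_⟩
  rw [← map_frobLead (C : Polynomial ℤ →+* _), ← map_qMultinom (C : Polynomial ℤ →+* _),
    ← map_sub] at hc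
  exact exists_eval₂_C_X_eq hp.out.ne_zero hc

/-- The `δ`-structure of `A⟨ξ⟩_{q,y}`. -/
theorem exists_standardDelta {p : ℕ} [hp : Fact p.Prime] {A : Type*} [CommRing A] {q x y : A}
    (hy : y = (1 - q) * x) (δA : DeltaStructure p A) (hδq : δA q = 0) (hδx : δA x = 0) :
    ∃ δ : DeltaStructure p (QDPoly A q y), IsStandardDelta x δA δ := by
  obtain ⟨δK, δ0, hKq, hKx, hst⟩ := exists_standardDelta_polynomial p
  let f : Polynomial (Polynomial ℤ) →+* A := eval₂RingHom (eval₂RingHom (Int.castRingHom A) q) x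
  have hQ : f (C X) = q := by simp [f]
  have hX : f X = x := by simp [f]
  refine hst.baseChange (f := f) ?_ hQ hX (by rw [map_mul, map_sub, map_one, hQ, hX, hy])
  rw [DeltaStructure.isDeltaHom_iff]
  refine Polynomial.ringHom_ext' (Polynomial.ringHom_ext' (RingHom.ext_int _ _) ?_) ?_
  · ext <;> simp [f, hKq, hδq]
  · ext <;> simp [f, hKx, hδx]

end Universal
end QDPoly

/-! ### Binomial coefficients modulo `p` -/

section Binomial

variable {p : ℕ} [hp : Fact p.Prime]

/-- Lucas's theorem, with the `l` lowest digits in base `p` grouped together. -/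
theorem natCast_choose_pow_mul_add {l m m' r r' : ℕ} (hr : r < p ^ l) (hr' : r' < p ^ l) :
    ((p ^ l * m + r).choose (p ^ l * m' + r') : ZMod p) = m.choose m' * r.choose r' := by
  have hdig : ∀ {m r i : ℕ}, i < l → (p ^ l * m + r) / p ^ i % p = r / p ^ i % p := by
    intro m r i hi
    have e : p ^ l * m = p ^ i * (p * (p ^ (l - i - 1) * m)) := by
      rw [← mul_assoc, ← mul_assoc, ← pow_succ, ← pow_add]
      congr 2
      omega
    rw [e, Nat.mul_add_div (pow_pos hp.out.pos i), Nat.mul_add_mod]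
  have h1 := Choose.choose_modEq_choose_mul_prod_range_choose (n := p ^ l * m + r)
    (k := p ^ l * m' + r') (p := p) l
  have h2 := Choose.choose_modEq_prod_range_choose (p := p) hr hr'
  rw [← ZMod.intCast_eq_intCast_iff] at h1 h2
  push_cast at h1 h2
  rw [h1, h2, Nat.mul_add_div (pow_pos hp.out.pos l), Nat.mul_add_div (pow_pos hp.out.pos l),
    Nat.div_eq_of_lt hr, Nat.div_eq_of_lt hr', add_zero, add_zero]
  congr 1
  refine Finset.prod_congr rfl fun i hi => ?_
  rw [hdig (Finset.mem_range.mp hi), hdig (Finset.mem_range.mp hi)]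

theorem natCast_ne_zero_of_lt {m : ℕ} (h0 : m ≠ 0) (h : m < p) : (m : ZMod p) ≠ 0 := by
  rw [Ne, ZMod.natCast_eq_zero_iff]
  exact fun hd => h0 (Nat.eq_zero_of_dvd_of_lt hd h)

/-- There are no carries when the leading digit is split off. -/
theorem natCast_choose_pow_log_ne_zero {n : ℕ} (hn : n ≠ 0) :
    (n.choose (p ^ Nat.log p n) : ZMod p) ≠ 0 := by
  set l := Nat.log p n
  have h1 : p ^ l ≤ n := Nat.pow_log_le_self p hn
  have h2 : n < p ^ (l + 1) := Nat.lt_pow_succ_log_self hp.out.one_lt n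
  have hpos := pow_pos hp.out.pos l
  have h3 := natCast_choose_pow_mul_add (p := p) (l := l) (m := n / p ^ l) (m' := 1)
    (Nat.mod_lt n hpos) hpos
  rw [Nat.div_add_mod, mul_one, add_zero, Nat.choose_one_right, Nat.choose_zero_right, Nat.cast_one,
    mul_one] at h3
  rw [h3]
  refine natCast_ne_zero_of_lt (Nat.div_pos h1 hpos).ne' (Nat.div_lt_of_lt_mul ?_)
  rwa [← pow_succ]

theorem natCast_choose_low_ne_zero {l m r : ℕ} (hr : r < p ^ l) :
    ((p ^ l * m + r).choose r : ZMod p) ≠ 0 := by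
  have h := natCast_choose_pow_mul_add (p := p) (m := m) (m' := 0) hr hr
  rw [mul_zero, zero_add, Nat.choose_zero_right, Nat.choose_self] at h
  rw [h]
  simp

theorem natCast_choose_pow_mul_add_self (k i : ℕ) :
    ((p ^ k * i + p ^ k).choose (p ^ k) : ZMod p) = ((i + 1 : ℕ) : ZMod p) := by
  have h := natCast_choose_pow_mul_add (p := p) (l := k) (m := i + 1) (m' := 1) (r := 0) (r' := 0)
    (pow_pos hp.out.pos k) (pow_pos hp.out.pos k)
  rw [mul_one, add_zero, add_zero, mul_add, mul_one] at h
  rw [h]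
  simp

theorem qBinom_one (n k : ℕ) : qBinom (1 : ℤ) n k = n.choose k := by
  induction n generalizing k with
  | zero => cases k <;> simp [qBinom]
  | succ n ih => cases k <;> simp [qBinom, ih, Nat.choose_succ_succ]

theorem prod_choose_ne_zero (k : ℕ) :
    ((∏ i ∈ Finset.range (p - 1), (p ^ k * i + p ^ k).choose (p ^ k) : ℕ) : ZMod p) ≠ 0 := by
  rw [Nat.cast_prod, Finset.prod_ne_zero_iff]
  intro i hi
  rw [Finset.mem_range] at hi
  rw [natCast_choose_pow_mul_add_self]
  exact natCast_ne_zero_of_lt i.succ_ne_zero (by omega)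

/-- The multinomial coefficient `(p^(k+1))! / (p^k)!^p` is exactly divisible by `p`. -/
theorem qMultinom_one_eq (k : ℕ) : ∃ m : ℤ, QDPoly.qMultinom (1 : ℤ) (p ^ k) p = p * m ∧
    (m : ZMod p) ≠ 0 := by
  have hpos := pow_pos hp.out.pos k
  -- The factor of index `i` is `i + 1` modulo `p`, so only the last one, `i = p - 1`, is divisible
  -- by `p`. Absorption, `j C(N, j) = N C(N-1, j-1)` with `N = p^(k+1)` and `j = p^k`, extracts a
  -- single `p`.
  have h1 : (p ^ k * (p - 1) + p ^ k).choose (p ^ k) =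
      p * (p ^ k * (p - 1) + (p ^ k - 1)).choose (p ^ k - 1) := by
    have h := Nat.add_one_mul_choose_eq (p ^ k * (p - 1) + (p ^ k - 1)) (p ^ k - 1)
    have e1 : p ^ k * (p - 1) + (p ^ k - 1) + 1 = p ^ k * (p - 1) + p ^ k := by omega
    have e2 : p ^ k * (p - 1) + p ^ k = p ^ k * p := by
      rw [← Nat.mul_succ, Nat.succ_eq_add_one, Nat.sub_add_cancel hp.out.one_le]
    rw [e1, Nat.sub_add_cancel hpos] at h
    apply Nat.eq_of_mul_eq_mul_right hpos
    rw [← h]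
    conv_lhs => rw [e2]
    ring
  refine ⟨((∏ i ∈ Finset.range (p - 1), (p ^ k * i + p ^ k).choose (p ^ k) : ℕ) : ℤ) *
    (p ^ k * (p - 1) + (p ^ k - 1)).choose (p ^ k - 1), ?_, ?_⟩
  · have e : Finset.range p = Finset.range (p - 1 + 1) := by rw [Nat.sub_add_cancel hp.out.one_le]
    rw [QDPoly.qMultinom, e, Finset.prod_range_succ]
    simp only [qBinom_one, h1]
    push_cast
    ring
  · have h2 := natCast_choose_low_ne_zero (p := p) (l := k) (m := p - 1) (r := p ^ k - 1) (by omega)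
    have h3 := prod_choose_ne_zero (p := p) k
    simp only [Int.cast_mul, Int.cast_natCast]
    exact mul_ne_zero h3 h2

end Binomial

/-! ### Units coming from `ℤ[q]` -/

section Units

open Polynomial

variable {p : ℕ} {A : Type*} [CommRing A] {q : A}

/-- The value at `q` of an integral polynomial. -/
noncomputable def evalQ (q : A) : Polynomial ℤ →+* A := eval₂RingHom (Int.castRingHom A) q

@[simp] theorem evalQ_X : evalQ q X = q := by simp [evalQ]

/-- The polynomials in `q` that are prime to `p` at `q = 1` become units. -/
def HasQUnits (p : ℕ) (q : A) : Prop :=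
  ∀ w : Polynomial ℤ, ((evalQ (1 : ℤ) w : ℤ) : ZMod p) ≠ 0 → IsUnit (evalQ q w)

theorem HasQUnits.map {B : Type*} [CommRing B] (h : HasQUnits p q) (f : A →+* B) :
    HasQUnits p (f q) := by
  intro w hw
  have e : f.comp (evalQ q) = evalQ (f q) := Polynomial.ringHom_ext' (RingHom.ext_int _ _) (by simp)
  rw [← e]
  exact (h w hw).map f

/-- The leading coefficient of `φ(ξ^[n+1]) / (p)_q`. -/
def divFrobLead (p : ℕ) (q : A) (n : ℕ) : A :=
  qBinom q (p - 1 + p * n) (p * n) * QDPoly.qMultinom q 1 (p - 1) * frobLead p q n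

theorem frobLead_succ (n : ℕ) : frobLead p q (n + 1) = qInt q p * divFrobLead p q n := rfl

theorem map_divFrobLead {B : Type*} [CommRing B] (f : A →+* B) (q : A) (n : ℕ) :
    f (divFrobLead p q n) = divFrobLead p (f q) n := by
  simp [divFrobLead, map_qBinom, QDPoly.map_qMultinom, map_frobLead]

theorem qInt_one_eq (n : ℕ) : qInt (1 : ℤ) n = n := by simp [qInt]

variable [hp : Fact p.Prime]

/-- A power series is a unit when its constant coefficient is; here that is the integer `w(1)`, a
unit of `ℤ_p` because it is prime to `p`. -/
theorem hasQUnits_powerSeries : HasQUnits p (1 + PowerSeries.X : PowerSeries ℤ_[p]) := by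
  intro w hw
  rw [PowerSeries.isUnit_iff_constantCoeff]
  have e : (PowerSeries.constantCoeff (R := ℤ_[p])).comp (evalQ (1 + PowerSeries.X)) =
      (Int.castRingHom ℤ_[p]).comp (evalQ 1) :=
    Polynomial.ringHom_ext' (RingHom.ext_int _ _) (by simp)
  have e' := RingHom.congr_fun e w
  rw [RingHom.comp_apply] at e'
  rw [e', PadicInt.isUnit_iff]
  refine le_antisymm (PadicInt.norm_le_one _) (not_lt.mp fun h => hw ?_)
  rw [RingHom.comp_apply, eq_intCast, PadicInt.norm_int_lt_one_iff_dvd] at h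
  rwa [ZMod.intCast_zmod_eq_zero_iff_dvd]

theorem HasQUnits.isUnit_qBinom (hu : HasQUnits p q) {n k : ℕ} (h : (n.choose k : ZMod p) ≠ 0) :
    IsUnit (qBinom q n k) := by
  have := hu (qBinom X n k) (by rw [map_qBinom, evalQ_X, qBinom_one]; simpa using h)
  rwa [map_qBinom, evalQ_X] at this

theorem HasQUnits.isUnit_qMultinom_pred (hu : HasQUnits p q) (k : ℕ) :
    IsUnit (QDPoly.qMultinom q (p ^ k) (p - 1)) := by
  have := hu (QDPoly.qMultinom X (p ^ k) (p - 1)) (by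
    rw [QDPoly.map_qMultinom, evalQ_X, QDPoly.qMultinom]
    have h := prod_choose_ne_zero (p := p) k
    simpa [qBinom_one] using h)
  rwa [QDPoly.map_qMultinom, evalQ_X] at this

/-- This coefficient is `(p-1)_q!`; its invertibility allows `ξ^[p]` to be solved for from
`φ(ξ)/(p)_q`. -/
theorem HasQUnits.isUnit_divFrobLead_zero (hu : HasQUnits p q) : IsUnit (divFrobLead p q 0) := by
  have h := hu.isUnit_qMultinom_pred 0
  simpa [divFrobLead, frobLead] using h

/-- The leading coefficient of `γ(ξ^[n])` is a unit if `n` is a power of `p`. -/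
theorem HasQUnits.isUnit_divFrobLead_sub (hu : HasQUnits p q) {k n : ℕ} (hn : n + 1 = p ^ k)
    {w : Polynomial ℤ}
    (hw : (p : Polynomial ℤ) * w = frobLead p X (n + 1) - QDPoly.qMultinom X (n + 1) p) :
    IsUnit (divFrobLead p q n - evalQ q w) := by
  have := hu (divFrobLead p X n - w) (by
    obtain ⟨m, hm, hm'⟩ := qMultinom_one_eq (p := p) k
    have h := congrArg (evalQ (1 : ℤ)) hw
    rw [map_mul, map_natCast, map_sub, map_frobLead, QDPoly.map_qMultinom, evalQ_X, frobLead_succ,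
      qInt_one_eq, hn, hm, ← mul_sub] at h
    -- At `q = 1` one has `(p)_q = p`, so cancelling `p` leaves `w(1) = divFrobLead - m`, and `m` is
    -- prime to `p`.
    have h2 := mul_left_cancel₀ (Int.natCast_ne_zero.mpr hp.out.ne_zero) h
    rw [map_sub, map_divFrobLead, evalQ_X, h2, sub_sub_cancel]
    exact hm')
  rwa [map_sub, map_divFrobLead, evalQ_X] at this

/-- The leading coefficient of `δ(ξ^[n])` is a unit if `n ≠ 1` is a power of `p`. -/
theorem HasQUnits.isUnit_coeff_delta (hu : HasQUnits p q) {k n : ℕ} (hn : n + 2 = p ^ k)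
    {w : Polynomial ℤ}
    (hw : (p : Polynomial ℤ) * w = frobLead p X (n + 2) - QDPoly.qMultinom X (n + 2) p) :
    IsUnit (evalQ q w) := by
  refine hu w ?_
  obtain ⟨m, hm, hm'⟩ := qMultinom_one_eq (p := p) k
  have h := congrArg (evalQ (1 : ℤ)) hw
  rw [map_mul, map_natCast, map_sub, map_frobLead, QDPoly.map_qMultinom, evalQ_X, frobLead_succ,
    qInt_one_eq, hn, hm, ← mul_sub] at h
  have h2 := mul_left_cancel₀ (Int.natCast_ne_zero.mpr hp.out.ne_zero) h
  -- For index at least `2` the term `divFrobLead` contains a second factor `(p)_q`, which is `p` at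
  -- `q = 1`; so `w(1) ≡ -m` modulo `p`. For index `1` this factor is missing.
  rw [h2, divFrobLead, frobLead_succ, qInt_one_eq]
  push_cast
  simpa using hm'

/-- The unit that controls the relation for the `p`-th power of `ξ^[p^k]`. -/
theorem HasQUnits.isUnit_delta_sub (hu : HasQUnits p q) (δA : DeltaStructure p A) (hδq : δA q = 0)
    (k : ℕ) (w : Polynomial ℤ) :
    IsUnit (δA (QDPoly.qMultinom q (p ^ k) p) - evalQ q w *
      ∑ i ∈ Finset.range p, QDPoly.qMultinom q (p ^ k) p ^ i *
        (QDPoly.qMultinom q (p ^ k) p + p * evalQ q w) ^ (p - 1 - i)) := by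
  obtain ⟨m, hm, hm'⟩ := qMultinom_one_eq (p := p) k
  let s : Polynomial ℤ →+* W2 p (Polynomial ℤ) := eval₂RingHom (Int.castRingHom _) ⟨X, 0⟩
  have hs : (W2.fstHom p _).comp s = RingHom.id _ :=
    Polynomial.ringHom_ext' (RingHom.ext_int _ _) (by simp [s])
  have hsA : (W2.map p (evalQ q)).comp s = δA.toW2.comp (evalQ q) := by
    refine Polynomial.ringHom_ext' (RingHom.ext_int _ _) ?_
    ext <;> simp [s, hδq]
  set c : Polynomial ℤ := QDPoly.qMultinom X (p ^ k) p with hc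
  have hcq : evalQ q c = QDPoly.qMultinom q (p ^ k) p := by
    rw [hc, QDPoly.map_qMultinom, evalQ_X]
  have hc1 : evalQ (1 : ℤ) c = p * m := by rw [hc, QDPoly.map_qMultinom, evalQ_X, hm]
  have hδc : evalQ q (s c).snd = δA (evalQ q c) :=
    congrArg W2.snd (RingHom.congr_fun hsA c)
  have := hu ((s c).snd - w * ∑ i ∈ Finset.range p, c ^ i * (c + (p : Polynomial ℤ) * w) ^ (p - 1 - i))
    (by
    let δX := DeltaStructure.ofW2 s fun a => RingHom.congr_fun hs a
    have hδX : δX X = 0 := by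
      change (s X).snd = 0
      simp [s]
    -- Since `φ(q) = q^p`, evaluation at `q = 1` is invariant under `φ`. Hence `c(1)^p + p δ(c)(1) =
    -- c(1)` with `c(1) = p m`, which gives `δ(c)(1) ≡ m` modulo `p`.
    have h1 : (evalQ (1 : ℤ)).comp δX.frobHom = evalQ 1 :=
      Polynomial.ringHom_ext' (RingHom.ext_int _ _) (by
        simp [DeltaStructure.frob_apply, hδX])
    have h2 := RingHom.congr_fun h1 c
    rw [RingHom.comp_apply, DeltaStructure.frobHom_apply, DeltaStructure.frob_apply, map_add,
      map_pow, map_mul, map_natCast, hc1] at h2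
    change _ + (p : ℤ) * evalQ 1 (s c).snd = _ at h2
    have hp0 : (p : ℤ) ≠ 0 := Int.natCast_ne_zero.mpr hp.out.ne_zero
    have hp1 : p ≠ 1 := hp.out.ne_one
    have h3 : evalQ 1 (s c).snd = m - p ^ (p - 1) * m ^ p := by
      apply mul_left_cancel₀ hp0
      have : (p : ℤ) ^ p = p * p ^ (p - 1) := by
        rw [← pow_succ', Nat.sub_add_cancel hp.out.one_le]
      rw [mul_pow, this] at h2
      linear_combination h2
    have h4 : p - 1 ≠ 0 := by have := hp.out.two_le; omega
    -- Each summand is at `q = 1` a product of `p - 1 ≥ 1` multiples of `p`.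
    have h5 : ((evalQ (1 : ℤ) (∑ i ∈ Finset.range p, c ^ i * (c + (p : Polynomial ℤ) * w) ^ (p - 1 - i))
        : ℤ) : ZMod p) = 0 := by
      rw [map_sum, Int.cast_sum]
      refine Finset.sum_eq_zero fun i hi => ?_
      rw [map_mul, map_pow, map_pow, map_add, map_mul, map_natCast, hc1]
      push_cast
      rw [ZMod.natCast_self, zero_mul, zero_mul, add_zero, ← pow_add, zero_pow]
      rw [Finset.mem_range] at hi
      omega
    rw [map_sub, map_mul, h3]
    push_cast at h5 ⊢
    rw [h5, ZMod.natCast_self, zero_pow h4]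
    simpa using hm')
  rw [map_sub, map_mul, hδc, map_sum, hcq] at this
  simpa only [map_mul, map_pow, map_add, map_natCast, hcq] using this

end Units
-- Formally this is `(φ(a)^n - (a^p)^n)/p` factored through `φ(a) - a^p = p δ(a)`; the induction
-- avoids dividing by `p`.
theorem DeltaStructure.map_pow {p : ℕ} {A : Type*} [CommRing A] (δ : DeltaStructure p A) (a : A)
    (n : ℕ) : δ (a ^ n) = δ a * ∑ i ∈ Finset.range n, (a ^ p) ^ i * δ.frob a ^ (n - 1 - i) := by
  induction n with
  | zero => simp
  | succ n ih =>
    rw [pow_succ', DeltaStructure.map_mul, Nat.add_sub_cancel, geom_sum₂_succ_eq]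
    have h : δ.frob a = a ^ p + p * δ a := rfl
    rw [ih, ← pow_mul, ← pow_mul, mul_comm n p]
    rw [mul_add]
    linear_combination (-(δ a * ∑ i ∈ Finset.range n, (a ^ p) ^ i * δ.frob a ^ (n - 1 - i))) * h

/-! ### Triangular recursion and multiplicativity in low degree -/

namespace QDPoly

variable {A : Type*} [CommRing A] {q x y : A} {B : Type*} [CommRing B] {s : A →+* B}

/-- Recursive construction of the images of the generators. -/
theorem exists_liftAdd_seq (s : A →+* B) (Good : ℕ → (ℕ → B) → Prop)
    (H : ∀ n, ∃ (Z : QDPoly A q y) (val : (ℕ → B) → B), Z ∈ degLT A q y (n + 1) ∧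
      IsUnit (coeff n Z) ∧ (∀ e e' : ℕ → B, (∀ m < n, e m = e' m) → val e = val e') ∧
      ∀ e, liftAdd q y s e Z = val e → Good n e) :
    ∃ e : ℕ → B, ∀ n, Good n e := by
  choose Z val hZ hlead hval hgood using H
  -- Solve for `e_n` by inverting the leading coefficient of `Z n`. The default `0` from index `n`
  -- on is harmless: `val n` and the remainder of `Z n` only involve indices below `n`.
  let F : (n : ℕ) → ((m : ℕ) → m < n → B) → B := fun n prev =>
    s (Ring.inverse (coeff n (Z n))) *
      (val n (fun m => if h : m < n then prev m h else 0) -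
        liftAdd q y s (fun m => if h : m < n then prev m h else 0) (Z n - coeff n (Z n) • dp q y n))
  let e : ℕ → B := fun n => Nat.lt_wfRel.wf.fix F n
  have he : ∀ n, e n = F n fun m _ => e m := fun n => Nat.lt_wfRel.wf.fix_eq F n
  refine ⟨e, fun n => hgood n e ?_⟩
  have h1 : ∀ m < n, e m = if _h : m < n then e m else 0 := fun m hm => by simp [hm]
  have h2 : s (coeff n (Z n)) * e n = val n e -
      liftAdd q y s e (Z n - coeff n (Z n) • dp q y n) := by
    rw [hval n e _ h1, liftAdd_congr s h1 (sub_lead_mem (hZ n)), he n, ← mul_assoc, ← map_mul,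
      Ring.mul_inverse_cancel _ (hlead n), map_one, one_mul]
  rw [map_sub, liftAdd_smul, liftAdd_dp] at h2
  linear_combination h2

/-! ### Partial multiplicativity -/

/-- Multiplicativity of the map `ξ^[n] ↦ e_n` in total degree `< N`. -/
def MulUpTo (q y : A) (s : A →+* B) (e : ℕ → B) (N : ℕ) : Prop :=
  ∀ i j, i + j < N → liftAdd q y s e (dp q y i * dp q y j) = e i * e j

section MulUpTo

variable {e : ℕ → B} {N : ℕ}

theorem MulUpTo.map_mul (h : MulUpTo q y s e N) {a b : ℕ} {z w : QDPoly A q y}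
    (hz : z ∈ degLT A q y (a + 1)) (hw : w ∈ degLT A q y (b + 1)) (hab : a + b < N) :
    liftAdd q y s e (z * w) = liftAdd q y s e z * liftAdd q y s e w := by
  refine degLT_induction (P := fun z => liftAdd q y s e (z * w) = liftAdd q y s e z *
    liftAdd q y s e w) (by simp) ?_ ?_ hz
  · intro u v _ _ hu hv
    rw [add_mul, map_add, hu, hv, map_add, add_mul]
  · intro r i hi
    refine degLT_induction (P := fun w => liftAdd q y s e (r • dp q y i * w) =
      liftAdd q y s e (r • dp q y i) * liftAdd q y s e w) (by simp) ?_ ?_ hw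
    · intro u v _ _ hu hv
      rw [mul_add, map_add, hu, hv, map_add, mul_add]
    · intro t j hj
      rw [smul_mul_smul_comm, liftAdd_smul, h i j (by omega), liftAdd_smul_dp, liftAdd_smul_dp,
        _root_.map_mul]
      ring

theorem MulUpTo.map_mul_of_lt (h : MulUpTo q y s e N) {a b : ℕ} {z w : QDPoly A q y}
    (hz : z ∈ degLT A q y a) (hw : w ∈ degLT A q y (b + 1)) (hab : a + b ≤ N) :
    liftAdd q y s e (z * w) = liftAdd q y s e z * liftAdd q y s e w := by
  rcases a with _ | a
  · rw [mem_degLT_zero.mp hz, zero_mul, map_zero, zero_mul]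
  · exact h.map_mul hz hw (by omega)

theorem liftAdd_one (h0 : e 0 = 1) : liftAdd q y s e 1 = 1 := by
  rw [← dp_zero, liftAdd_dp, h0]

theorem list_prod_mem_degLT {a : ℕ} (l : List (QDPoly A q y)) (hl : ∀ z ∈ l, z ∈ degLT A q y (a + 1)) :
    l.prod ∈ degLT A q y (a * l.length + 1) := by
  induction l with
  | nil => exact one_mem_degLT (by simp)
  | cons z l ih =>
    rw [List.prod_cons, List.length_cons, mul_add, mul_one, add_comm (a * l.length)]
    exact mul_mem_degLT (hl z (by simp)) (ih fun w hw => hl w (by simp [hw]))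

theorem MulUpTo.map_list_prod (h : MulUpTo q y s e N) (h0 : e 0 = 1) {a : ℕ}
    (l : List (QDPoly A q y)) (hl : ∀ z ∈ l, z ∈ degLT A q y (a + 1)) (hN : a * l.length < N) :
    liftAdd q y s e l.prod = (l.map (liftAdd q y s e)).prod := by
  induction l with
  | nil => exact liftAdd_one h0
  | cons z l ih =>
    rw [List.length_cons, mul_add, mul_one] at hN
    have hl' : ∀ w ∈ l, w ∈ degLT A q y (a + 1) := fun w hw => hl w (by simp [hw])
    rw [List.prod_cons, List.map_cons, List.prod_cons, h.map_mul (hl z (by simp))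
      (list_prod_mem_degLT l hl') (by omega), ih hl' (by omega)]

theorem MulUpTo.map_pow (h : MulUpTo q y s e N) (h0 : e 0 = 1) {a : ℕ} {z : QDPoly A q y}
    (hz : z ∈ degLT A q y (a + 1)) {j : ℕ} (hN : a * j < N) :
    liftAdd q y s e (z ^ j) = liftAdd q y s e z ^ j := by
  have := h.map_list_prod h0 (List.replicate j z)
    (fun w hw => List.eq_of_mem_replicate hw ▸ hz) (by simpa using hN)
  simpa using this

theorem liftAdd_natCast_mul (n : ℕ) (z : QDPoly A q y) :
    liftAdd q y s e ((n : QDPoly A q y) * z) = n * liftAdd q y s e z := by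
  rw [← nsmul_eq_mul, map_nsmul, nsmul_eq_mul]

theorem liftAdd_algebraMap_mul (a : A) (z : QDPoly A q y) :
    liftAdd q y s e (algebraMap A _ a * z) = s a * liftAdd q y s e z := by
  rw [← Algebra.smul_def, liftAdd_smul]

theorem liftAdd_algebraMap (h0 : e 0 = 1) (a : A) : liftAdd q y s e (algebraMap A _ a) = s a := by
  rw [← mul_one (algebraMap A _ a), liftAdd_algebraMap_mul, liftAdd_one h0, mul_one]

theorem algebraMap_mem_degLT (a : A) : algebraMap A (QDPoly A q y) a ∈ degLT A q y (0 + 1) := by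
  rw [algebraMap_apply]
  exact Submodule.smul_mem _ _ (one_mem_degLT one_pos)

theorem natCast_mul_mem_degLT (n : ℕ) {M : ℕ} {z : QDPoly A q y} (hz : z ∈ degLT A q y M) :
    (n : QDPoly A q y) * z ∈ degLT A q y M := by
  rw [← nsmul_eq_mul]
  exact nsmul_mem hz n

/-- Only mixed products `z^i w^(p-i)` with `0 < i < p` occur, so multiplicativity is not needed in
the degrees of the pure powers `z^p` and `w^p`. -/
theorem MulUpTo.map_carry {p : ℕ} (h : MulUpTo q y s e N) (h0 : e 0 = 1) {a b : ℕ}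
    {z w : QDPoly A q y} (hz : z ∈ degLT A q y (a + 1)) (hw : w ∈ degLT A q y (b + 1))
    (hN : ∀ i ∈ Finset.Ico 1 p, a * i + b * (p - i) < N) :
    liftAdd q y s e (carry p z w) = carry p (liftAdd q y s e z) (liftAdd q y s e w) := by
  rw [carry, carry, map_sum]
  refine Finset.sum_congr rfl fun i hi => ?_
  have hi' := hN i hi
  rw [mul_assoc, liftAdd_natCast_mul, h.map_mul (pow_mem_degLT hz i) (pow_mem_degLT hw _) hi',
    h.map_pow h0 hz (by omega), h.map_pow h0 hw (by omega), mul_assoc]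

theorem carry_mem_degLT {p a : ℕ} {z w : QDPoly A q y} (hz : z ∈ degLT A q y (a + 1))
    (hw : w ∈ degLT A q y (a + 1)) : carry p z w ∈ degLT A q y (p * a + 1) := by
  refine sum_mem fun i hi => ?_
  rw [Finset.mem_Ico] at hi
  rw [mul_assoc]
  refine natCast_mul_mem_degLT _ ?_
  have := mul_mem_degLT (pow_mem_degLT hz i) (pow_mem_degLT hw (p - i))
  rwa [← mul_add, Nat.add_sub_cancel' hi.2.le, mul_comm a p] at this

end MulUpTo

/-! ### Compatibility with `δ` in low degree -/

section Delta

variable {p : ℕ} {δA : DeltaStructure p A} {δ : DeltaStructure p (QDPoly A q y)}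

theorem IsStandardDelta.delta_mem_degLT (hst : IsStandardDelta x δA δ) {a : ℕ} {z : QDPoly A q y}
    (hz : z ∈ degLT A q y (a + 1)) : δ z ∈ degLT A q y (p * a + 1) := by
  refine (degLT_induction (P := fun z => δ z ∈ degLT A q y (p * a + 1)) ?_ ?_ ?_ hz)
  · simp
  · intro u v hu hv h1 h2
    rw [DeltaStructure.map_add]
    exact sub_mem (add_mem h1 h2) (carry_mem_degLT hu hv)
  · intro r n hn
    have hpn : p * n ≤ p * a := Nat.mul_le_mul_left p (by omega)
    rw [Algebra.smul_def, DeltaStructure.map_mul, ← hst.algebraMap_delta, ← map_pow, mul_assoc,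
      ← Algebra.smul_def, mul_comm _ (algebraMap A _ (δA r)), ← Algebra.smul_def,
      ← Algebra.smul_def]
    have h1 := degLT_mono (by omega) (hst.delta_dp_mem_degLT n) (N := p * a + 1)
    have h2 := pow_mem_degLT (dp_mem_degLT (q := q) (y := y) n.lt_succ_self) p
    rw [mul_comm n p] at h2
    exact add_mem (add_mem (Submodule.smul_mem _ _ h1)
      (Submodule.smul_mem _ _ (degLT_mono (by omega) h2)))
      (natCast_mul_mem_degLT p (Submodule.smul_mem _ _ h1))

variable [hp : Fact p.Prime] {δB : DeltaStructure p B} {e : ℕ → B} {N : ℕ}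

/-- Compatibility of the map `ξ^[n] ↦ e_n` with `δ` in low degree only has to be checked on the
generators whose index is a power of `p`. -/
theorem MulUpTo.map_delta (h : MulUpTo q y s e N) (hst : IsStandardDelta x δA δ)
    (hs : IsDeltaHom δA δB s) (hu : HasQUnits p q) (h0 : e 0 = 1) {a : ℕ} (ha : p * a < N)
    (hgen : ∀ k, p ^ k ≤ a → liftAdd q y s e (δ (dp q y (p ^ k))) = δB (e (p ^ k)))
    {z : QDPoly A q y} (hz : z ∈ degLT A q y (a + 1)) :
    liftAdd q y s e (δ z) = δB (liftAdd q y s e z) := by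
  have hmul : ∀ {b c : ℕ} {z w : QDPoly A q y}, z ∈ degLT A q y (b + 1) → w ∈ degLT A q y (c + 1) →
      b + c ≤ a → liftAdd q y s e (δ z) = δB (liftAdd q y s e z) →
      liftAdd q y s e (δ w) = δB (liftAdd q y s e w) →
      liftAdd q y s e (δ (z * w)) = δB (liftAdd q y s e (z * w)) := by
    intro b c z w hz hw hbc h1 h2
    have hpbc : p * b + p * c ≤ p * a := by rw [← mul_add]; exact Nat.mul_le_mul_left p hbc
    have hle : a ≤ p * a := Nat.le_mul_of_pos_left a hp.out.pos
    have hz' := pow_mem_degLT hz p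
    have hw' := pow_mem_degLT hw p
    rw [mul_comm] at hz' hw'
    rw [DeltaStructure.map_mul, map_add, map_add,
      h.map_mul hz' (hst.delta_mem_degLT hw) (by omega),
      h.map_mul hw' (hst.delta_mem_degLT hz) (by omega),
      mul_assoc, liftAdd_natCast_mul, h.map_mul (hst.delta_mem_degLT hz)
      (hst.delta_mem_degLT hw) (by omega), h.map_pow h0 hz (by rw [mul_comm]; omega),
      h.map_pow h0 hw (by rw [mul_comm]; omega), h1, h2, h.map_mul hz hw (by omega),
      DeltaStructure.map_mul]
    ring
  have hadd : ∀ {z w : QDPoly A q y}, z ∈ degLT A q y (a + 1) → w ∈ degLT A q y (a + 1) →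
      liftAdd q y s e (δ z) = δB (liftAdd q y s e z) →
      liftAdd q y s e (δ w) = δB (liftAdd q y s e w) →
      liftAdd q y s e (δ (z + w)) = δB (liftAdd q y s e (z + w)) := by
    intro z w hz hw h1 h2
    rw [DeltaStructure.map_add, map_sub, map_add, map_add, DeltaStructure.map_add, h1, h2,
      h.map_carry h0 hz hw fun i hi => ?_]
    rw [Finset.mem_Ico] at hi
    rw [← mul_add, Nat.add_sub_cancel' hi.2.le, mul_comm]
    exact ha
  have hsmul : ∀ (r : A) {z : QDPoly A q y}, z ∈ degLT A q y (a + 1) →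
      liftAdd q y s e (δ z) = δB (liftAdd q y s e z) →
      liftAdd q y s e (δ (r • z)) = δB (liftAdd q y s e (r • z)) := by
    intro r z hz h1
    rw [Algebra.smul_def]
    refine hmul (algebraMap_mem_degLT r) hz (by omega) ?_ h1
    rw [← hst.algebraMap_delta, liftAdd_algebraMap h0, liftAdd_algebraMap h0, hs]
  have key : ∀ n ≤ a, liftAdd q y s e (δ (dp q y n)) = δB (e n) := by
    intro n
    induction n using Nat.strong_induction_on with
    | _ n ih =>
    intro hn
    by_cases hn0 : n = 0
    · subst hn0
      rw [h0, dp_zero, DeltaStructure.map_one, DeltaStructure.map_one, map_zero]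
    by_cases hpow : n = p ^ Nat.log p n
    · rw [hpow]
      exact hgen _ (hpow ▸ hn)
    set P := p ^ Nat.log p n
    have hP : P ≤ n := Nat.pow_log_le_self p hn0
    have hPpos : 0 < P := pow_pos hp.out.pos _
    have hlow : ∀ w ∈ degLT A q y n, liftAdd q y s e (δ w) = δB (liftAdd q y s e w) := by
      intro w hw
      refine degLT_induction
        (P := fun w => liftAdd q y s e (δ w) = δB (liftAdd q y s e w)) (by simp) ?_ ?_ hw
      · exact fun u v hu hv => hadd (degLT_mono (by omega) hu) (degLT_mono (by omega) hv)
      · intro r m hm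
        refine hsmul r (dp_mem_degLT (by omega)) ?_
        rw [liftAdd_dp]
        exact ih m hm (by omega)
    have hprod := dp_mul_dp_mem_degLT (q := q) (y := y) (n - P) P
    have hco := coeff_dp_mul_dp (q := q) (y := y) (n - P) P
    rw [Nat.add_sub_cancel' hP] at hprod hco
    have hunit : IsUnit (qBinom q n (n - P)) := hu.isUnit_qBinom (by
      rw [Nat.choose_symm hP]
      exact natCast_choose_pow_log_ne_zero hn0)
    obtain ⟨b, hb⟩ := hunit.exists_left_inv
    have hL := sub_lead_mem hprod
    rw [hco] at hL
    -- `ξ^[n]` is a unit multiple of `ξ^[P] ξ^[n-P]` up to lower degree; sums, products and scalar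
    -- multiples preserve compatibility with `δ`.
    have e1 : dp q y n = b • (dp q y P * dp q y (n - P)) +
        (-b) • (dp q y P * dp q y (n - P) - qBinom q n (n - P) • dp q y n) := by
      rw [neg_smul, smul_sub, smul_smul, hb, one_smul]
      abel
    rw [← liftAdd_dp (q := q) (y := y) s e n, e1]
    have hL' := degLT_mono (q := q) (y := y) (show n ≤ a + 1 by omega) hL
    have hprod' := degLT_mono (q := q) (y := y) (show n + 1 ≤ a + 1 by omega) hprod
    refine hadd (Submodule.smul_mem _ _ hprod') (Submodule.smul_mem _ _ hL') (hsmul b hprod' ?_)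
      (hsmul _ hL' (hlow _ hL))
    refine hmul (dp_mem_degLT P.lt_succ_self) (dp_mem_degLT (n - P).lt_succ_self) (by omega) ?_ ?_
    · rw [liftAdd_dp]
      exact ih P (lt_of_le_of_ne hP (Ne.symm hpow)) (by omega)
    · rw [liftAdd_dp]
      exact ih (n - P) (by omega) (by omega)
  refine degLT_induction
    (P := fun w => liftAdd q y s e (δ w) = δB (liftAdd q y s e w)) (by simp) ?_ ?_ hz
  · exact fun u v hu hv => hadd hu hv
  · intro r m hm
    refine hsmul r (dp_mem_degLT hm) ?_
    rw [liftAdd_dp]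
    exact key m (by omega)

end Delta

end QDPoly

/-! ### Defects of multiplicativity and the induction on the degree -/

namespace QDPoly

variable {A : Type*} [CommRing A] {q x y : A} {B : Type*} [CommRing B] {s : A →+* B} {e : ℕ → B}
  {N : ℕ}

/-- The failure of the map `ξ^[n] ↦ e_n` to respect the product `ξ^[i] ξ^[j]`. -/
noncomputable def mulDefect (q y : A) (s : A →+* B) (e : ℕ → B) (i j : ℕ) : B :=
  liftAdd q y s e (dp q y i * dp q y j) - e i * e j

theorem mulDefect_comm (i j : ℕ) : mulDefect q y s e i j = mulDefect q y s e j i := by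
  rw [mulDefect, mulDefect, mul_comm, mul_comm (e i)]

/-- The part of `ξ^[a] ξ^[b]` below degree `a + b` multiplies correctly with `ξ^[c]`, so only the
leading term leaves a defect. -/
theorem MulUpTo.mulDefect_assoc (h : MulUpTo q y s e N) {a b c : ℕ} (hab : a + b < N)
    (hN : a + b + c ≤ N) :
    liftAdd q y s e (dp q y a * dp q y b * dp q y c) - e a * e b * e c =
      s (qBinom q (a + b) b) * mulDefect q y s e (a + b) c := by
  have hL := sub_lead_mem (dp_mul_dp_mem_degLT (q := q) (y := y) b a)
  rw [coeff_dp_mul_dp] at hL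
  set L := dp q y a * dp q y b - qBinom q (a + b) b • dp q y (a + b) with hLdef
  have e1 : dp q y a * dp q y b = qBinom q (a + b) b • dp q y (a + b) + L := by
    rw [hLdef]; abel
  have h1 := h a b hab
  rw [e1, map_add, liftAdd_smul_dp] at h1
  rw [e1, add_mul, map_add, smul_mul_assoc, liftAdd_smul,
    h.map_mul_of_lt hL (dp_mem_degLT c.lt_succ_self) hN, liftAdd_dp, mulDefect]
  linear_combination e c * h1

/-- The two bracketings of `ξ^[a] ξ^[b] ξ^[c]` give the same total defect. When the binomial
coefficient on one side is a unit, vanishing passes to that side. -/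
theorem MulUpTo.mulDefect_cocycle (h : MulUpTo q y s e N) {a b c : ℕ} (hab : a + b < N)
    (hbc : b + c < N) (hN : a + b + c = N) :
    s (qBinom q (a + b) b) * mulDefect q y s e (a + b) c =
      s (qBinom q (b + c) b) * mulDefect q y s e (b + c) a := by
  have h1 := h.mulDefect_assoc hab hN.le
  have h2 := h.mulDefect_assoc (a := c) (b := b) (c := a) (by omega) (by omega)
  rw [add_comm b c, ← h1, ← h2, mul_comm (dp q y c * dp q y b), mul_comm (dp q y c),
    mul_assoc (dp q y a)]
  ring

/-- The product of `j` elements of degree at most `n` and of `p - j` copies of `ξ^[n]`. -/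
theorem MulUpTo.list_prod_defect {p n : ℕ} (h : MulUpTo q y s e (n * p)) (h0 : e 0 = 1)
    (l : List (QDPoly A q y)) (hl : ∀ z ∈ l, z ∈ degLT A q y (n + 1)) {j : ℕ}
    (hj : l.length + j = p) :
    liftAdd q y s e (l.prod * dp q y n ^ j) - (l.map (liftAdd q y s e)).prod * e n ^ j =
      s (l.map (coeff n)).prod * (liftAdd q y s e (dp q y n ^ p) - e n ^ p) := by
  induction l generalizing j with
  | nil =>
    rw [List.length_nil, zero_add] at hj
    simp [hj]
  | cons z l ih =>
    rw [List.length_cons] at hj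
    have hl' : ∀ w ∈ l, w ∈ degLT A q y (n + 1) := fun w hw => hl w (by simp [hw])
    have h1 := ih hl' (j := j + 1) (by omega)
    have hz := hl z (by simp)
    have hL := sub_lead_mem hz
    have hlj : n * l.length + n * j + n = n * p := by rw [← hj]; ring
    have hdp := dp_mem_degLT (q := q) (y := y) n.lt_succ_self
    set c := coeff n z
    set L := z - c • dp q y n with hLdef
    have e1 : z = c • dp q y n + L := by rw [hLdef]; abel
    have hrest : l.prod * dp q y n ^ j ∈ degLT A q y (n * l.length + n * j + 1) :=
      mul_mem_degLT (list_prod_mem_degLT l hl') (pow_mem_degLT hdp j)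
    have e2 : (z :: l).prod * dp q y n ^ j =
        c • (l.prod * dp q y n ^ (j + 1)) + L * (l.prod * dp q y n ^ j) := by
      rw [List.prod_cons]
      conv_lhs => rw [e1]
      rw [add_mul, add_mul, smul_mul_assoc, smul_mul_assoc]
      congr 1
      · congr 1
        ring
      · ring
    have h2 : liftAdd q y s e (L * (l.prod * dp q y n ^ j)) = liftAdd q y s e L *
        ((l.map (liftAdd q y s e)).prod * e n ^ j) := by
      -- For `n = 0` the bound `n * p` gives no multiplicativity, but the remainder `L` is then
      -- zero.
      rcases Nat.eq_zero_or_pos n with hn | hn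
      · have hL0 : L = 0 := by
          rw [hn] at hL
          exact mem_degLT_zero.mp hL
        rw [hL0, zero_mul, map_zero, zero_mul]
      · rw [h.map_mul_of_lt hL hrest (by omega),
          h.map_mul (list_prod_mem_degLT l hl') (pow_mem_degLT hdp j) (by omega),
          h.map_list_prod h0 l hl' (by omega), h.map_pow h0 hdp (by omega), liftAdd_dp]
    have h3 : liftAdd q y s e z = s c * e n + liftAdd q y s e L := by
      conv_lhs => rw [e1]
      rw [map_add, liftAdd_smul_dp]
    rw [e2, map_add, liftAdd_smul, h2, List.map_cons, List.prod_cons, List.map_cons, List.prod_cons,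
      h3, RingHom.map_mul]
    linear_combination s c * h1

section Prime

variable {p : ℕ} [hp : Fact p.Prime]

theorem HasQUnits.eq_zero_of_mul_eq_zero (hu : HasQUnits p q) {n k : ℕ}
    (h : (n.choose k : ZMod p) ≠ 0) {b : B} (hb : s (qBinom q n k) * b = 0) : b = 0 :=
  ((hu.isUnit_qBinom h).map s).mul_right_eq_zero.mp hb

/-- The vanishing of the defects follows from the case where one index is a power of `p`. -/
theorem MulUpTo.succ_of_pow (h : MulUpTo q y s e N) (hu : HasQUnits p q) (h0 : e 0 = 1)
    (H : ∀ l, p ^ l < N → mulDefect q y s e (p ^ l) (N - p ^ l) = 0) :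
    MulUpTo q y s e (N + 1) := by
  intro i j hij
  rcases (Nat.lt_succ_iff.mp hij).lt_or_eq with hlt | heq
  · exact h i j hlt
  by_cases hi : i = 0
  · rw [hi, dp_zero, one_mul, liftAdd_dp, h0, one_mul]
  by_cases hj : j = 0
  · rw [hj, dp_zero, mul_one, liftAdd_dp, h0, mul_one]
  set P := p ^ Nat.log p i
  have hP : P ≤ i := Nat.pow_log_le_self p hi
  have hPpos : 0 < P := pow_pos hp.out.pos _
  -- Splitting the leading power `P` off `i` trades the defect at `(i, j)` for the one at `(N - P,
  -- P)`.
  have h1 := h.mulDefect_cocycle (a := P) (b := i - P) (c := j) (by omega) (by omega) (by omega)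
  have h2 := H (Nat.log p i) (show P < N by omega)
  change mulDefect q y s e P (N - P) = 0 at h2
  rw [show i - P + j = N - P by omega, mulDefect_comm _ P, h2, mul_zero, Nat.add_sub_cancel' hP] at h1
  have h3 := HasQUnits.eq_zero_of_mul_eq_zero hu (by
    rw [Nat.choose_symm hP]
    exact natCast_choose_pow_log_ne_zero hi) h1
  exact sub_eq_zero.mp h3

/-- The inductive step when the degree is not a power of `p`. -/
theorem MulUpTo.succ_of_ne_pow (h : MulUpTo q y s e N) (hu : HasQUnits p q) (h0 : e 0 = 1)
    (hN0 : N ≠ 0) (hN : N ≠ p ^ Nat.log p N)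
    (hlog : liftAdd q y s e (dp q y (p ^ Nat.log p N) * dp q y (N - p ^ Nat.log p N)) =
      e (p ^ Nat.log p N) * e (N - p ^ Nat.log p N)) : MulUpTo q y s e (N + 1) := by
  set K := Nat.log p N with hK
  have hPN : p ^ K ≤ N := Nat.pow_log_le_self p hN0
  have hNP : N < p ^ (K + 1) := Nat.lt_pow_succ_log_self hp.out.one_lt N
  have hPpos : 0 < p ^ K := pow_pos hp.out.pos _
  have hbase : mulDefect q y s e (p ^ K) (N - p ^ K) = 0 := sub_eq_zero.mpr hlog
  refine h.succ_of_pow hu h0 fun l hl => ?_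
  have hlpos : 0 < p ^ l := pow_pos hp.out.pos _
  have hlK : l ≤ K := by
    by_contra hc
    have := Nat.pow_le_pow_right hp.out.pos (show K + 1 ≤ l by omega)
    omega
  rw [mulDefect_comm]
  -- The known relation has indices `p^K` and `N - p^K`. If `p^K` fits into `N - p^l`, split it off.
  -- Otherwise `N - p^K < p^l`, and splitting off `N - p^K` gives a binomial coefficient without
  -- carries.
  rcases le_or_gt (p ^ K) (N - p ^ l) with hle | hlt
  · have hl' : Nat.log p (N - p ^ l) = K :=
      Nat.log_eq_of_pow_le_of_lt_pow hle (by omega)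
    have h1 := h.mulDefect_cocycle (a := p ^ K) (b := N - p ^ l - p ^ K) (c := p ^ l)
      (by omega) (by omega) (by omega)
    rw [Nat.add_sub_cancel' hle, show N - p ^ l - p ^ K + p ^ l = N - p ^ K by omega,
      mulDefect_comm (N - p ^ K), hbase, mul_zero] at h1
    refine HasQUnits.eq_zero_of_mul_eq_zero hu ?_ h1
    rw [Nat.choose_symm hle]
    have := natCast_choose_pow_log_ne_zero (p := p) (n := N - p ^ l) (by omega)
    rwa [hl'] at this
  · have hPl : p ^ l ≤ p ^ K := Nat.pow_le_pow_right hp.out.pos hlK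
    have h1 := h.mulDefect_cocycle (a := N - p ^ K) (b := p ^ K - p ^ l) (c := p ^ l)
      (by omega) (by omega) (by omega)
    rw [show N - p ^ K + (p ^ K - p ^ l) = N - p ^ l by omega, Nat.sub_add_cancel hPl, hbase,
      mul_zero] at h1
    refine HasQUnits.eq_zero_of_mul_eq_zero hu ?_ h1
    have h2 := natCast_choose_low_ne_zero (p := p) (l := l) (m := p ^ (K - l) - 1)
      (r := N - p ^ K) (by omega)
    have e1 : p ^ l * (p ^ (K - l) - 1) = p ^ K - p ^ l := by
      rw [Nat.mul_sub, ← pow_add, Nat.add_sub_cancel' hlK, mul_one]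
    rw [e1, show p ^ K - p ^ l + (N - p ^ K) = N - p ^ l by omega] at h2
    rwa [← Nat.choose_symm (by omega), show N - p ^ l - (p ^ K - p ^ l) = N - p ^ K by omega]

/-- The inductive step when the degree is a power of `p`. -/
theorem MulUpTo.succ_of_eq_pow {k : ℕ} (h : MulUpTo q y s e (p ^ (k + 1))) (hu : HasQUnits p q)
    (h0 : e 0 = 1) (hpow : liftAdd q y s e (dp q y (p ^ k) ^ p) = e (p ^ k) ^ p) :
    MulUpTo q y s e (p ^ (k + 1) + 1) := by
  set n := p ^ k with hn
  have hnpos : 0 < n := pow_pos hp.out.pos _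
  have hp1 : p - 1 + 1 = p := Nat.sub_add_cancel hp.out.one_le
  have hN : p ^ (k + 1) = n * (p - 1) + n := by rw [pow_succ, ← Nat.mul_succ, Nat.succ_eq_add_one, hp1]
  -- `ξ^[n]^(p-1)` is a unit times `ξ^[n(p-1)]` plus lower terms, so the relation for `ξ^[n]^p`
  -- yields the defect at `(n, n(p-1))`.
  have hbase : mulDefect q y s e n (p ^ (k + 1) - n) = 0 := by
    have e1 : p ^ (k + 1) - n = n * (p - 1) := by omega
    have hmem := pow_mem_degLT (dp_mem_degLT (q := q) (y := y) n.lt_succ_self) (p - 1)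
    have hL := sub_lead_mem hmem
    rw [coeff_pow_of_mem (dp_mem_degLT n.lt_succ_self), coeff_dp_self, one_pow, mul_one] at hL
    set κ := qMultinom q n (p - 1)
    set L := dp q y n ^ (p - 1) - κ • dp q y (n * (p - 1)) with hLdef
    have e2 : dp q y n ^ (p - 1) = κ • dp q y (n * (p - 1)) + L := by rw [hLdef]; abel
    have h1 := h.map_pow h0 (dp_mem_degLT (q := q) (y := y) n.lt_succ_self) (j := p - 1) (by omega)
    rw [e2, map_add, liftAdd_smul_dp, liftAdd_dp] at h1
    rw [← hp1, pow_succ, pow_succ (e n), e2, add_mul, map_add, smul_mul_assoc, liftAdd_smul,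
      h.map_mul_of_lt hL (dp_mem_degLT n.lt_succ_self) (by omega), liftAdd_dp] at hpow
    have h2 : s κ * mulDefect q y s e (n * (p - 1)) n = 0 := by
      rw [mulDefect]
      linear_combination hpow - e n * h1
    rw [e1, mulDefect_comm]
    exact ((hu.isUnit_qMultinom_pred k).map s).mul_right_eq_zero.mp h2
  refine h.succ_of_pow hu h0 fun l hl => ?_
  have hlpos : 0 < p ^ l := pow_pos hp.out.pos _
  have hlk : l ≤ k := by
    have := (Nat.pow_lt_pow_iff_right hp.out.one_lt).mp hl
    omega
  have hln : p ^ l ≤ n := Nat.pow_le_pow_right hp.out.pos hlk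
  have hnlt : n < p ^ (k + 1) := Nat.pow_lt_pow_right hp.out.one_lt k.lt_succ_self
  -- Write `N - p^l = n(p-1) + (n - p^l)`: the second part lies below `n = p^k`, so there are no
  -- carries.
  have h1 := h.mulDefect_cocycle (a := p ^ (k + 1) - n) (b := n - p ^ l) (c := p ^ l)
    (by omega) (by omega) (by omega)
  rw [Nat.sub_add_cancel hln, hbase, mul_zero,
    show p ^ (k + 1) - n + (n - p ^ l) = p ^ (k + 1) - p ^ l by omega] at h1
  rw [mulDefect_comm]
  refine HasQUnits.eq_zero_of_mul_eq_zero hu ?_ h1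
  have h2 := natCast_choose_low_ne_zero (p := p) (l := k) (m := p - 1) (r := n - p ^ l) (by omega)
  rwa [← hn, show n * (p - 1) + (n - p ^ l) = p ^ (k + 1) - p ^ l by omega] at h2

end Prime
end QDPoly

/-! ### Systems of images of the generators, and existence of the extension -/

namespace QDPoly

variable {A : Type*} [CommRing A] {q x y : A} {B : Type*} [CommRing B] {s : A →+* B} {e : ℕ → B}
  {p : ℕ} {δA : DeltaStructure p A} {δ : DeltaStructure p (QDPoly A q y)}
  {δB : DeltaStructure p B}

/-- Conditions on the images of the generators `ξ^[n]` that make them into a homomorphism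
of `δ`-rings. -/
structure IsDeltaSystem (p : ℕ) (s : A →+* B) (x : A) (δ : DeltaStructure p (QDPoly A q y))
    (δB : DeltaStructure p B) (e : ℕ → B) : Prop where
  zero : e 0 = 1
  mul_pow_log : ∀ n, n ≠ 0 → n ≠ p ^ Nat.log p n →
    liftAdd q y s e (dp q y (p ^ Nat.log p n) * dp q y (n - p ^ Nat.log p n)) =
      e (p ^ Nat.log p n) * e (n - p ^ Nat.log p n)
  delta_one : δB (e 1) = carry p (e 1) (s x)
  frob_one : δB.frob (e 1) = s (qInt q p) * liftAdd q y s e (divFrobDp p q x y 0)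
  delta_pow : ∀ k, k ≠ 0 → liftAdd q y s e (δ (dp q y (p ^ k))) = δB (e (p ^ k))

/-- `δ(ξ)` is a polynomial in `ξ` of degree less than `p`, so multiplicativity below degree `p`
suffices. -/
theorem IsDeltaSystem.map_delta_one (he : IsDeltaSystem p s x δ δB e)
    (hst : IsStandardDelta x δA δ) (h : MulUpTo q y s e p) :
    liftAdd q y s e (δ (dp q y 1)) = δB (e 1) := by
  rw [hst.delta_dp_one, he.delta_one, h.map_carry he.zero (dp_mem_degLT one_lt_two)
    (algebraMap_mem_degLT x) fun i hi => by rw [Finset.mem_Ico] at hi; omega, liftAdd_dp,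
    liftAdd_algebraMap he.zero]

theorem IsDeltaSystem.map_delta_pow (he : IsDeltaSystem p s x δ δB e)
    (hst : IsStandardDelta x δA δ) (h : MulUpTo q y s e p) (k : ℕ) :
    liftAdd q y s e (δ (dp q y (p ^ k))) = δB (e (p ^ k)) := by
  rcases eq_or_ne k 0 with rfl | hk
  · rw [pow_zero]
    exact he.map_delta_one hst h
  · exact he.delta_pow k hk

/-- In `φ(ξ) = ξ^p + p δ(ξ)` the images of `φ(ξ)` and `δ(ξ)` are already right, hence so is that of
`ξ^p`. -/
theorem IsDeltaSystem.map_dp_one_pow (he : IsDeltaSystem p s x δ δB e)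
    (hst : IsStandardDelta x δA δ) (h : MulUpTo q y s e p) :
    liftAdd q y s e (dp q y 1 ^ p) = e 1 ^ p := by
  have h1 := congrArg (liftAdd q y s e) (hst.frob_dp 1)
  rw [frobDp_succ, liftAdd_smul, ← he.frob_one, DeltaStructure.frob_apply, map_add,
    liftAdd_natCast_mul, he.map_delta_one hst h, DeltaStructure.frob_apply] at h1
  exact add_right_cancel h1

variable [hp : Fact p.Prime]

/-- Apply `δ` to `c ξ^[n] = t^p + L` with `t = ξ^[p^k]` and compare with `B`. On the left, the
failure `Δ` for `ξ^[n]^p` enters with the factor `δ(c)`. On the right, `δ(t^p)` is a sum of products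
of `p` elements of degree at most `n`, so by `list_prod_defect` it contributes `Δ` times their
leading coefficients. All other terms agree, and the difference of the two factors is the unit of
`isUnit_delta_sub`. -/
theorem IsDeltaSystem.map_dp_pow_pow (he : IsDeltaSystem p s x δ δB e)
    (hst : IsStandardDelta x δA δ) (hs : IsDeltaHom δA δB s) (hu : HasQUnits p q) (hδq : δA q = 0)
    {k : ℕ} (h : MulUpTo q y s e (p ^ (k + 1) * p)) :
    liftAdd q y s e (dp q y (p ^ (k + 1)) ^ p) = e (p ^ (k + 1)) ^ p := by
  have h0 := he.zero
  set n' := p ^ k with hn'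
  set n := p ^ (k + 1) with hn
  have hnn' : n = n' * p := pow_succ p k
  have hppos := hp.out.pos
  have hn'pos : 0 < n' := pow_pos hppos _
  have hnpos : 0 < n := pow_pos hppos _
  have hnlt : n < n * p := lt_mul_of_one_lt_right hnpos hp.out.one_lt
  have hple : p ≤ n * p := Nat.le_mul_of_pos_left p hnpos
  have hgen := he.map_delta_pow hst (fun i j hij => h i j (by omega))
  set c := qMultinom q n' p with hc
  set t := dp q y n' with ht
  have htmem : t ∈ degLT A q y (n' + 1) := dp_mem_degLT n'.lt_succ_self
  have htp : t ^ p ∈ degLT A q y (n + 1) := by rw [hnn']; exact pow_mem_degLT htmem p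
  have hcoefft : coeff n (t ^ p) = c := by
    rw [hnn', coeff_pow_of_mem htmem, ht, coeff_dp_self, one_pow, mul_one]
  have hδt : δ t ∈ degLT A q y (n + 1) := by
    have := hst.delta_mem_degLT htmem
    rwa [mul_comm, ← hnn'] at this
  obtain ⟨w, -, hw⟩ := hst.coeff_delta_dp n'
  change _ = evalQ q w at hw
  rw [mul_comm, ← hnn', ← ht] at hw
  have hφt : δ.frob t ∈ degLT A q y (n + 1) := add_mem htp (natCast_mul_mem_degLT p hδt)
  have hcoeffφ : coeff n (δ.frob t) = c + p * evalQ q w := by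
    rw [DeltaStructure.frob_apply, map_add, hcoefft, ← nsmul_eq_mul, map_nsmul, hw, nsmul_eq_mul]
  have hvt : liftAdd q y s e t = e n' := liftAdd_dp s e n'
  have hvtp : liftAdd q y s e (t ^ p) = e n' ^ p := by
    rw [h.map_pow h0 htmem (by rw [← hnn']; exact hnlt), hvt]
  have hvδt : liftAdd q y s e (δ t) = δB (e n') := hgen k
  have hvφt : liftAdd q y s e (δ.frob t) = δB.frob (e n') := by
    rw [DeltaStructure.frob_apply, map_add, liftAdd_natCast_mul, hvtp, hvδt,
      DeltaStructure.frob_apply]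
  set Δ := liftAdd q y s e (dp q y n ^ p) - e n ^ p with hΔ
  -- the defect of the `δ` of the `p`-th power of `t`
  have hdefect : liftAdd q y s e (δ (t ^ p)) - δB (e n' ^ p) = s (evalQ q w *
      ∑ i ∈ Finset.range p, c ^ i * (c + p * evalQ q w) ^ (p - 1 - i)) * Δ := by
    rw [DeltaStructure.map_pow, DeltaStructure.map_pow, Finset.mul_sum, Finset.mul_sum,
      Finset.mul_sum, map_sum, map_sum, ← Finset.sum_sub_distrib, Finset.sum_mul]
    refine Finset.sum_congr rfl fun i hi => ?_
    rw [Finset.mem_range] at hi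
    have h1 := h.list_prod_defect h0
      (δ t :: (List.replicate i (t ^ p) ++ List.replicate (p - 1 - i) (δ.frob t))) (j := 0) (by
        intro z hz
        simp only [List.mem_cons, List.mem_append, List.mem_replicate] at hz
        rcases hz with rfl | ⟨-, rfl⟩ | ⟨-, rfl⟩
        · exact hδt
        · exact htp
        · exact hφt) (by simp; omega)
    simp only [List.map_cons, List.map_append, List.map_replicate, List.prod_cons,
      List.prod_append, List.prod_replicate, pow_zero, mul_one, hvδt, hvtp, hvφt, hw, hcoefft,
      hcoeffφ] at h1
    exact h1
  -- apply `δ` to the relation `c ξ^[n] = t ^ p + L`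
  set L := c • dp q y n - t ^ p with hL
  have hLmem : L ∈ degLT A q y (n - 1 + 1) := by
    rw [Nat.sub_add_cancel hnpos]
    have := neg_mem (sub_lead_mem htp)
    rwa [hcoefft, neg_sub] at this
  have hrel : algebraMap A _ c * dp q y n = t ^ p + L := by
    rw [hL, ← Algebra.smul_def]; abel
  have hpn : p * (n - 1) < n * p := by
    rw [mul_comm n p]; exact Nat.mul_lt_mul_of_pos_left (by omega) hppos
  -- `L` has degree at most `n - 1`, so `δ(L)` stays within the range where multiplicativity is
  -- known.
  have hvL : liftAdd q y s e (δ L) = δB (liftAdd q y s e L) :=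
    h.map_delta hst hs hu h0 hpn (fun j _ => hgen j) hLmem
  have hcarry : liftAdd q y s e (carry p (t ^ p) L) =
      carry p (e n' ^ p) (liftAdd q y s e L) := by
    rw [h.map_carry h0 htp hLmem fun i hi => ?_, hvtp]
    rw [Finset.mem_Ico] at hi
    have h1 : (n - 1) * (p - i) < n * (p - i) := Nat.mul_lt_mul_of_pos_right (by omega) (by omega)
    have h2 : n * i + n * (p - i) = n * p := by rw [← mul_add, Nat.add_sub_cancel' hi.2.le]
    omega
  have hD := congrArg (fun z => liftAdd q y s e (δ z)) hrel
  have hB := congrArg (fun z => δB (liftAdd q y s e z)) hrel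
  simp only [DeltaStructure.map_mul, DeltaStructure.map_add, ← hst.algebraMap_delta c] at hD
  have hassoc : (p : QDPoly A q y) * algebraMap A _ (δA c) * δ (dp q y n) =
      algebraMap A _ (δA c) * (p * δ (dp q y n)) := by ring
  rw [hassoc, mul_comm (dp q y n ^ p), map_sub, map_add, map_add, map_add, ← map_pow,
    liftAdd_algebraMap_mul, liftAdd_algebraMap_mul, liftAdd_algebraMap_mul, liftAdd_natCast_mul,
    hgen (k + 1), hvL, hcarry] at hD
  simp only [liftAdd_algebraMap_mul, map_add, liftAdd_dp, hvtp, DeltaStructure.map_mul,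
    DeltaStructure.map_add, ← hs c] at hB
  have hfinal : s (δA c - evalQ q w *
      ∑ i ∈ Finset.range p, c ^ i * (c + p * evalQ q w) ^ (p - 1 - i)) * Δ = 0 := by
    rw [map_sub, sub_mul, ← hdefect, hΔ]
    rw [map_pow] at hD
    linear_combination hD - hB
  exact sub_eq_zero.mp
    (((hu.isUnit_delta_sub δA hδq k w).map s).mul_right_eq_zero.mp hfinal)

theorem IsDeltaSystem.mulUpTo (he : IsDeltaSystem p s x δ δB e)
    (hst : IsStandardDelta x δA δ) (hs : IsDeltaHom δA δB s) (hu : HasQUnits p q) (hδq : δA q = 0)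
    (N : ℕ) : MulUpTo q y s e N := by
  induction N with
  | zero => exact fun i j hij => absurd hij (by omega)
  | succ N ih =>
    rcases eq_or_ne N 0 with rfl | hN0
    · intro i j hij
      rw [show i = 0 by omega, show j = 0 by omega, dp_zero, one_mul, liftAdd_one he.zero, he.zero,
        one_mul]
    by_cases hpow : N = p ^ Nat.log p N
    · rcases hk : Nat.log p N with _ | k
      · rw [hk, pow_zero] at hpow
        subst hpow
        intro i j hij
        rcases Nat.eq_zero_or_pos i with rfl | hi
        · rw [dp_zero, one_mul, liftAdd_dp, he.zero, one_mul]
        · rw [show j = 0 by omega, dp_zero, mul_one, liftAdd_dp, he.zero, mul_one]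
      · rw [hk] at hpow
        subst hpow
        refine ih.succ_of_eq_pow hu he.zero ?_
        rcases k with _ | k
        · rw [zero_add, pow_one] at ih
          rw [pow_zero]
          exact he.map_dp_one_pow hst ih
        · rw [pow_succ] at ih
          exact he.map_dp_pow_pow hst hs hu hδq ih
    · exact ih.succ_of_ne_pow hu he.zero hN0 hpow (he.mul_pow_log N hN0 hpow)

/-- The homomorphism attached to a system. -/
noncomputable def IsDeltaSystem.hom (he : IsDeltaSystem p s x δ δB e)
    (hst : IsStandardDelta x δA δ) (hs : IsDeltaHom δA δB s) (hu : HasQUnits p q)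
    (hδq : δA q = 0) : QDPoly A q y →+* B :=
  liftHom s e he.zero fun i j => he.mulUpTo hst hs hu hδq _ i j (i + j).lt_succ_self

theorem IsDeltaSystem.isDeltaHom_hom (he : IsDeltaSystem p s x δ δB e)
    (hst : IsStandardDelta x δA δ) (hs : IsDeltaHom δA δB s) (hu : HasQUnits p q)
    (hδq : δA q = 0) : IsDeltaHom δ δB (he.hom hst hs hu hδq) := by
  intro z
  obtain ⟨N, hN⟩ := exists_mem_degLT z
  exact (he.mulUpTo hst hs hu hδq _).map_delta hst hs hu he.zero (p * N).lt_succ_self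
    (fun k _ => he.map_delta_pow hst (he.mulUpTo hst hs hu hδq p) k)
    (degLT_mono N.le_succ hN)

/-- Existence of the images of the generators. -/
theorem exists_isDeltaSystem (hst : IsStandardDelta x δA δ) (hu : HasQUnits p q) (s : A →+* B)
    {f g : B} (hf : δB f = carry p f (s x)) (hg : δB.frob f = s (qInt q p) * g) :
    ∃ e, e 1 = f ∧ IsDeltaSystem p s x δ δB e := by
  have hp1 := hp.out.one_lt
  obtain ⟨e, he⟩ := exists_liftAdd_seq (q := q) (y := y) s (fun n e =>
    (n = 0 → e 0 = 1) ∧ (n = 1 → e 1 = f) ∧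
    (n ≠ 0 → n ≠ p ^ Nat.log p n →
      liftAdd q y s e (dp q y (p ^ Nat.log p n) * dp q y (n - p ^ Nat.log p n)) =
        e (p ^ Nat.log p n) * e (n - p ^ Nat.log p n)) ∧
    (n = p → liftAdd q y s e (divFrobDp p q x y 0) = g) ∧
    (∀ k, k ≠ 0 → n = p ^ (k + 1) → liftAdd q y s e (δ (dp q y (p ^ k))) = δB (e (p ^ k)))) (by
    intro n
    by_cases hn0 : n = 0
    · subst hn0
      refine ⟨dp q y 0, fun _ => 1, dp_mem_degLT one_pos, by simp, fun _ _ _ => rfl,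
        fun e he => ⟨fun _ => by rwa [liftAdd_dp] at he, by simp, by simp, fun h => ?_,
          fun k _ h => ?_⟩⟩
      · omega
      · have := pow_pos hp.out.pos (k + 1); omega
    by_cases hpow : n = p ^ Nat.log p n
    · rcases hk : Nat.log p n with _ | k
      · rw [hk, pow_zero] at hpow
        subst hpow
        refine ⟨dp q y 1, fun _ => f, dp_mem_degLT one_lt_two, by simp, fun _ _ _ => rfl,
          fun e he => ⟨by simp, fun _ => by rwa [liftAdd_dp] at he, fun _ h => ?_, fun h => ?_,
            fun k _ h => ?_⟩⟩
        · simp at h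
        · omega
        · exact absurd h (Nat.one_lt_pow k.succ_ne_zero hp1).ne
      rw [hk] at hpow
      have hlog : ∀ m, n = p ^ m → m = k + 1 := fun m hm =>
        Nat.pow_right_injective hp.out.two_le (hm.symm.trans hpow)
      -- Degree `p` is special: `δ(ξ)` has degree below `p` and cannot determine `e_p`. The quotient
      -- `φ(ξ)/(p)_q` is used instead, with image `g`.
      rcases eq_or_ne k 0 with rfl | hk0
      · rw [zero_add, pow_one] at hpow
        subst hpow
        have h1 := divFrobDp_mem_degLT (q := q) (x := x) (y := y) n 0
        have h2 := coeff_divFrobDp (q := q) (x := x) (y := y) n 0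
        rw [zero_add, mul_one] at h1 h2
        refine ⟨divFrobDp n q x y 0, fun _ => g, h1, ?_, fun _ _ _ => rfl,
          fun e he => ⟨fun h => absurd h hn0, fun h => absurd h hp1.ne', fun _ h => ?_,
            fun _ => he, fun k hk h => ?_⟩⟩
        · rw [h2]
          exact hu.isUnit_divFrobLead_zero
        · rw [zero_add, pow_one] at h
          exact absurd rfl h
        · have := hlog _ h
          omega
      · obtain ⟨w, hw, hw'⟩ := hst.coeff_delta_dp (p ^ k)
        have h1 := hst.delta_dp_mem_degLT (p ^ k)
        have e1 : p * p ^ k = n := by rw [hpow, pow_succ']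
        rw [e1] at h1 hw'
        have h2 : 1 < p ^ k := Nat.one_lt_pow hk0 hp1
        have h3 : p ^ k < n := hpow ▸ Nat.pow_lt_pow_right hp1 k.lt_succ_self
        refine ⟨δ (dp q y (p ^ k)), fun e => δB (e (p ^ k)), h1, ?_,
          fun e e' h => congrArg δB.toFun (h _ h3),
          fun e he => ⟨fun h => absurd h hn0, fun h => ?_, fun _ h => ?_, fun h => ?_,
            fun j hj h => ?_⟩⟩
        · rw [hw']
          obtain ⟨m, hm⟩ : ∃ m, m + 2 = p ^ k := ⟨p ^ k - 2, by omega⟩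
          exact hu.isUnit_coeff_delta hm (by rw [hm]; exact hw)
        · omega
        · exact absurd hpow h
        · have := hlog 1 (by rw [h, pow_one])
          omega
        · have := hlog _ h
          obtain rfl : j = k := by omega
          exact he
    · set P := p ^ Nat.log p n with hP
      have hPn : P ≤ n := Nat.pow_log_le_self p hn0
      have hPlt : P < n := lt_of_le_of_ne hPn (Ne.symm hpow)
      have hPpos : 0 < P := pow_pos hp.out.pos _
      have h1 := dp_mul_dp_mem_degLT (q := q) (y := y) (n - P) P
      have h2 := coeff_dp_mul_dp (q := q) (y := y) (n - P) P
      rw [Nat.add_sub_cancel' hPn] at h1 h2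
      have hnot : ∀ m, n ≠ p ^ m := fun m hm => hpow (by rw [hP, hm, Nat.log_pow hp1])
      refine ⟨dp q y P * dp q y (n - P), fun e => e P * e (n - P), h1, ?_,
        fun e e' h => by simp only [h P hPlt, h (n - P) (by omega)],
        fun e he => ⟨fun h => absurd h hn0, fun h => ?_, fun _ _ => he, fun h => ?_,
          fun j _ h => absurd h (hnot _)⟩⟩
      · rw [h2]
        refine hu.isUnit_qBinom ?_
        rw [Nat.choose_symm hPn]
        exact natCast_choose_pow_log_ne_zero hn0
      · exact absurd h (by simpa using hnot 0)
      · exact absurd h (by simpa using hnot 1))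
  have he1 : e 1 = f := (he 1).2.1 rfl
  refine ⟨e, he1, (he 0).1 rfl, fun n => (he n).2.2.1, by rw [he1, hf], ?_, fun k hk =>
    (he (p ^ (k + 1))).2.2.2.2 k hk rfl⟩
  rw [he1, (he p).2.2.2.1 rfl, hg]

end QDPoly

/-! ### The `δ`-structure on `A[ξ]` -/

section Polynomial

open Polynomial

variable {p : ℕ} {A : Type*} [CommRing A] {δA : DeltaStructure p A} {x : A}

theorem isPolyDelta_iff {δP : DeltaStructure p (Polynomial A)} :
    IsPolyDelta δA x δP ↔ IsDeltaHom δA δP C ∧ δP X = carry p X (C x) := by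
  have h : ∑ i ∈ Finset.Ico 1 p, C (((p.choose i / p : ℕ) : A) * x ^ (p - i)) * X ^ i =
      carry p X (C x) := by
    refine Finset.sum_congr rfl fun i _ => ?_
    simp only [map_mul, map_natCast, map_pow]
    ring
  rw [IsPolyDelta, h]

/-- A section `A[ξ] → W2 p A[ξ]` is a ring homomorphism, hence determined by its restriction to `A`
and by a freely chosen second component for the image of `ξ`. -/
theorem existsUnique_isPolyDelta [hp : Fact p.Prime] (δA : DeltaStructure p A) (x : A) :
    ∃! δP : DeltaStructure p (Polynomial A), IsPolyDelta δA x δP := by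
  let s : Polynomial A →+* W2 p (Polynomial A) :=
    eval₂RingHom ((W2.map p C).comp δA.toW2) ⟨X, carry p X (C x)⟩
  have hs : (W2.fstHom p _).comp s = RingHom.id _ :=
    Polynomial.ringHom_ext' (RingHom.ext fun a => by simp [s]) (by simp [s])
  refine ⟨DeltaStructure.ofW2 s fun a => RingHom.congr_fun hs a,
    isPolyDelta_iff.mpr ⟨fun a => ?_, ?_⟩, fun δ hδ => ?_⟩
  · change C (δA a) = (s (C a)).snd
    simp [s]
  · change (s X).snd = _
    simp [s]
  · obtain ⟨h1, h2⟩ := isPolyDelta_iff.mp hδ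
    have h3 : δ.toW2 = s := by
      refine Polynomial.ringHom_ext' (RingHom.ext fun a => ?_) ?_
      · ext1
        · simp [s]
        · simp [s, ← h1 a]
      · ext1
        · simp [s]
        · simp [s, h2]
    exact DeltaStructure.ext (funext fun a => congrArg W2.snd (RingHom.congr_fun h3 a))

end Polynomial

/-! ### The operation `γ` and generation of `I^[1]` -/

namespace QDPoly

section AlgebraMap

variable {A : Type*} [CommRing A] {q y : A} {R : Type*} [CommRing R] [Algebra R A] {r : R}

theorem algebraMap_eq_comp (a : R) :
    algebraMap R (QDPoly A q y) a = algebraMap A _ (algebraMap R A a) := by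
  rw [algebraMap_apply, algebraMap_apply, algebraMap_smul]

theorem algebraMap_mul_eq_smul (hr : q = algebraMap R A r) (n : ℕ) (z : QDPoly A q y) :
    algebraMap R (QDPoly A q y) (qInt r n) * z = qInt q n • z := by
  rw [algebraMap_eq_comp, map_qInt, ← hr, Algebra.smul_def]

/-- `δ`-homomorphisms commute with `γ`; the relation is kept multiplied by `(p)_q`, so no torsion
hypothesis enters. -/
theorem map_gamma {p : ℕ} {δ : DeltaStructure p (QDPoly A q y)} {B : Type*} [CommRing B]
    [Algebra R B] {δB : DeltaStructure p B} (hr : q = algebraMap R A r) {v : QDPoly A q y →ₐ[R] B}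
    (hv : IsDeltaHom δ δB (v : QDPoly A q y →+* B)) {z h : QDPoly A q y}
    (hh : δ.frob z - qInt q p • δ z = qInt q p • h) :
    δB.frob (v z) - algebraMap R B (qInt r p) * δB (v z) = algebraMap R B (qInt r p) * v h := by
  have hvδ : v (δ z) = δB (v z) := hv z
  rw [← algebraMap_mul_eq_smul hr, ← algebraMap_mul_eq_smul hr] at hh
  have h1 := congrArg v hh
  rw [map_sub, map_mul, map_mul, AlgHom.commutes, hvδ, DeltaStructure.frob_apply, map_add, map_pow,
    map_mul, map_natCast, hvδ] at h1
  exact h1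

end AlgebraMap

variable {p : ℕ} [hp : Fact p.Prime] {A : Type*} [CommRing A] {q x y : A} {δA : DeltaStructure p A}
  {δ : DeltaStructure p (QDPoly A q y)}

theorem IsStandardDelta.delta_mem_filt_one (hst : IsStandardDelta x δA δ) {z : QDPoly A q y}
    (hz : z ∈ filt q y 1) : δ z ∈ filt q y 1 := by
  refine filt_one_induction (P := fun z => δ z ∈ filt q y 1) (by simp) ?_ ?_ hz
  · intro a b ha hb h1 h2
    rw [DeltaStructure.map_add]
    refine sub_mem (add_mem h1 h2) (sum_mem fun i hi => ?_)
    rw [Finset.mem_Ico] at hi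
    exact Ideal.mul_mem_left _ _ (Ideal.pow_mem_of_mem _ hb _ (by omega))
  · intro r n hn
    rw [Algebra.smul_def, DeltaStructure.map_mul]
    have h1 := hst.delta_dp_mem_filt n hn
    exact add_mem (add_mem (Ideal.mul_mem_left _ _ h1) (Ideal.mul_mem_right _ _
      (Ideal.pow_mem_of_mem _ (dp_mem_filt_one hn) _ hp.out.pos))) (Ideal.mul_mem_left _ _ h1)

/-- Sharper than the `q`-PD-pair condition: the quotient lies in `I^[1]` because `φ(ξ^[n+1])/(p)_q`
is a primitive. This is what `γ`-stability needs. -/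
theorem IsStandardDelta.exists_frob_eq (hst : IsStandardDelta x δA δ) {z : QDPoly A q y}
    (hz : z ∈ filt q y 1) : ∃ h ∈ filt q y 1, δ.frob z = qInt q p • h := by
  refine filt_one_induction (P := fun z => ∃ h ∈ filt q y 1, δ.frob z = qInt q p • h)
    ⟨0, zero_mem _, ?_⟩ ?_ ?_ hz
  · rw [← DeltaStructure.frobHom_apply, map_zero, smul_zero]
  · rintro a b - - ⟨u, hu, hu'⟩ ⟨v, hv, hv'⟩
    refine ⟨u + v, add_mem hu hv, ?_⟩
    rw [smul_add, ← hu', ← hv', ← DeltaStructure.frobHom_apply, map_add]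
    rfl
  · intro r n hn
    obtain ⟨n, rfl⟩ := Nat.exists_eq_succ_of_ne_zero hn
    refine ⟨δ.frob (algebraMap A _ r) * divFrobDp p q x y n,
      Ideal.mul_mem_left _ _ (divFrobDp_mem_filt_one p n), ?_⟩
    rw [Algebra.smul_def, ← DeltaStructure.frobHom_apply, map_mul, DeltaStructure.frobHom_apply,
      DeltaStructure.frobHom_apply, hst.frob_dp, frobDp_succ, mul_smul_comm]

/-- Subtract the lower terms and invert the leading coefficient. As `S` need not contain `1`, the
constant term of `Z` has to vanish. -/
theorem dp_mem_of_isUnit_coeff {S : Submodule A (QDPoly A q y)} {n : ℕ} (hn : n ≠ 0)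
    (hlow : ∀ m < n, m ≠ 0 → dp q y m ∈ S) {Z : QDPoly A q y} (hZ : Z ∈ degLT A q y (n + 1))
    (hZ0 : Z ∈ filt q y 1) (hlead : IsUnit (coeff n Z)) (hZS : Z ∈ S) : dp q y n ∈ S := by
  have hL : Z - coeff n Z • dp q y n ∈ S := by
    have h0 : coeff 0 (Z - coeff n Z • dp q y n) = 0 := by
      rw [map_sub, map_smul, mem_filt_one.mp hZ0, coeff_dp_of_ne hn, smul_zero, sub_zero]
    have h1 := degLT_induction (P := fun w => w - coeff 0 w • dp q y 0 ∈ S) (by simp) (by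
      intro u v _ _ hu hv
      rw [map_add, add_smul, add_sub_add_comm]
      exact add_mem hu hv) (by
      intro r m hm
      rcases eq_or_ne m 0 with rfl | hm0
      · simp
      · rw [map_smul, coeff_dp_of_ne hm0, smul_zero, zero_smul, sub_zero]
        exact S.smul_mem r (hlow m hm hm0)) (sub_lead_mem hZ)
    rwa [h0, zero_smul, sub_zero] at h1
  obtain ⟨b, hb⟩ := hlead.exists_left_inv
  have h2 := S.smul_mem b (sub_mem hZS hL)
  rwa [sub_sub_cancel, smul_smul, hb, one_smul] at h2

/-- The ideal `I^[1]` is generated by `ξ` under products and the operation `γ`. -/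
theorem IsStandardDelta.dp_mem_of_gamma (hst : IsStandardDelta x δA δ) (hu : HasQUnits p q)
    {S : Submodule A (QDPoly A q y)} (h1 : dp q y 1 ∈ S)
    (hmul : ∀ z ∈ S, ∀ w ∈ S, z * w ∈ S)
    (hgamma : ∀ z ∈ S, ∀ h, δ.frob z - qInt q p • δ z = qInt q p • h → h ∈ S) {n : ℕ}
    (hn : n ≠ 0) : dp q y n ∈ S := by
  have hp1 := hp.out.one_lt
  induction n using Nat.strong_induction_on with
  | _ n ih =>
  by_cases hpow : n = p ^ Nat.log p n
  · rcases hk : Nat.log p n with _ | k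
    · rw [hk, pow_zero] at hpow
      rwa [hpow]
    · rw [hk] at hpow
      obtain ⟨m, hm⟩ := Nat.exists_eq_succ_of_ne_zero (pow_pos hp.out.pos k).ne'
      have e1 : p * (m + 1) = n := by rw [hpow, pow_succ', hm]
      have hlt : m + 1 < n := by
        rw [hpow, ← Nat.succ_eq_add_one, ← hm]
        exact Nat.pow_lt_pow_right hp1 k.lt_succ_self
      have h2 := divFrobDp_mem_degLT (q := q) (x := x) (y := y) p m
      have h3 := coeff_divFrobDp (q := q) (x := x) (y := y) p m
      have h4 := hst.delta_dp_mem_degLT (m + 1)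
      obtain ⟨w, hw, h5⟩ := hst.coeff_delta_dp (m + 1)
      rw [e1] at h2 h3 h4 h5
      -- `Z` is `γ(ξ^[p^k])` with `m + 1 = p^k`; its top degree is `p · p^k = n`.
      refine dp_mem_of_isUnit_coeff hn ih (Z := divFrobDp p q x y m - δ (dp q y (m + 1)))
        (sub_mem h2 h4) (sub_mem (divFrobDp_mem_filt_one p m)
        (hst.delta_dp_mem_filt _ m.succ_ne_zero)) ?_
        (hgamma _ (ih (m + 1) hlt m.succ_ne_zero) _ ?_)
      · rw [map_sub, h3, h5]
        exact hu.isUnit_divFrobLead_sub hm.symm hw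
      · rw [hst.frob_dp, frobDp_succ, smul_sub]
  · have hPn : p ^ Nat.log p n ≤ n := Nat.pow_log_le_self p hn
    have hPpos : 0 < p ^ Nat.log p n := pow_pos hp.out.pos _
    set P := p ^ Nat.log p n
    have hPlt : P < n := lt_of_le_of_ne hPn (Ne.symm hpow)
    have h2 := dp_mul_dp_mem_degLT (q := q) (y := y) (n - P) P
    have h3 := coeff_dp_mul_dp (q := q) (y := y) (n - P) P
    rw [Nat.add_sub_cancel' hPn] at h2 h3
    refine dp_mem_of_isUnit_coeff hn ih h2
      (Ideal.mul_mem_right _ _ (dp_mem_filt_one hPpos.ne')) ?_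
      (hmul _ (ih P hPlt hPpos.ne') _ (ih (n - P) (by omega) (by omega)))
    rw [h3]
    refine hu.isUnit_qBinom ?_
    rw [Nat.choose_symm hPn]
    exact natCast_choose_pow_log_ne_zero hn

/-! ### The `q`-PD-envelope -/

section Envelope

variable {R : Type*} [CommRing R] [Algebra R A] {δR : DeltaStructure p R} {r : R}

theorem IsStandardDelta.isQPDPair (hst : IsStandardDelta x δA δ)
    (hA : IsDeltaHom δR δA (algebraMap R A)) (hr : q = algebraMap R A r)
    (htf : IsTorsionFree p r A) : IsQPDPair δR r δ (filt q y 1) where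
  algebraMap_delta a := by
    rw [algebraMap_eq_comp (δR a), algebraMap_eq_comp a, hA, hst.algebraMap_delta]
  torsionFree b hb := by
    rw [algebraMap_mul_eq_smul hr] at hb
    refine ext_coeff fun n => ?_
    rw [map_zero]
    refine htf _ ?_
    have := congrArg (coeff n) hb
    rwa [map_smul, map_zero, smul_eq_mul, hr, ← map_qInt] at this
  frob_mem f hf := by
    obtain ⟨h, -, hh⟩ := hst.exists_frob_eq hf
    exact ⟨h, by rw [hh, algebraMap_mul_eq_smul hr]⟩

theorem IsStandardDelta.isGammaStable (hst : IsStandardDelta x δA δ)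
    (hr : q = algebraMap R A r) : IsGammaStable r δ (filt q y 1) := by
  intro f hf
  obtain ⟨h, hh, e⟩ := hst.exists_frob_eq hf
  refine ⟨h - δ f, sub_mem hh (hst.delta_mem_filt_one hf), ?_⟩
  rw [algebraMap_mul_eq_smul hr, algebraMap_mul_eq_smul hr, e, smul_sub]

theorem ofPoly_C (a : A) : ofPoly q y (Polynomial.C a) = algebraMap A _ a :=
  Polynomial.aeval_C _ a

theorem ofPoly_X : ofPoly q y Polynomial.X = dp q y 1 := Polynomial.aeval_X _

theorem IsStandardDelta.isDeltaHom_ofPoly (hst : IsStandardDelta x δA δ)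
    {δP : DeltaStructure p (Polynomial A)} (hP : IsPolyDelta δA x δP) :
    IsDeltaHom δP δ (ofPoly q y : Polynomial A →+* QDPoly A q y) := by
  obtain ⟨h1, h2⟩ := isPolyDelta_iff.mp hP
  rw [DeltaStructure.isDeltaHom_iff]
  refine Polynomial.ringHom_ext' (RingHom.ext fun a => ?_) ?_
  · ext1
    · rfl
    · change ofPoly q y (δP (Polynomial.C a)) = δ (ofPoly q y (Polynomial.C a))
      rw [← h1, ofPoly_C, ofPoly_C, hst.algebraMap_delta]
  · ext1
    · rfl
    · change ofPoly q y (δP Polynomial.X) = δ (ofPoly q y Polynomial.X)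
      rw [h2, ofPoly_X, hst.delta_dp_one, ← RingHom.coe_coe, map_carry, RingHom.coe_coe, ofPoly_C,
        ofPoly_X]

variable {B : Type*} [CommRing B] [Algebra R B] {δB : DeltaStructure p B} {J : Ideal B}

/-- The preimage of `J` is an `A`-submodule containing `ξ`, closed under products and under `γ`; so
it contains all generators of `I^[1]`. -/
theorem IsStandardDelta.map_filt_le (hst : IsStandardDelta x δA δ) (hu : HasQUnits p q)
    (hr : q = algebraMap R A r) (hB : IsQPDPair δR r δB J) (hJ : IsGammaStable r δB J)
    {v : QDPoly A q y →ₐ[R] B} (hv : IsDeltaHom δ δB (v : QDPoly A q y →+* B))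
    (h1 : v (dp q y 1) ∈ J) : (filt q y 1).map v ≤ J := by
  let S : Submodule A (QDPoly A q y) :=
    { carrier := {z | v z ∈ J}
      add_mem' := fun ha hb => by
        change v _ ∈ J
        rw [map_add]; exact add_mem ha hb
      zero_mem' := by
        change v 0 ∈ J
        rw [map_zero]; exact zero_mem J
      smul_mem' := fun c z hz => by
        change v _ ∈ J
        rw [Algebra.smul_def, map_mul]; exact J.mul_mem_left _ hz }
  have hS : ∀ n, n ≠ 0 → dp q y n ∈ S := fun n hn =>
    hst.dp_mem_of_gamma hu (S := S) h1 (fun z hz w _ => by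
      change v (z * w) ∈ J
      rw [map_mul]; exact J.mul_mem_right _ hz) (fun z hz h hh => by
      obtain ⟨g, hg, hg'⟩ := hJ (v z) hz
      rw [map_gamma hr hv hh] at hg'
      have : v h = g := sub_eq_zero.mp (hB.torsionFree _ (by rw [mul_sub, hg', sub_self]))
      change v h ∈ J
      rwa [this]) hn
  rw [Ideal.map_le_iff_le_comap]
  intro z hz
  refine filt_one_induction (P := fun z => z ∈ S) (zero_mem S) (fun a b _ _ => S.add_mem)
    (fun c n hn => S.smul_mem c (hS n hn)) hz

/-- The equalizer of `v` and `v'` is closed under `γ`, because `(p)_q` can be cancelled in `B`; so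
it contains everything generated by `ξ`. -/
theorem IsStandardDelta.algHom_ext (hst : IsStandardDelta x δA δ) (hu : HasQUnits p q)
    (hr : q = algebraMap R A r) (htf : IsTorsionFree p r B) {v v' : QDPoly A q y →ₐ[R] B}
    (hv : IsDeltaHom δ δB (v : QDPoly A q y →+* B)) (hv' : IsDeltaHom δ δB (v' : QDPoly A q y →+* B))
    (h : v.comp ((ofPoly q y).restrictScalars R) = v'.comp ((ofPoly q y).restrictScalars R)) :
    v = v' := by
  have hA : ∀ a : A, v (algebraMap A _ a) = v' (algebraMap A _ a) := fun a => by
    rw [← ofPoly_C]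
    exact AlgHom.congr_fun h (Polynomial.C a)
  let S : Submodule A (QDPoly A q y) :=
    { carrier := {z | v z = v' z}
      add_mem' := fun {a b} ha hb => by
        change v _ = v' _
        rw [map_add, map_add, show v a = v' a from ha, show v b = v' b from hb]
      zero_mem' := by
        change v 0 = v' 0
        rw [map_zero, map_zero]
      smul_mem' := fun c z hz => by
        change v _ = v' _
        rw [Algebra.smul_def, map_mul, map_mul, hA, show v z = v' z from hz] }
  have h1 : v (dp q y 1) = v' (dp q y 1) := by
    rw [← ofPoly_X]
    exact AlgHom.congr_fun h Polynomial.X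
  have hS : ∀ n, n ≠ 0 → dp q y n ∈ S := fun n hn =>
    hst.dp_mem_of_gamma hu (S := S) h1 (fun z hz w hw => by
      change v (z * w) = v' (z * w)
      rw [map_mul, map_mul, show v z = v' z from hz, show v w = v' w from hw])
      (fun z hz g hg => by
      have h2 := map_gamma hr hv hg
      have h3 := map_gamma hr hv' hg
      rw [show v z = v' z from hz, h3] at h2
      exact (sub_eq_zero.mp (htf _ (by rw [mul_sub, h2, sub_self]))).symm) hn
  refine AlgHom.coe_ringHom_injective (ringHom_ext hA fun n => ?_)
  rcases eq_or_ne n 0 with rfl | hn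
  · rw [dp_zero, map_one, map_one]
  · exact hS n hn

/-- Two facts about the image `f` of `ξ` feed the recursion: `δ(f) = carry p f (s x)`, since `u`
commutes with `δ`, and `φ(f) ∈ (p)_q B`, since `f ∈ J`. -/
theorem IsStandardDelta.exists_lift (hst : IsStandardDelta x δA δ) (hu : HasQUnits p q)
    (hδq : δA q = 0) (hr : q = algebraMap R A r) {δP : DeltaStructure p (Polynomial A)}
    (hP : IsPolyDelta δA x δP) (hB : IsQPDPair δR r δB J) {u : Polynomial A →ₐ[R] B}
    (huδ : IsDeltaHom δP δB (u : Polynomial A →+* B)) (huJ : u Polynomial.X ∈ J) :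
    ∃ v : QDPoly A q y →ₐ[R] B, IsDeltaHom δ δB (v : QDPoly A q y →+* B) ∧
      v.comp ((ofPoly q y).restrictScalars R) = u := by
  obtain ⟨hPC, hPX⟩ := isPolyDelta_iff.mp hP
  set s : A →+* B := (u : Polynomial A →+* B).comp Polynomial.C with hs
  have hsδ : IsDeltaHom δA δB s := fun a => by
    change u (Polynomial.C (δA a)) = _
    rw [hPC]
    exact huδ _
  have hsR : ∀ a : R, s (algebraMap R A a) = algebraMap R B a := fun a => by
    rw [← u.commutes a]
    rfl
  have hf : δB (u Polynomial.X) = carry p (u Polynomial.X) (s x) := by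
    have h1 : u (δP Polynomial.X) = δB (u Polynomial.X) := huδ _
    rw [← h1, hPX]
    exact map_carry (u : Polynomial A →+* B) _ _
  obtain ⟨g, hg⟩ := hB.frob_mem _ huJ
  rw [← hsR, map_qInt (algebraMap R A), ← hr] at hg
  obtain ⟨e, he1, he⟩ := exists_isDeltaSystem hst hu s hf hg
  have hvA : ∀ a, he.hom hst hsδ hu hδq (algebraMap A _ a) = s a := liftAdd_algebraMap he.zero
  refine ⟨{ he.hom hst hsδ hu hδq with
    commutes' := fun a => ?_ }, he.isDeltaHom_hom hst hsδ hu hδq, ?_⟩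
  · change he.hom hst hsδ hu hδq (algebraMap R _ a) = _
    rw [algebraMap_eq_comp, hvA, hsR]
  · refine AlgHom.coe_ringHom_injective (Polynomial.ringHom_ext' (RingHom.ext fun a => ?_) ?_)
    · change he.hom hst hsδ hu hδq (ofPoly q y (Polynomial.C a)) = s a
      rw [ofPoly_C, hvA]
    · change he.hom hst hsδ hu hδq (ofPoly q y Polynomial.X) = u Polynomial.X
      rw [ofPoly_X, ← he1]
      exact liftAdd_dp s e 1

end Envelope
end QDPoly
end QDiv

theorem proposition6p1 {p : ℕ} [Fact p.Prime]
    {R : Type uR} [CommRing R] [Algebra (PowerSeries ℤ_[p]) R]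
    (δR : QDiv.DeltaStructure p R) (q : R)
    (hq : q = algebraMap (PowerSeries ℤ_[p]) R (1 + PowerSeries.X)) (hδq : δR q = 0)
    {A : Type uA} [CommRing A] [Algebra R A]
    (δA : QDiv.DeltaStructure p A) (hA : QDiv.IsDeltaHom δR δA (algebraMap R A))
    (x : A) (hδx : δA x = 0) (htf : QDiv.IsTorsionFree p q A)
    (qA y : A) (hqA : qA = algebraMap R A q) (hy : y = (1 - qA) * x) :
    (∃! δP : QDiv.DeltaStructure p (Polynomial A), QDiv.IsPolyDelta δA x δP) ∧
    ∀ δP : QDiv.DeltaStructure p (Polynomial A), QDiv.IsPolyDelta δA x δP →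
      ∃ δD : QDiv.DeltaStructure p (QDiv.QDPoly A qA y),
        QDiv.IsQPDEnvelope.{uR, uA, uA, w} δR q δP (Ideal.span {Polynomial.X})
          δD (QDiv.QDPoly.filt qA y 1)
          ((QDiv.QDPoly.ofPoly qA y).restrictScalars R) := by
  have hδqA : δA qA = 0 := by rw [hqA, ← hA, hδq, map_zero]
  have hu : QDiv.HasQUnits p qA := by
    rw [hqA, hq]
    exact (QDiv.hasQUnits_powerSeries.map (algebraMap (PowerSeries ℤ_[p]) R)).map (algebraMap R A)
  refine ⟨QDiv.existsUnique_isPolyDelta δA x, fun δP hP => ?_⟩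
  obtain ⟨δD, hst⟩ := QDiv.QDPoly.exists_standardDelta hy δA hδqA hδx
  refine ⟨δD, hst.isQPDPair hA hqA htf, hst.isGammaStable hqA, hst.isDeltaHom_ofPoly hP, ?_, ?_, ?_⟩
  · rw [Ideal.map_span, Set.image_singleton, Ideal.span_singleton_le_iff_mem]
    change QDiv.QDPoly.ofPoly qA y Polynomial.X ∈ _
    rw [QDiv.QDPoly.ofPoly_X]
    exact QDiv.QDPoly.dp_mem_filt_one one_ne_zero
  · intro B _ _ δB J hB u huδ huJ
    have hX : u Polynomial.X ∈ J := huJ (Ideal.mem_map_of_mem u (Ideal.mem_span_singleton_self _))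
    obtain ⟨v, hv, hvu⟩ := hst.exists_lift hu hδqA hqA hP hB huδ hX
    exact ⟨v, ⟨hv, hvu⟩, fun v' hv' =>
      hst.algHom_ext hu hqA hB.torsionFree hv'.1 hv (hv'.2.trans hvu.symm)⟩
  · intro B _ _ δB J hB hJ v hv hvJ
    refine hst.map_filt_le hu hqA hB hJ hv ?_
    have hX := hvJ (Ideal.mem_map_of_mem (v.comp ((QDiv.QDPoly.ofPoly qA y).restrictScalars R))
      (Ideal.mem_span_singleton_self (Polynomial.X : Polynomial A)))
    rw [← QDiv.QDPoly.ofPoly_X]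
    exact hX
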